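/- Let $\Phi : M \to N$ be a smooth map of finite-dimensional (Hausdorff, second countable) smooth manifolds. *Covers.* A cover of $\Phi$ consists of open covers $\mathcal U=(U_i)_{i\in I}$ of $M$ and $\mathcal V=(V_j)_{j\in J}$ of $N$ with a map $r : I\to J$ such that $\Phi(U_i)\subseteq V_{r(i)}$. Refinements are pairs of index maps compatible with the inclusions and with the maps $r$. *Relative cohomology.* For a sheaf of abelian groups $A$ of functions (locally constant $\mathbb Z$-valued functions, or the sheaf $\underline{U(1)}$ of smooth $U(1)$-valued functions), $H^q(\Phi,A)$ is the direct limit over all covers of $\Phi$ of the cohomology of the complex $\check C^{q-1}(\mathcal U,A)\oplus \check C^{q}(\mathcal V,A)$ with differential $d(\alpha,\beta)=(\Phi^*\beta-d\alpha,\,d\beta)$. In particular, classes in $H^2(\Phi,\underline{U(1)})$ are represented by pairs $(s,t)\in \check C^1(\mathcal U,\underline{U(1)})\times\check C^2(\mathcal V,\underline{U(1)})$ with $\delta t=1$ and $\Phi^*t=\delta s$. *Gerbes.* A gerbe $\mathcal G=(L,\theta)$ on $\mathcal V$ consists of Hermitian line bundles $L_{jj'}$ on $V_{jj'}=V_j\cap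 V_{j'}$ (so that $L_{jj'}\cong L_{j'j}^{-1}$) and unitary sections $\theta_{jj'j''}$ of $(\delta L)_{jj'j''}=L_{j'j''}\otimes L_{jj''}^{-1}\otimes L_{jj'}$ with $\delta\theta=1$ in the canonically trivial bundle $\delta\delta L$. A quasi-line bundle $(E,\psi)$ for $\mathcal G$ consists of Hermitian line bundles $E_j$ on $V_j$ and unitary sections $\psi_{jj'}$ of $(\delta E)^{-1}_{jj'}\otimes L_{jj'}$, where $(\delta E)_{jj'}=E_{j'}\otimes E_j^{-1}$, with $\delta\psi=\theta$. For two quasi-line bundles $(E,\psi)$, $(E',\psi')$ for the same gerbe, the line bundles $E_j\otimes E_j'^{-1}$ are glued by $\psi\otimes\psi'^{-1}$ to a global line bundle, denoted $(E,\psi)\otimes (E',\psi')^{-1}$. *Relative gerbes.* A relative gerbe $(\mathcal L,\mathcal G)$ for $\Phi$, on a cover of $\Phi$, is a gerbe $\mathcal G$ on $\mathcal V$ together with a quasi-line bundle $\mathcal L=(E,\psi)$ for the gerbe $\Phi^*\mathcal G$ on $\mathcal U$. Products and duals are formed from tensor products and duals of all the line bundles and sections, after passing to a common refinement. Let $Ger(\Phi)$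 be the direct limit, over refinements of covers of $\Phi$, of the isomorphism classes of relative gerbes, an isomorphism being a family of unitary isomorphisms of the bundles $L_{jj'}$ and $E_i$ that preserve $\theta$ and $\psi$. Call $(\mathcal L,\mathcal G)$ trivial if $\mathcal G$ admits a quasi-line bundle $\mathcal L'$ such that the line bundle $\mathcal L\otimes(\Phi^*\mathcal L')^{-1}$ on $M$ admits a unitary section, and let $Ger_0(\Phi)\subseteq Ger(\Phi)$ be the set of all elements that are represented by trivial relative gerbes. **Theorem.** 1. $Ger(\Phi)$ is an abelian group under products, with inverses given by duals. 2. There is a homomorphism $\kappa : Ger(\Phi)\to H^2(\Phi,\underline{U(1)})$ such that $\kappa[(\mathcal L,\mathcal G)]=[(s,t)]$ for every relative gerbe and every choice of unitary sections $\sigma_{jj'}$ of $L_{jj'}$ and $\lambda_i$ of $E_i$, where $$t=(\delta\sigma)\,\theta^{-1},\qquad s=\psi^{-1}\big((\delta\lambda)^{-1}\otimes\Phi^*\sigma\big),$$ and $(s,t)$ is a relative cocycle. Every element of $Ger(\Phi)$ is represented by a relative gerbe for which such $\sigma$ and $\lambda$ exist. 3. The homomorphism $\kappa$ is onto, and its kernel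 is $Ger_0(\Phi)$. Composed with the isomorphism $e : H^2(\Phi,\underline{U(1)})\cong H^3(\Phi,\mathbb Z)$ given by the connecting homomorphism of the exponential sequence (if $w=\exp(2\pi\sqrt{-1}f)$ for a real relative cochain $f$, then $e[w]=[df]$), it gives a short exact sequence $$0\to Ger_0(\Phi)\hookrightarrow Ger(\Phi)\xrightarrow{\ \kappa\ }H^3(\Phi,\mathbb Z)\to 0 .$$ A relative gerbe represents an element of $Ger_0(\Phi)$ if and only if its restriction to some refinement of its cover is trivial. 4. Relative gerbes are classified by $H^3(\Phi,\mathbb Z)$: two relative gerbes $g,k$ have the same class in $H^3(\Phi,\mathbb Z)$ if and only if $g\otimes k^{-1}$ represents an element of $Ger_0(\Phi)$. -/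

import Mathlib

open TopologicalSpace
open scoped Manifold ContDiff TensorProduct DirectSum

universe u

noncomputable section

namespace RelGerbe

/-! ### Finite intersections of the members of a family of open sets -/

section Inter

variable {X : Type*} [TopologicalSpace X] {ι : Type*}

/-- The open set `U_{α 0} ∩ ⋯ ∩ U_{α (n-1)}`. -/
def inter (U : ι → Opens X) {n : ℕ} (α : Fin n → ι) : Opens X :=
  ⟨⋂ k, (U (α k) : Set X), isOpen_iInter_of_finite fun k => (U (α k)).isOpen⟩

theorem mem_inter {U : ι → Opens X} {n : ℕ} {α : Fin n → ι} {x : X} :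
    x ∈ inter U α ↔ ∀ k, x ∈ U (α k) := by
  change x ∈ ⋂ k, (U (α k) : Set X) ↔ _
  simp

/-- Omitting the `k`-th index gives a larger set. -/
theorem inter_le_face (U : ι → Opens X) {n : ℕ} (α : Fin (n + 1) → ι) (k : Fin (n + 1)) :
    inter U α ≤ inter U (α ∘ k.succAbove) :=
  fun _ hx => mem_inter.2 fun l => mem_inter.1 hx (k.succAbove l)

theorem mapsTo_inter {Y : Type*} [TopologicalSpace Y] {κ : Type*} {U : ι → Opens X}
    {V : κ → Opens Y} {f : X → Y} {r : ι → κ} (h : ∀ i, ∀ x ∈ U i, f x ∈ V (r i))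
    {n : ℕ} (α : Fin n → ι) : ∀ x ∈ inter U α, f x ∈ inter V (r ∘ α) :=
  fun x hx => mem_inter.2 fun k => h (α k) x (mem_inter.1 hx k)

end Inter

/-! ### Covers of a map and their refinements -/

section Cover

variable {M N : Type u} [TopologicalSpace M] [TopologicalSpace N]

/-- A cover of the map `Φ : M → N`: an open cover `V_j`, `j ∈ J`, of `N`, an open cover `U_i`,
`i ∈ I`, of `M`, and a map `r : I → J` with `Φ (U_i) ⊆ V_{r i}`.  The index set `I` is sorted
by the values of `r`: it is the disjoint union of the fibres `fib j = r⁻¹ {j}`, and `r` is the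
first projection. -/
structure Cover (Φ : M → N) where
  /-- the index set of the cover of `N` -/
  J : Type u
  /-- the fibres of `r` -/
  fib : J → Type u
  /-- the cover of `N` -/
  V : J → Opens N
  /-- the cover of `M` -/
  U : (Σ j, fib j) → Opens M
  cover_V : ∀ y, ∃ j, y ∈ V j
  cover_U : ∀ x, ∃ i, x ∈ U i
  mapsTo : ∀ i, ∀ x ∈ U i, Φ x ∈ V i.1

namespace Cover

variable {Φ : M → N}

/-- The index set of the cover of `M`. -/
abbrev I (c : Cover Φ) : Type u := Σ j, c.fib j

/-- The map of index sets with `Φ (U_i) ⊆ V_{r i}`. -/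
abbrev r (c : Cover Φ) : c.I → c.J := Sigma.fst

/-- `Refinement c c'`: the cover `c'` refines `c`, by maps of index sets `b : J' → J`,
`I' → I` which commute with `r'` and `r`. -/
structure Refinement (c c' : Cover Φ) where
  b : c'.J → c.J
  fibMap : ∀ j, c'.fib j → c.fib (b j)
  V_le : ∀ j, c'.V j ≤ c.V (b j)
  U_le : ∀ i : c'.I, c'.U i ≤ c.U ⟨b i.1, fibMap i.1 i.2⟩

/-- The map of index sets `I' → I` of a refinement. -/
def Refinement.a {c c' : Cover Φ} (ρ : Refinement c c') : c'.I → c.I :=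
  fun i => ⟨ρ.b i.1, ρ.fibMap i.1 i.2⟩

theorem Refinement.le_a {c c' : Cover Φ} (ρ : Refinement c c') (i : c'.I) :
    c'.U i ≤ c.U (ρ.a i) :=
  ρ.U_le i

/-- The common refinement by pairwise intersections. -/
def prod (c c' : Cover Φ) : Cover Φ where
  J := c.J × c'.J
  fib j := c.fib j.1 × c'.fib j.2
  V j := c.V j.1 ⊓ c'.V j.2
  U i := c.U ⟨i.1.1, i.2.1⟩ ⊓ c'.U ⟨i.1.2, i.2.2⟩
  cover_V y := by
    obtain ⟨j, hj⟩ := c.cover_V y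
    obtain ⟨j', hj'⟩ := c'.cover_V y
    exact ⟨(j, j'), hj, hj'⟩
  cover_U x := by
    obtain ⟨⟨j, i⟩, hi⟩ := c.cover_U x
    obtain ⟨⟨j', i'⟩, hi'⟩ := c'.cover_U x
    exact ⟨⟨(j, j'), (i, i')⟩, hi, hi'⟩
  mapsTo i x hx := ⟨c.mapsTo ⟨i.1.1, i.2.1⟩ x hx.1, c'.mapsTo ⟨i.1.2, i.2.2⟩ x hx.2⟩

/-- `c.prod c'` refines `c`. -/
def prodFst (c c' : Cover Φ) : Refinement c (c.prod c') where
  b := Prod.fst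
  fibMap _ := Prod.fst
  V_le _ := inf_le_left
  U_le _ := inf_le_left

/-- `c.prod c'` refines `c'`. -/
def prodSnd (c c' : Cover Φ) : Refinement c' (c.prod c') where
  b := Prod.snd
  fibMap _ := Prod.snd
  V_le _ := inf_le_right
  U_le _ := inf_le_right

end Cover

end Cover

/-! ### Relative Čech cohomology -/

section Cech

/-- A presheaf of `A`-valued functions on `X`. -/
structure FunctionPresheaf (X : Type*) [TopologicalSpace X] (A : Type*) [AddCommGroup A] where
  /-- the sections over an open set -/
  sec : ∀ W : Opens X, AddSubgroup (W → A)
  res_mem : ∀ {W W' : Opens X} (h : W' ≤ W) {f : W → A}, f ∈ sec W →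
    (fun x : W' => f ⟨x, h x.2⟩) ∈ sec W'

namespace FunctionPresheaf

variable {X : Type*} [TopologicalSpace X] {A : Type*} [AddCommGroup A]
  (F : FunctionPresheaf X A) {ι κ : Type*}

/-- Restriction of sections. -/
def res {W W' : Opens X} (h : W' ≤ W) : F.sec W →+ F.sec W' where
  toFun f := ⟨fun x => f.1 ⟨x, h x.2⟩, F.res_mem h f.2⟩
  map_zero' := rfl
  map_add' _ _ := rfl

/-- Čech `p`-cochains `f_{i_0 ⋯ i_p}` of a family of open sets. -/
abbrev Cochain (U : ι → Opens X) (p : ℕ) := ∀ α : Fin (p + 1) → ι, F.sec (inter U α)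

/-- The Čech differential
`(d f)_{i_0 ⋯ i_{p+1}} = ∑ k, (-1) ^ k f_{i_0 ⋯ (omit i_k) ⋯ i_{p+1}}`. -/
def d (U : ι → Opens X) (p : ℕ) : F.Cochain U p →+ F.Cochain U (p + 1) where
  toFun f α := ∑ k : Fin (p + 2), (-1 : ℤ) ^ (k : ℕ) •
    F.res (inter_le_face U α k) (f (α ∘ k.succAbove))
  map_zero' := by ext; simp
  map_add' f g := by
    funext α
    simp [Finset.sum_add_distrib]

/-- The restriction of cochains to a refinement `V_j ⊆ U_{b j}`. -/
def refine {U : ι → Opens X} {V : κ → Opens X} (b : κ → ι) (h : ∀ j, V j ≤ U (b j)) (p : ℕ) :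
    F.Cochain U p →+ F.Cochain V p where
  toFun f α := F.res (mapsTo_inter (f := id) h α) (f (b ∘ α))
  map_zero' := rfl
  map_add' _ _ := rfl

theorem refine_d {U : ι → Opens X} {V : κ → Opens X} (b : κ → ι) (h : ∀ j, V j ≤ U (b j))
    (p : ℕ) (f : F.Cochain U p) :
    F.refine b h (p + 1) (F.d U p f) = F.d V p (F.refine b h p f) := by
  funext α
  have : F.refine b h (p + 1) (F.d U p f) α =
      F.res (mapsTo_inter (f := id) h α) (F.d U p f (b ∘ α)) := rfl
  rw [this]
  change F.res _ (∑ k : Fin (p + 2), (-1 : ℤ) ^ (k : ℕ) •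
    F.res (inter_le_face U (b ∘ α) k) (f ((b ∘ α) ∘ k.succAbove))) = _
  rw [map_sum]
  refine Finset.sum_congr rfl fun k _ => ?_
  rw [map_zsmul]
  rfl

end FunctionPresheaf

variable {M N : Type u} [TopologicalSpace M] [TopologicalSpace N]

/-- Coefficients for the relative cohomology of `Φ : M → N`: presheaves of `A`-valued functions
on `M` and on `N` such that `Φ` pulls sections back to sections. -/
structure Coeff (Φ : M → N) (A : Type*) [AddCommGroup A] where
  onM : FunctionPresheaf M A
  onN : FunctionPresheaf N A
  pull_mem : ∀ {W : Opens M} {W' : Opens N} (h : ∀ x ∈ W, Φ x ∈ W') {f : W' → A},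
    f ∈ onN.sec W' → (fun x : W => f ⟨Φ x, h x x.2⟩) ∈ onM.sec W

namespace Coeff

variable {Φ : M → N} {A : Type*} [AddCommGroup A] (F : Coeff Φ A)

/-- The pull-back `Φ^*` of sections. -/
def pullSec {W : Opens M} {W' : Opens N} (h : ∀ x ∈ W, Φ x ∈ W') :
    F.onN.sec W' →+ F.onM.sec W where
  toFun f := ⟨fun x => f.1 ⟨Φ x, h x x.2⟩, F.pull_mem h f.2⟩
  map_zero' := rfl
  map_add' _ _ := rfl

/-- The pull-back `Φ^*` of cochains, `(Φ^* f)_{i_0 ⋯ i_p} = Φ^* f_{r i_0 ⋯ r i_p}`. -/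
def pull (c : Cover Φ) (p : ℕ) : F.onN.Cochain c.V p →+ F.onM.Cochain c.U p where
  toFun f α := F.pullSec (mapsTo_inter c.mapsTo α) (f (c.r ∘ α))
  map_zero' := rfl
  map_add' _ _ := rfl

/-- Relative cochains of degree `p + 1`: the degree `p + 1` part
`C^p(M) ⊕ C^{p+1}(N)` of the mapping cone of `Φ^*`. -/
abbrev RelCochain (c : Cover Φ) (p : ℕ) := F.onM.Cochain c.U p × F.onN.Cochain c.V (p + 1)

/-- The differential `d (α, β) = (Φ^* β - d α, d β)` of the mapping cone. -/
def relD (c : Cover Φ) (p : ℕ) : F.RelCochain c p →+ F.RelCochain c (p + 1) where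
  toFun z := (F.pull c (p + 1) z.2 - F.onM.d c.U p z.1, F.onN.d c.V (p + 1) z.2)
  map_zero' := by simp
  map_add' z w := by
    simp only [Prod.fst_add, Prod.snd_add, map_add, Prod.mk_add_mk, Prod.mk.injEq, and_true]
    abel

/-- Relative cocycles of degree `p + 2`. -/
abbrev Cocycle (c : Cover Φ) (p : ℕ) : AddSubgroup (F.RelCochain c (p + 1)) :=
  (F.relD c (p + 1)).ker

/-- The relative Čech cohomology in degree `p + 2` with respect to the cover `c`. -/
abbrev CoverH (c : Cover Φ) (p : ℕ) :=
  F.Cocycle c p ⧸ ((F.relD c p).range.addSubgroupOf (F.Cocycle c p))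

/-- The restriction of relative cochains to a refinement. -/
def relRefine {c c' : Cover Φ} (ρ : Cover.Refinement c c') (p : ℕ) :
    F.RelCochain c p →+ F.RelCochain c' p :=
  (F.onM.refine ρ.a ρ.le_a p).prodMap (F.onN.refine ρ.b ρ.V_le (p + 1))

theorem relRefine_relD {c c' : Cover Φ} (ρ : Cover.Refinement c c') (p : ℕ)
    (z : F.RelCochain c p) :
    F.relRefine ρ (p + 1) (F.relD c p z) = F.relD c' p (F.relRefine ρ p z) := by
  refine Prod.ext ?_ (F.onN.refine_d ρ.b ρ.V_le (p + 1) z.2)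
  change F.onM.refine ρ.a ρ.le_a (p + 1) (F.pull c (p + 1) z.2 - F.onM.d c.U p z.1) =
    F.pull c' (p + 1) (F.onN.refine ρ.b ρ.V_le (p + 1) z.2) -
      F.onM.d c'.U p (F.onM.refine ρ.a ρ.le_a p z.1)
  rw [map_sub, F.onM.refine_d]
  rfl

/-- The restriction of relative cocycles to a refinement. -/
def cocycleRefine {c c' : Cover Φ} (ρ : Cover.Refinement c c') (p : ℕ) :
    F.Cocycle c p →+ F.Cocycle c' p :=
  ((F.relRefine ρ (p + 1)).comp (F.Cocycle c p).subtype).codRestrict _ fun z => by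
    have hz : F.relD c (p + 1) z.1 = 0 := z.2
    change F.relD c' (p + 1) (F.relRefine ρ (p + 1) z.1) = 0
    rw [← F.relRefine_relD, hz, map_zero]

/-- The map induced by a refinement in relative Čech cohomology. -/
def coverHRefine {c c' : Cover Φ} (ρ : Cover.Refinement c c') (p : ℕ) :
    F.CoverH c p →+ F.CoverH c' p :=
  QuotientAddGroup.map _ _ (F.cocycleRefine ρ p) fun z hz => by
    obtain ⟨w, hw⟩ : ∃ w, F.relD c p w = z.1 := hz
    refine ⟨F.relRefine ρ p w, ?_⟩
    rw [← F.relRefine_relD, hw]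
    rfl

open Classical in
/-- The relative Čech cohomology group of `Φ` in degree `p + 2`: the direct limit, in the category
of abelian groups, of the groups of all covers of `Φ` under all refinements. -/
def H (p : ℕ) : Type _ :=
  (⨁ c : Cover Φ, F.CoverH c p) ⧸ AddSubgroup.closure
    {x : ⨁ c : Cover Φ, F.CoverH c p | ∃ (c c' : Cover Φ) (ρ : Cover.Refinement c c')
      (h : F.CoverH c p), x = DirectSum.of _ c h - DirectSum.of _ c' (F.coverHRefine ρ p h)}

instance (p : ℕ) : AddCommGroup (F.H p) :=
  inferInstanceAs (AddCommGroup (_ ⧸ _))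

open Classical in
/-- The class of a relative cocycle of degree `p + 2`. -/
def cls (c : Cover Φ) (p : ℕ) : F.Cocycle c p →+ F.H p :=
  (QuotientAddGroup.mk' _).comp
    ((DirectSum.of (fun c : Cover Φ => F.CoverH c p) c).comp (QuotientAddGroup.mk' _))

end Coeff

end Cech

/-! ### The coefficients `ℤ`, `ℝ` and `U(1)` -/

section Coefficients

variable {E H : Type*} [NormedAddCommGroup E] [NormedSpace ℝ E] [TopologicalSpace H]
  (I : ModelWithCorners ℝ E H) (X : Type*) [TopologicalSpace X] [ChartedSpace H X]

/-- The locally constant integer-valued functions. -/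
def intPresheaf (X : Type*) [TopologicalSpace X] : FunctionPresheaf X ℤ where
  sec _ :=
    { carrier := {f | IsLocallyConstant f}
      add_mem' := fun hf hg => hf.add hg
      zero_mem' := IsLocallyConstant.const 0
      neg_mem' := fun hf => hf.neg }
  res_mem h _ hf := IsLocallyConstant.comp_continuous hf (Opens.isOpenEmbedding_of_le h).continuous

/-- The smooth real-valued functions. -/
def realPresheaf : FunctionPresheaf X ℝ where
  sec _ :=
    { carrier := {f | ContMDiff I 𝓘(ℝ, ℝ) ∞ f}
      add_mem' := fun hf hg => ContMDiff.add hf hg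
      zero_mem' := contMDiff_const
      neg_mem' := fun hf => ContMDiff.neg hf }
  res_mem h _ hf := ContMDiff.comp hf (contMDiff_inclusion h)

/-- The smooth `U(1)`-valued functions, written additively. -/
def circlePresheaf : FunctionPresheaf X (Additive Circle) where
  sec _ :=
    { carrier := {f | ContMDiff I (𝓡 1) ∞ (fun x => (f x).toMul)}
      add_mem' := fun hf hg => ContMDiff.mul hf hg
      zero_mem' := contMDiff_const
      neg_mem' := fun hf => ContMDiff.inv hf }
  res_mem {W _} h f hf :=
    ContMDiff.comp (g := fun x : W => (f x).toMul) hf (contMDiff_inclusion h)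

end Coefficients

section RelCoefficients

variable {E H : Type*} [NormedAddCommGroup E] [NormedSpace ℝ E] [TopologicalSpace H]
  {I : ModelWithCorners ℝ E H} {X : Type*} [TopologicalSpace X] [ChartedSpace H X]
  {E' H' : Type*} [NormedAddCommGroup E'] [NormedSpace ℝ E'] [TopologicalSpace H']
  {I' : ModelWithCorners ℝ E' H'} {Y : Type*} [TopologicalSpace Y] [ChartedSpace H' Y]

/-- The restriction of a smooth map `f : X → Y` with `f(W) ⊆ W'` to a map `W → W'`. -/
def restrictMap (f : C^∞⟮I, X; I', Y⟯) {W : Opens X} {W' : Opens Y} (h : ∀ x ∈ W, f x ∈ W') :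
    C^∞⟮I, W; I', W'⟯ where
  val x := ⟨f x, h x x.2⟩
  property := (ContMDiff.subtypeVal_comp_iff W' _).1 (f.contMDiff.comp contMDiff_subtype_val)

/-- The inclusion of an open set into a larger one. -/
def inclMap (I : ModelWithCorners ℝ E H) {W W' : Opens X} (h : W ≤ W') : C^∞⟮I, W; I, W'⟯ where
  val x := ⟨x.1, h x.2⟩
  property := contMDiff_inclusion h

end RelCoefficients

section RelCoefficients

variable {E H : Type*} [NormedAddCommGroup E] [NormedSpace ℝ E] [TopologicalSpace H]
  {I : ModelWithCorners ℝ E H} {M : Type u} [TopologicalSpace M] [ChartedSpace H M]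
  {E' H' : Type*} [NormedAddCommGroup E'] [NormedSpace ℝ E'] [TopologicalSpace H']
  {I' : ModelWithCorners ℝ E' H'} {N : Type u} [TopologicalSpace N] [ChartedSpace H' N]

/-- Integer coefficients for the relative cohomology of `Φ`. -/
def intCoeff (Φ : C^∞⟮I, M; I', N⟯) : Coeff Φ ℤ where
  onM := intPresheaf M
  onN := intPresheaf N
  pull_mem h _ hf := IsLocallyConstant.comp_continuous hf (restrictMap Φ h).contMDiff.continuous

/-- Coefficients in the sheaves of smooth real-valued functions. -/
def realCoeff (Φ : C^∞⟮I, M; I', N⟯) : Coeff Φ ℝ where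
  onM := realPresheaf I M
  onN := realPresheaf I' N
  pull_mem h _ hf := ContMDiff.comp hf (restrictMap Φ h).contMDiff

/-- Coefficients in the sheaves of smooth `U(1)`-valued functions. -/
def circleCoeff (Φ : C^∞⟮I, M; I', N⟯) : Coeff Φ (Additive Circle) where
  onM := circlePresheaf I M
  onN := circlePresheaf I' N
  pull_mem {_ W'} h f hf :=
    ContMDiff.comp (g := fun x : W' => (f x).toMul) hf (restrictMap Φ h).contMDiff

theorem contMDiff_exp_two_pi {f : M → ℝ} (hf : ContMDiff I 𝓘(ℝ, ℝ) ∞ f) :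
    ContMDiff I (𝓡 1) ∞ fun x => Circle.exp (2 * Real.pi * f x) := by
  have h : ContMDiff 𝓘(ℝ, ℝ) 𝓘(ℝ, ℝ) ∞ fun t : ℝ => 2 * Real.pi * t :=
    (contDiff_const.mul contDiff_id : ContDiff ℝ ∞ fun t : ℝ => 2 * Real.pi * t).contMDiff
  exact contMDiff_circleExp.comp (h.comp hf)

theorem contMDiff_intCast {f : M → ℤ} (hf : IsLocallyConstant f) :
    ContMDiff I 𝓘(ℝ, ℝ) ∞ fun x => (f x : ℝ) := fun x => by
  have : (fun y => (f y : ℝ)) =ᶠ[nhds x] fun _ => (f x : ℝ) := by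
    filter_upwards [(IsLocallyConstant.iff_eventually_eq f).1 hf x] with y hy
    rw [hy]
  exact contMDiffAt_const.congr_of_eventuallyEq this

/-- The relative cochain `exp (2 π √-1 f)` of a real relative cochain `f`. -/
def expCochain {Φ : C^∞⟮I, M; I', N⟯} {c : Cover Φ} {p : ℕ} (f : (realCoeff Φ).RelCochain c p) :
    (circleCoeff Φ).RelCochain c p :=
  (fun α => ⟨fun x => Additive.ofMul (Circle.exp (2 * Real.pi * (f.1 α).1 x)),
      contMDiff_exp_two_pi (f.1 α).2⟩,
    fun α => ⟨fun x => Additive.ofMul (Circle.exp (2 * Real.pi * (f.2 α).1 x)),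
      contMDiff_exp_two_pi (f.2 α).2⟩)

/-- An integer relative cochain, regarded as a real one. -/
def realCochain {Φ : C^∞⟮I, M; I', N⟯} {c : Cover Φ} {p : ℕ} (z : (intCoeff Φ).RelCochain c p) :
    (realCoeff Φ).RelCochain c p :=
  (fun α => ⟨fun x => ((z.1 α).1 x : ℝ), contMDiff_intCast (z.1 α).2⟩,
    fun α => ⟨fun x => ((z.2 α).1 x : ℝ), contMDiff_intCast (z.2 α).2⟩)

end RelCoefficients

/-! ### Hermitian lines -/

/-- A Hermitian line: a complex inner product space of dimension one. -/
structure HermLine where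
  carrier : Type
  [instNormedAddCommGroup : NormedAddCommGroup carrier]
  [instInnerProductSpace : InnerProductSpace ℂ carrier]
  finrank_eq_one : Module.finrank ℂ carrier = 1

namespace HermLine

attribute [instance] instNormedAddCommGroup instInnerProductSpace

/-- The unit vectors of a Hermitian line. -/
def Unit (A : HermLine) : Type := {v : A.carrier // ‖v‖ = 1}

instance (A : HermLine) : SMul Circle A.Unit where
  smul z v := ⟨(z : ℂ) • v.1, by rw [norm_smul, v.2, Circle.norm_coe, mul_one]⟩

instance (A : HermLine) : Nonempty A.Unit := by
  have : Nontrivial A.carrier := Module.nontrivial_of_finrank_eq_succ A.finrank_eq_one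
  obtain ⟨v, hv⟩ := exists_norm_eq A.carrier (zero_le_one (α := ℝ))
  exact ⟨⟨v, hv⟩⟩

theorem exists_smul {A : HermLine} (u v : A.Unit) : ∃ z : Circle, u = z • v := by
  have hv : v.1 ≠ 0 := fun h => by simpa [h] using v.2
  obtain ⟨z, hz⟩ := (finrank_eq_one_iff_of_nonzero' v.1 hv).1 A.finrank_eq_one u.1
  have : ‖z‖ = 1 := by
    have := congrArg norm hz
    rwa [norm_smul, v.2, u.2, mul_one] at this
  exact ⟨⟨z, by simpa [Submonoid.unitSphere] using this⟩, Subtype.ext hz.symm⟩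

theorem inner_smul_self {A : HermLine} (z : Circle) (v : A.Unit) :
    inner ℂ v.1 (z • v).1 = (z : ℂ) := by
  change inner ℂ v.1 ((z : ℂ) • v.1) = _
  rw [inner_smul_right, inner_self_eq_norm_sq_to_K, v.2]
  simp

/-- The ratio `u / v ∈ U(1)` of two unit vectors of a Hermitian line. -/
def ratio {A : HermLine} (u v : A.Unit) : Circle :=
  ⟨inner ℂ v.1 u.1, by
    obtain ⟨z, rfl⟩ := exists_smul u v
    rw [inner_smul_self]
    exact z.2⟩

@[simp] theorem ratio_smul {A : HermLine} (z : Circle) (v : A.Unit) : ratio (z • v) v = z :=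
  Circle.ext (inner_smul_self z v)

theorem smul_smul' {A : HermLine} (z w : Circle) (v : A.Unit) : z • w • v = (z * w) • v :=
  Subtype.ext (smul_smul (z : ℂ) (w : ℂ) v.1)

@[simp] theorem ratio_smul_self {A : HermLine} (u v : A.Unit) : ratio u v • v = u := by
  obtain ⟨z, rfl⟩ := exists_smul u v
  rw [ratio_smul]

theorem ratio_mul {A : HermLine} (u v w : A.Unit) : ratio u v * ratio v w = ratio u w := by
  obtain ⟨z, rfl⟩ := exists_smul u v
  obtain ⟨y, rfl⟩ := exists_smul v w
  rw [smul_smul', ratio_smul, ratio_smul, ← smul_smul', ratio_smul]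

@[simp] theorem ratio_self {A : HermLine} (u : A.Unit) : ratio u u = 1 := by
  have := ratio_mul u u u
  simpa using this

theorem ratio_eq_one {A : HermLine} {u v : A.Unit} : ratio u v = 1 ↔ u = v := by
  refine ⟨fun h => ?_, fun h => h ▸ ratio_self u⟩
  have := ratio_smul_self u v
  rw [h] at this
  rw [← this]
  exact Subtype.ext (one_smul ℂ v.1)

theorem ratio_smul_left {A : HermLine} (z : Circle) (u v : A.Unit) :
    ratio (z • u) v = z * ratio u v := by
  rw [← ratio_mul (z • u) u v, ratio_smul]

theorem inv_ratio {A : HermLine} (u v : A.Unit) : (ratio u v)⁻¹ = ratio v u := by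
  rw [inv_eq_iff_mul_eq_one, ratio_mul, ratio_self]

theorem ratio_smul_right {A : HermLine} (z : Circle) (u v : A.Unit) :
    ratio u (z • v) = z⁻¹ * ratio u v := by
  rw [← inv_ratio, ratio_smul_left, mul_inv, inv_ratio]

/-- The tensor product of two Hermitian lines. -/
def tensor (A B : HermLine) : HermLine where
  carrier := A.carrier ⊗[ℂ] B.carrier
  finrank_eq_one := by
    rw [Module.finrank_tensorProduct, A.finrank_eq_one, B.finrank_eq_one]

/-- The tensor product of two unit vectors. -/
def tmul {A B : HermLine} (u : A.Unit) (v : B.Unit) : (A.tensor B).Unit :=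
  ⟨u.1 ⊗ₜ[ℂ] v.1, by
    change ‖u.1 ⊗ₜ[ℂ] v.1‖ = 1
    rw [TensorProduct.norm_tmul, u.2, v.2, one_mul]⟩

@[simp] theorem ratio_tmul {A B : HermLine} (u u' : A.Unit) (v v' : B.Unit) :
    ratio (tmul u v) (tmul u' v') = ratio u u' * ratio v v' :=
  Circle.ext (TensorProduct.inner_tmul ℂ u'.1 u.1 v'.1 v.1)

instance (A : HermLine) : FiniteDimensional ℂ A.carrier :=
  Module.finite_of_finrank_eq_succ A.finrank_eq_one

instance (A : HermLine) : CompleteSpace A.carrier := FiniteDimensional.complete ℂ _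

/-- The inner product on the dual of a Hermitian line, for the dual norm. -/
@[reducible] def dualInner (A : HermLine) : InnerProductSpace ℂ (StrongDual ℂ A.carrier) where
  inner f g := inner ℂ ((InnerProductSpace.toDual ℂ A.carrier).symm g)
    ((InnerProductSpace.toDual ℂ A.carrier).symm f)
  norm_sq_eq_re_inner f := by
    have h := inner_self_eq_norm_sq (𝕜 := ℂ) ((InnerProductSpace.toDual ℂ A.carrier).symm f)
    rw [LinearIsometryEquiv.norm_map] at h
    exact h.symm
  conj_inner_symm f g := inner_conj_symm _ _
  add_left f g h := by
    change inner ℂ _ _ = inner ℂ _ _ + inner ℂ _ _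
    rw [map_add, inner_add_right]
  smul_left f g z := by
    change inner ℂ _ _ = _ * inner ℂ _ _
    rw [map_smulₛₗ, inner_smul_right]

/-- The dual Hermitian line. -/
def dual (A : HermLine) : HermLine where
  carrier := StrongDual ℂ A.carrier
  instInnerProductSpace := A.dualInner
  finrank_eq_one := by
    have h := (LinearMap.toContinuousLinearMap (𝕜 := ℂ) (E := A.carrier) (F' := ℂ)).finrank_eq
    exact h.symm.trans (Subspace.dual_finrank_eq.trans A.finrank_eq_one)

/-- The unit vector `u⁻¹ = ⟪u, ·⟫` of the dual line. -/
def inv {A : HermLine} (u : A.Unit) : A.dual.Unit :=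
  ⟨InnerProductSpace.toDual ℂ A.carrier u.1, by
    change ‖InnerProductSpace.toDual ℂ A.carrier u.1‖ = 1
    rw [LinearIsometryEquiv.norm_map, u.2]⟩

@[simp] theorem ratio_inv {A : HermLine} (u v : A.Unit) :
    ratio (inv u) (inv v) = (ratio u v)⁻¹ := by
  rw [inv_ratio]
  refine Circle.ext ?_
  change inner ℂ ((InnerProductSpace.toDual ℂ A.carrier).symm _)
    ((InnerProductSpace.toDual ℂ A.carrier).symm _) = inner ℂ u.1 v.1
  simp [inv]

end HermLine

namespace HermLine

/-- The line `A ⊗ B⁻¹`. -/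
abbrev d1 (A B : HermLine) : HermLine := A.tensor B.dual

/-- The line `A ⊗ B⁻¹ ⊗ C`. -/
abbrev d2 (A B C : HermLine) : HermLine := (A.tensor B.dual).tensor C

/-- The line `A ⊗ B⁻¹ ⊗ C ⊗ D⁻¹`. -/
abbrev d3 (A B C D : HermLine) : HermLine := ((A.tensor B.dual).tensor C).tensor D.dual

variable {A B C D A' B' C' : HermLine}

/-- The unit vector `u ⊗ v⁻¹`. -/
abbrev v1 (u : A.Unit) (v : B.Unit) : (d1 A B).Unit := tmul u (inv v)

/-- The unit vector `u ⊗ v⁻¹ ⊗ w`. -/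
abbrev v2 (u : A.Unit) (v : B.Unit) (w : C.Unit) : (d2 A B C).Unit := tmul (tmul u (inv v)) w

/-- The unit vector `u ⊗ v⁻¹ ⊗ w ⊗ z⁻¹`. -/
abbrev v3 (u : A.Unit) (v : B.Unit) (w : C.Unit) (z : D.Unit) : (d3 A B C D).Unit :=
  tmul (tmul (tmul u (inv v)) w) (inv z)

/-- The line `(A ⊗ B⁻¹)⁻¹ ⊗ C`. -/
abbrev q (A B C : HermLine) : HermLine := (d1 A B).dual.tensor C

/-- The unit vector `(u ⊗ v⁻¹)⁻¹ ⊗ w`. -/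
abbrev vq (u : A.Unit) (v : B.Unit) (w : C.Unit) : (q A B C).Unit := tmul (inv (v1 u v)) w

theorem ratio_v1 (u u' : A.Unit) (v v' : B.Unit) :
    ratio (v1 u v) (v1 u' v') = ratio u u' * (ratio v v')⁻¹ := by
  simp only [ratio_tmul, ratio_inv]

theorem ratio_v2 (u u' : A.Unit) (v v' : B.Unit) (w w' : C.Unit) :
    ratio (v2 u v w) (v2 u' v' w') = ratio u u' * (ratio v v')⁻¹ * ratio w w' := by
  simp only [ratio_tmul, ratio_inv]

theorem ratio_v3 (u u' : A.Unit) (v v' : B.Unit) (w w' : C.Unit) (z z' : D.Unit) :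
    ratio (v3 u v w z) (v3 u' v' w' z') =
      ratio u u' * (ratio v v')⁻¹ * ratio w w' * (ratio z z')⁻¹ := by
  simp only [ratio_tmul, ratio_inv]

theorem ratio_vq (u u' : A.Unit) (v v' : B.Unit) (w w' : C.Unit) :
    ratio (vq u v w) (vq u' v' w') = (ratio u u' * (ratio v v')⁻¹)⁻¹ * ratio w w' := by
  simp only [ratio_tmul, ratio_inv]

/-- An arbitrary unit vector. -/
def some (A : HermLine) : A.Unit := Classical.arbitrary _

/-- The canonical isomorphism
`(A ⊗ B⁻¹ ⊗ C) ⊗ (A' ⊗ B'⁻¹ ⊗ C') ≅ (A ⊗ A') ⊗ (B ⊗ B')⁻¹ ⊗ (C ⊗ C')` on unit vectors: the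
image of `v2 a b c ⊗ v2 a' b' c'` is `v2 (a ⊗ a') (b ⊗ b') (c ⊗ c')`. -/
def mul2 (u : (d2 A B C).Unit) (u' : (d2 A' B' C').Unit) :
    (d2 (A.tensor A') (B.tensor B') (C.tensor C')).Unit :=
  (ratio u (v2 A.some B.some C.some) * ratio u' (v2 A'.some B'.some C'.some)) •
    v2 (tmul A.some A'.some) (tmul B.some B'.some) (tmul C.some C'.some)

theorem ratio_mul2 (u : (d2 A B C).Unit) (u' : (d2 A' B' C').Unit) (a : A.Unit) (b : B.Unit)
    (c : C.Unit) (a' : A'.Unit) (b' : B'.Unit) (c' : C'.Unit) :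
    ratio (mul2 u u') (v2 (tmul a a') (tmul b b') (tmul c c')) =
      ratio u (v2 a b c) * ratio u' (v2 a' b' c') := by
  rw [mul2, ratio_smul_left, ← ratio_mul u (v2 A.some B.some C.some) (v2 a b c),
    ← ratio_mul u' (v2 A'.some B'.some C'.some) (v2 a' b' c')]
  simp only [ratio_tmul, ratio_inv, mul_inv]
  ac_rfl

/-- The canonical isomorphism `(A ⊗ B⁻¹ ⊗ C)⁻¹ ≅ A⁻¹ ⊗ (B⁻¹)⁻¹ ⊗ C⁻¹` on inverses of unit vectors:
the image of `(v2 a b c)⁻¹` is `v2 a⁻¹ b⁻¹ c⁻¹`. -/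
def inv2 (u : (d2 A B C).Unit) : (d2 A.dual B.dual C.dual).Unit :=
  (ratio u (v2 A.some B.some C.some))⁻¹ • v2 (inv A.some) (inv B.some) (inv C.some)

theorem ratio_inv2 (u : (d2 A B C).Unit) (a : A.Unit) (b : B.Unit) (c : C.Unit) :
    ratio (inv2 u) (v2 (inv a) (inv b) (inv c)) = (ratio u (v2 a b c))⁻¹ := by
  rw [inv2, ratio_smul_left, ← ratio_mul u (v2 A.some B.some C.some) (v2 a b c)]
  simp only [ratio_tmul, ratio_inv, mul_inv]

/-- The canonical isomorphism `((A ⊗ B⁻¹)⁻¹ ⊗ C) ⊗ ((A' ⊗ B'⁻¹)⁻¹ ⊗ C') ≅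
((A ⊗ A') ⊗ (B ⊗ B')⁻¹)⁻¹ ⊗ (C ⊗ C')` on unit vectors: the image of `vq a b c ⊗ vq a' b' c'` is
`vq (a ⊗ a') (b ⊗ b') (c ⊗ c')`. -/
def mulq (u : (q A B C).Unit) (u' : (q A' B' C').Unit) :
    (q (A.tensor A') (B.tensor B') (C.tensor C')).Unit :=
  (ratio u (vq A.some B.some C.some) * ratio u' (vq A'.some B'.some C'.some)) •
    vq (tmul A.some A'.some) (tmul B.some B'.some) (tmul C.some C'.some)

theorem ratio_mulq (u : (q A B C).Unit) (u' : (q A' B' C').Unit) (a : A.Unit) (b : B.Unit)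
    (c : C.Unit) (a' : A'.Unit) (b' : B'.Unit) (c' : C'.Unit) :
    ratio (mulq u u') (vq (tmul a a') (tmul b b') (tmul c c')) =
      ratio u (vq a b c) * ratio u' (vq a' b' c') := by
  rw [mulq, ratio_smul_left, ← ratio_mul u (vq A.some B.some C.some) (vq a b c),
    ← ratio_mul u' (vq A'.some B'.some C'.some) (vq a' b' c')]
  simp only [ratio_tmul, ratio_inv, mul_inv]
  ac_rfl

/-- The canonical isomorphism `((A ⊗ B⁻¹)⁻¹ ⊗ C)⁻¹ ≅ (A⁻¹ ⊗ (B⁻¹)⁻¹)⁻¹ ⊗ C⁻¹` on inverses of unit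
vectors: the image of `(vq a b c)⁻¹` is `vq a⁻¹ b⁻¹ c⁻¹`. -/
def invq (u : (q A B C).Unit) : (q A.dual B.dual C.dual).Unit :=
  (ratio u (vq A.some B.some C.some))⁻¹ • vq (inv A.some) (inv B.some) (inv C.some)

theorem ratio_invq (u : (q A B C).Unit) (a : A.Unit) (b : B.Unit) (c : C.Unit) :
    ratio (invq u) (vq (inv a) (inv b) (inv c)) = (ratio u (vq a b c))⁻¹ := by
  rw [invq, ratio_smul_left, ← ratio_mul u (vq A.some B.some C.some) (vq a b c)]
  simp only [ratio_tmul, ratio_inv, mul_inv]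

theorem exists_eq_tmul (u : (A.tensor B).Unit) : ∃ (v : A.Unit) (w : B.Unit), u = tmul v w := by
  refine ⟨A.some, ratio u (tmul A.some B.some) • B.some, ?_⟩
  rw [← ratio_eq_one, ← ratio_mul u (tmul A.some B.some)]
  rw [ratio_tmul, ratio_self, one_mul, ratio_smul_right, ratio_self, mul_one, mul_inv_cancel]

theorem exists_eq_inv (u : A.dual.Unit) : ∃ v : A.Unit, u = inv v := by
  refine ⟨(ratio u (inv A.some))⁻¹ • A.some, ?_⟩
  rw [← ratio_eq_one, ← ratio_mul u (inv A.some)]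
  rw [ratio_inv, ratio_smul_right, ratio_self, mul_one, inv_inv, mul_inv_cancel]

/-- The action of an isometry of Hermitian lines on unit vectors. -/
def Unit.map (f : A.carrier ≃ₗᵢ[ℂ] B.carrier) (u : A.Unit) : B.Unit :=
  ⟨f u.1, by rw [f.norm_map, u.2]⟩

end HermLine

/-! ### Hermitian line bundles -/

section LineBundle

variable {E H : Type*} [NormedAddCommGroup E] [NormedSpace ℝ E] [TopologicalSpace H]

/-- A smooth Hermitian line bundle over `X`: a family of Hermitian lines with, around each point
`a`, a local unitary frame over an open set `dom a ∋ a`, such that the transition functions between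
the frames are smooth maps to `U(1)`.  (The values of `frame a` outside of `dom a` play no role.) -/
structure HermLineBundle (I : ModelWithCorners ℝ E H) (X : Type*) [TopologicalSpace X]
    [ChartedSpace H X] where
  fibre : X → HermLine
  dom : X → Opens X
  mem_dom : ∀ a, a ∈ dom a
  frame : X → ∀ x, (fibre x).Unit
  smooth : ∀ a b, ContMDiffOn I (𝓡 1) ∞ (fun x => HermLine.ratio (frame a x) (frame b x))
    (dom a ∩ dom b)

/-- A smooth unitary section of a Hermitian line bundle. -/
structure UnitarySection {I : ModelWithCorners ℝ E H} {X : Type*} [TopologicalSpace X]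
    [ChartedSpace H X] (L : HermLineBundle I X) where
  val : ∀ x, (L.fibre x).Unit
  smooth : ∀ a, ContMDiffOn I (𝓡 1) ∞ (fun x => HermLine.ratio (val x) (L.frame a x)) (L.dom a)

variable {I : ModelWithCorners ℝ E H} {X : Type*} [TopologicalSpace X] [ChartedSpace H X]
  {E' H' : Type*} [NormedAddCommGroup E'] [NormedSpace ℝ E'] [TopologicalSpace H']
  {I' : ModelWithCorners ℝ E' H'} {Y : Type*} [TopologicalSpace Y] [ChartedSpace H' Y]

namespace HermLineBundle

/-- The tensor product of Hermitian line bundles. -/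
def tensor (L K : HermLineBundle I X) : HermLineBundle I X where
  fibre x := (L.fibre x).tensor (K.fibre x)
  dom a := L.dom a ⊓ K.dom a
  mem_dom a := ⟨L.mem_dom a, K.mem_dom a⟩
  frame a x := HermLine.tmul (L.frame a x) (K.frame a x)
  smooth a b := by
    simp only [HermLine.ratio_tmul]
    exact ((L.smooth a b).mono fun _ hx => ⟨hx.1.1, hx.2.1⟩).mul
      ((K.smooth a b).mono fun _ hx => ⟨hx.1.2, hx.2.2⟩)

/-- The dual (inverse) of a Hermitian line bundle. -/
def dual (L : HermLineBundle I X) : HermLineBundle I X where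
  fibre x := (L.fibre x).dual
  dom := L.dom
  mem_dom := L.mem_dom
  frame a x := HermLine.inv (L.frame a x)
  smooth a b := by
    simp only [HermLine.ratio_inv]
    exact (L.smooth a b).inv

/-- The pull-back of a Hermitian line bundle by a smooth map. -/
def pullback (L : HermLineBundle I' Y) (f : C^∞⟮I, X; I', Y⟯) : HermLineBundle I X where
  fibre x := L.fibre (f x)
  dom a := (L.dom (f a)).comap ⟨f, f.contMDiff.continuous⟩
  mem_dom a := L.mem_dom (f a)
  frame a x := L.frame (f a) (f x)
  smooth a b := (L.smooth (f a) (f b)).comp f.contMDiff.contMDiffOn fun _ hx => hx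

/-- An isomorphism of Hermitian line bundles. -/
structure Iso (L K : HermLineBundle I X) where
  map : ∀ x, (L.fibre x).carrier ≃ₗᵢ[ℂ] (K.fibre x).carrier
  smooth : ∀ a b, ContMDiffOn I (𝓡 1) ∞
    (fun x => HermLine.ratio (HermLine.Unit.map (map x) (L.frame a x)) (K.frame b x))
    (L.dom a ∩ K.dom b)

end HermLineBundle

namespace UnitarySection

/-- The ratio of two unitary sections is a smooth map to `U(1)`. -/
theorem contMDiff_ratio {L : HermLineBundle I X} (s t : UnitarySection L) :
    ContMDiff I (𝓡 1) ∞ fun x => HermLine.ratio (s.val x) (t.val x) := by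
  intro a
  have h := (s.smooth a).mul (t.smooth a).inv
  refine (h.congr fun x _ => ?_).contMDiffAt ((L.dom a).isOpen.mem_nhds (L.mem_dom a))
  simp only [Pi.mul_apply]
  rw [HermLine.inv_ratio, HermLine.ratio_mul]

/-- The tensor product of unitary sections. -/
def tensor {L K : HermLineBundle I X} (s : UnitarySection L) (t : UnitarySection K) :
    UnitarySection (L.tensor K) where
  val x := HermLine.tmul (s.val x) (t.val x)
  smooth a := by
    refine (((s.smooth a).mono fun _ hx => hx.1).mul
      ((t.smooth a).mono fun _ hx => hx.2)).congr fun x _ => ?_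
    exact HermLine.ratio_tmul _ _ _ _

/-- The inverse of a unitary section. -/
def dual {L : HermLineBundle I X} (s : UnitarySection L) : UnitarySection L.dual where
  val x := HermLine.inv (s.val x)
  smooth a := (s.smooth a).inv.congr fun _ _ => HermLine.ratio_inv _ _

/-- The pull-back of a unitary section. -/
def pullback {L : HermLineBundle I' Y} (s : UnitarySection L) (f : C^∞⟮I, X; I', Y⟯) :
    UnitarySection (L.pullback f) where
  val x := s.val (f x)
  smooth a := (s.smooth (f a)).comp f.contMDiff.contMDiffOn fun _ hx => hx

end UnitarySection

end LineBundle

/-! ### Families of line bundles on the intersections of a cover -/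

section Families

variable {E H : Type*} [NormedAddCommGroup E] [NormedSpace ℝ E] [TopologicalSpace H]
  (I : ModelWithCorners ℝ E H) {X : Type*} [TopologicalSpace X] [ChartedSpace H X] {ι : Type*}

/-- A Hermitian line bundle on every `n`-fold intersection `U_{i_1 ⋯ i_n}`. -/
abbrev BundleFamily (U : ι → Opens X) (n : ℕ) :=
  ∀ α : Fin n → ι, HermLineBundle I (inter U α)

variable {I} {U : ι → Opens X}

/-- A unitary section of every bundle of a family. -/
abbrev SectionFamily {n : ℕ} (L : BundleFamily I U n) := ∀ α, UnitarySection (L α)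

/-- A unit vector at the point `x` in every bundle of a family which is defined at `x`. -/
abbrev VectorFamily {n : ℕ} (L : BundleFamily I U n) (x : X) :=
  ∀ α, ∀ h : x ∈ inter U α, ((L α).fibre ⟨x, h⟩).Unit

/-- The values at `x` of a family of unitary sections. -/
def SectionFamily.at {n : ℕ} {L : BundleFamily I U n} (s : SectionFamily L) (x : X) :
    VectorFamily L x :=
  fun α h => (s α).val ⟨x, h⟩

/-- The bundle of the face of `α` which omits the `k`-th index, restricted to `U_α`. -/
abbrev BundleFamily.face {n : ℕ} (L : BundleFamily I U n) (α : Fin (n + 1) → ι)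
    (k : Fin (n + 1)) : HermLineBundle I (inter U α) :=
  (L (α ∘ k.succAbove)).pullback (inclMap I (inter_le_face U α k))

/-- `(δ E)_{i i'} = E_{i'} ⊗ E_i⁻¹`. -/
abbrev BundleFamily.delta1 (L : BundleFamily I U 1) : BundleFamily I U 2 :=
  fun α => (L.face α 0).tensor (L.face α 1).dual

/-- `(δ L)_{i i' i''} = L_{i' i''} ⊗ L_{i i''}⁻¹ ⊗ L_{i i'}`. -/
abbrev BundleFamily.delta2 (L : BundleFamily I U 2) : BundleFamily I U 3 :=
  fun α => ((L.face α 0).tensor (L.face α 1).dual).tensor (L.face α 2)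

/-- The bundles `(δ E)⁻¹ ⊗ L`. -/
abbrev BundleFamily.quasi (K : BundleFamily I U 1) (L : BundleFamily I U 2) :
    BundleFamily I U 2 :=
  fun α => (K.delta1 α).dual.tensor (L α)

/-- The coboundary of a family of unitary sections. -/
def SectionFamily.delta1 {L : BundleFamily I U 1} (s : SectionFamily L) :
    SectionFamily L.delta1 :=
  fun _ => ((s _).pullback _).tensor ((s _).pullback _).dual

/-- The coboundary of a family of unitary sections. -/
def SectionFamily.delta2 {L : BundleFamily I U 2} (s : SectionFamily L) :
    SectionFamily L.delta2 :=
  fun _ => (((s _).pullback _).tensor ((s _).pullback _).dual).tensor ((s _).pullback _)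

/-- The sections `(δ t)⁻¹ ⊗ s`. -/
def SectionFamily.quasi {K : BundleFamily I U 1} {L : BundleFamily I U 2} (t : SectionFamily K)
    (s : SectionFamily L) : SectionFamily (K.quasi L) :=
  fun α => (SectionFamily.delta1 t α).dual.tensor (s α)

variable {x : X}

/-- The value at face `k`. -/
abbrev VectorFamily.face {n : ℕ} {L : BundleFamily I U n} (v : VectorFamily L x)
    (α : Fin (n + 1) → ι) (k : Fin (n + 1)) (h : x ∈ inter U α) :=
  v (α ∘ k.succAbove) (inter_le_face U α k h)

/-- The coboundary `v_{i'} ⊗ v_i⁻¹`. -/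
def VectorFamily.delta1 {L : BundleFamily I U 1} (v : VectorFamily L x) :
    VectorFamily L.delta1 x :=
  fun α h => HermLine.v1 (v.face α 0 h) (v.face α 1 h)

/-- The coboundary `v_{i' i''} ⊗ v_{i i''}⁻¹ ⊗ v_{i i'}`. -/
def VectorFamily.delta2 {L : BundleFamily I U 2} (v : VectorFamily L x) :
    VectorFamily L.delta2 x :=
  fun α h => HermLine.v2 (v.face α 0 h) (v.face α 1 h) (v.face α 2 h)

/-- The coboundary
`v_{i' i'' i'''} ⊗ v_{i i'' i'''}⁻¹ ⊗ v_{i i' i'''} ⊗ v_{i i' i''}⁻¹`. -/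
def VectorFamily.delta3 {L : BundleFamily I U 3} (v : VectorFamily L x) (α : Fin 4 → ι)
    (h : x ∈ inter U α) :
    (HermLine.d3 ((L.face α 0).fibre ⟨x, h⟩) ((L.face α 1).fibre ⟨x, h⟩)
      ((L.face α 2).fibre ⟨x, h⟩) ((L.face α 3).fibre ⟨x, h⟩)).Unit :=
  HermLine.v3 (v.face α 0 h) (v.face α 1 h) (v.face α 2 h) (v.face α 3 h)

/-- The vectors `(δ w)⁻¹ ⊗ v`. -/
def VectorFamily.quasi {K : BundleFamily I U 1} {L : BundleFamily I U 2} (w : VectorFamily K x)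
    (v : VectorFamily L x) : VectorFamily (K.quasi L) x :=
  fun α h => HermLine.vq (w.face α 0 h) (w.face α 1 h) (v α h)

open HermLine

theorem VectorFamily.ratio_delta1 {L : BundleFamily I U 1} (v w : VectorFamily L x)
    (α : Fin 2 → ι) (h : x ∈ inter U α) :
    ratio (v.delta1 α h) (w.delta1 α h) =
      ratio (v.face α 0 h) (w.face α 0 h) * (ratio (v.face α 1 h) (w.face α 1 h))⁻¹ :=
  ratio_v1 _ _ _ _

theorem VectorFamily.ratio_delta2 {L : BundleFamily I U 2} (v w : VectorFamily L x)
    (α : Fin 3 → ι) (h : x ∈ inter U α) :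
    ratio (v.delta2 α h) (w.delta2 α h) =
      ratio (v.face α 0 h) (w.face α 0 h) * (ratio (v.face α 1 h) (w.face α 1 h))⁻¹ *
        ratio (v.face α 2 h) (w.face α 2 h) :=
  ratio_v2 _ _ _ _ _ _

theorem VectorFamily.ratio_delta3 {L : BundleFamily I U 3} (v w : VectorFamily L x)
    (α : Fin 4 → ι) (h : x ∈ inter U α) :
    ratio (v.delta3 α h) (w.delta3 α h) =
      ratio (v.face α 0 h) (w.face α 0 h) * (ratio (v.face α 1 h) (w.face α 1 h))⁻¹ *
        ratio (v.face α 2 h) (w.face α 2 h) * (ratio (v.face α 3 h) (w.face α 3 h))⁻¹ :=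
  ratio_v3 _ _ _ _ _ _ _ _

theorem VectorFamily.ratio_quasi {K : BundleFamily I U 1} {L : BundleFamily I U 2}
    (lam lam' : VectorFamily K x) (v w : VectorFamily L x) (α : Fin 2 → ι)
    (h : x ∈ inter U α) :
    ratio (lam.quasi v α h) (lam'.quasi w α h) =
      (ratio (lam.face α 0 h) (lam'.face α 0 h) *
        (ratio (lam.face α 1 h) (lam'.face α 1 h))⁻¹)⁻¹ * ratio (v α h) (w α h) :=
  ratio_vq _ _ _ _ _ _

/-- An iterated face of `α` depends only on the indices which remain. -/
theorem VectorFamily.ratio_face_face {n : ℕ} {L : BundleFamily I U n} (v w : VectorFamily L x)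
    {β : Fin (n + 2) → ι} (h : x ∈ inter U β) (k k' : Fin (n + 2)) (l l' : Fin (n + 1))
    (hk : ∀ m, k.succAbove (l.succAbove m) = k'.succAbove (l'.succAbove m)) :
    ratio (v.face (β ∘ k.succAbove) l (inter_le_face U β k h))
        (w.face (β ∘ k.succAbove) l (inter_le_face U β k h)) =
      ratio (v.face (β ∘ k'.succAbove) l' (inter_le_face U β k' h))
        (w.face (β ∘ k'.succAbove) l' (inter_le_face U β k' h)) := by
  have key : ∀ α α' : Fin n → ι, α = α' → ∀ (hα : x ∈ inter U α) (hα' : x ∈ inter U α'),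
      ratio (v α hα) (w α hα) = ratio (v α' hα') (w α' hα') := by
    rintro α _ rfl _ _
    rfl
  exact key _ _ (funext fun m => congrArg β (hk m)) _ _

/-- `δ (δ σ)` does not depend on the family of unit vectors `σ`. -/
theorem VectorFamily.delta3_delta2 {L : BundleFamily I U 2} (v w : VectorFamily L x)
    (β : Fin 4 → ι) (h : x ∈ inter U β) : v.delta2.delta3 β h = w.delta2.delta3 β h := by
  refine ratio_eq_one.1 ((ratio_delta3 _ _ β h).trans ?_)
  rw [ratio_delta2, ratio_delta2, ratio_delta2, ratio_delta2,
    ratio_face_face v w h 0 1 0 0 (by decide), ratio_face_face v w h 0 2 1 0 (by decide),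
    ratio_face_face v w h 0 3 2 0 (by decide), ratio_face_face v w h 1 2 1 1 (by decide),
    ratio_face_face v w h 1 3 2 1 (by decide), ratio_face_face v w h 2 3 2 2 (by decide)]
  simp only [mul_inv, inv_inv]
  generalize ratio (v.face (β ∘ Fin.succAbove 1) 0 _) _ = a
  generalize ratio (v.face (β ∘ Fin.succAbove 2) 0 _) _ = b
  generalize ratio (v.face (β ∘ Fin.succAbove 2) 1 _) _ = c
  generalize ratio (v.face (β ∘ Fin.succAbove 3) 0 _) _ = d
  generalize ratio (v.face (β ∘ Fin.succAbove 3) 1 _) _ = f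
  generalize ratio (v.face (β ∘ Fin.succAbove 3) 2 _) _ = g
  refine Additive.ofMul.injective ?_
  simp only [ofMul_mul, ofMul_inv, ofMul_one]
  abel

/-- `δ ((δ lam)⁻¹ ⊗ σ)` depends on `lam` and `σ` in the same way as `δ σ`. -/
theorem VectorFamily.ratio_quasi_delta2 {K : BundleFamily I U 1} {L : BundleFamily I U 2}
    (lam lam' : VectorFamily K x) (v w : VectorFamily L x) (β : Fin 3 → ι) (h : x ∈ inter U β) :
    ratio ((lam.quasi v).delta2 β h) ((lam'.quasi w).delta2 β h) =
      ratio (v.delta2 β h) (w.delta2 β h) := by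
  rw [ratio_delta2, ratio_delta2, ratio_quasi, ratio_quasi, ratio_quasi,
    ratio_face_face lam lam' h 0 1 0 0 (by decide),
    ratio_face_face lam lam' h 0 2 1 0 (by decide),
    ratio_face_face lam lam' h 1 2 1 1 (by decide)]
  simp only [mul_inv, inv_inv]
  generalize ratio (lam.face (β ∘ Fin.succAbove 1) 0 _) _ = a
  generalize ratio (lam.face (β ∘ Fin.succAbove 2) 0 _) _ = b
  generalize ratio (lam.face (β ∘ Fin.succAbove 2) 1 _) _ = c
  refine Additive.ofMul.injective ?_
  simp only [ofMul_mul, ofMul_inv]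
  abel

end Families

/-! ### Gerbes and quasi-line bundles -/

section Gerbe

variable {E H : Type*} [NormedAddCommGroup E] [NormedSpace ℝ E] [TopologicalSpace H]

/-- A gerbe on the open cover `U`: Hermitian line bundles `L_{i i'}` on `U_{i i'}` and unitary
sections `θ_{i i' i''}` of `δ L` with `δ θ = 1`.  Here `1` is the canonical section of `δ (δ L)`,
whose value at `x` is `δ (δ σ)` for any unit vectors `σ_{i i'}` of the lines `L_{i i'}` at `x`.
All families of indices are admitted, so the isomorphisms `L_{i i'} ≅ L_{i' i}⁻¹` come from the
sections `θ_{i i i}` and `θ_{i i' i}`; see `Gerbe.nonempty_symm`. -/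
structure Gerbe (I : ModelWithCorners ℝ E H) {X : Type*} [TopologicalSpace X] [ChartedSpace H X]
    {ι : Type*} (U : ι → Opens X) where
  L : BundleFamily I U 2
  θ : SectionFamily L.delta2
  delta_θ : ∀ (x : X) (σ : VectorFamily L x) (β : Fin 4 → ι) (h : x ∈ inter U β),
    (θ.at x).delta3 β h = σ.delta2.delta3 β h

/-- A quasi-line bundle for the gerbe `G`: Hermitian line bundles `E_i` on `U_i` and unitary
sections `ψ_{i i'}` of `(δ E)⁻¹ ⊗ L` with `δ ψ = θ`.  The equality refers to the canonical
isomorphism `δ ((δ E)⁻¹ ⊗ L) ≅ δ L`, which maps `δ ((δ lam)⁻¹ ⊗ σ)` to `δ σ` for all unit vectors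
`lam_i` and `σ_{i i'}`: the coordinates of `δ ψ` and `θ` with respect to these are the same. -/
structure QuasiLineBundle {I : ModelWithCorners ℝ E H} {X : Type*} [TopologicalSpace X]
    [ChartedSpace H X] {ι : Type*} {U : ι → Opens X} (G : Gerbe I U) where
  E : BundleFamily I U 1
  ψ : SectionFamily (E.quasi G.L)
  delta_ψ : ∀ (x : X) (lam : VectorFamily E x) (σ : VectorFamily G.L x) (β : Fin 3 → ι)
    (h : x ∈ inter U β),
    HermLine.ratio ((ψ.at x).delta2 β h) ((lam.quasi σ).delta2 β h) =
      HermLine.ratio (G.θ.at x β h) (σ.delta2 β h)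

variable {I : ModelWithCorners ℝ E H} {X : Type*} [TopologicalSpace X] [ChartedSpace H X]
  {E' H' : Type*} [NormedAddCommGroup E'] [NormedSpace ℝ E'] [TopologicalSpace H']
  {I' : ModelWithCorners ℝ E' H'} {Y : Type*} [TopologicalSpace Y] [ChartedSpace H' Y]
  {ι κ : Type*} {U : ι → Opens X} {V : κ → Opens Y}

/-- The pull-back of a family of bundles. -/
def BundleFamily.pullback {n : ℕ} (L : BundleFamily I' V n) (f : C^∞⟮I, X; I', Y⟯) {r : ι → κ}
    (h : ∀ i, ∀ x ∈ U i, f x ∈ V (r i)) : BundleFamily I U n :=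
  fun α => (L (r ∘ α)).pullback (restrictMap f (mapsTo_inter h α))

/-- The pull-back of a family of unitary sections. -/
def SectionFamily.pullback {n : ℕ} {L : BundleFamily I' V n} (s : SectionFamily L)
    (f : C^∞⟮I, X; I', Y⟯) {r : ι → κ} (h : ∀ i, ∀ x ∈ U i, f x ∈ V (r i)) :
    SectionFamily (L.pullback f h) :=
  fun α => (s (r ∘ α)).pullback (restrictMap f (mapsTo_inter h α))

/-- The pull-back of a family of unit vectors. -/
def VectorFamily.pullback {n : ℕ} {L : BundleFamily I' V n} {f : C^∞⟮I, X; I', Y⟯} {x : X}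
    (v : VectorFamily L (f x)) {r : ι → κ} (h : ∀ i, ∀ x ∈ U i, f x ∈ V (r i)) :
    VectorFamily (L.pullback f h) x :=
  fun α hα => v (r ∘ α) (mapsTo_inter h α x hα)

/-- An arbitrary family of unit vectors. -/
def VectorFamily.some {n : ℕ} (L : BundleFamily I U n) (x : X) : VectorFamily L x :=
  fun _ _ => HermLine.some _

/-- The tensor product of families of unit vectors. -/
def VectorFamily.tensor {n : ℕ} {L K : BundleFamily I U n} {x : X} (v : VectorFamily L x)
    (w : VectorFamily K x) : VectorFamily (fun α => (L α).tensor (K α)) x :=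
  fun α h => HermLine.tmul (v α h) (w α h)

/-- The inverse of a family of unit vectors. -/
def VectorFamily.inv {n : ℕ} {L : BundleFamily I U n} {x : X} (v : VectorFamily L x) :
    VectorFamily (fun α => (L α).dual) x :=
  fun α h => HermLine.inv (v α h)

open HermLine

/-- The pull-back of a family of unitary sections of `δ L` to one of `δ (f^* L)`. -/
def SectionFamily.pullbackDelta {L : BundleFamily I' V 2} (s : SectionFamily L.delta2)
    (f : C^∞⟮I, X; I', Y⟯) {r : ι → κ} (h : ∀ i, ∀ x ∈ U i, f x ∈ V (r i)) :
    SectionFamily (L.pullback f h).delta2 :=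
  fun α =>
    { val := fun x => (s (r ∘ α)).val (restrictMap f (mapsTo_inter h α) x)
      smooth := fun a => by
        have h1 := ((s (r ∘ α)).smooth (restrictMap f (mapsTo_inter h α) a)).comp
          (restrictMap f (mapsTo_inter h α)).contMDiff.contMDiffOn (fun _ hx => hx)
        refine ContMDiffOn.mono (ContMDiffOn.congr h1 fun x _ => ?_) fun x hx => ?_
        · rfl
        · exact hx }

namespace Gerbe

/-- The pull-back of a gerbe on `V` by a smooth map `f`, on a cover `U` with
`f (U_i) ⊆ V_{r i}`. -/
def pullback (G : Gerbe I' V) (f : C^∞⟮I, X; I', Y⟯) {r : ι → κ}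
    (h : ∀ i, ∀ x ∈ U i, f x ∈ V (r i)) : Gerbe I U where
  L := G.L.pullback f h
  θ := SectionFamily.pullbackDelta G.θ f h
  delta_θ x σ β hβ := by
    let v := VectorFamily.some G.L (f x)
    have h0 := G.delta_θ (f x) v (r ∘ β) (mapsTo_inter h β x hβ)
    have h1 := VectorFamily.delta3_delta2 (L := G.L.pullback f h) (VectorFamily.pullback v h) σ β hβ
    refine Eq.trans ?_ h1
    exact h0

/-- The product of two gerbes on the same cover: the line bundles `L ⊗ L'` and the sections
`θ ⊗ θ'`. -/
def tensor (G K : Gerbe I U) : Gerbe I U where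
  L α := (G.L α).tensor (K.L α)
  θ α :=
    { val := fun x => mul2 ((G.θ α).val x) ((K.θ α).val x)
      smooth := fun a => by
        refine (((G.θ α).smooth a).mono ?_).mul (((K.θ α).smooth a).mono ?_) |>.congr
          fun x _ => ratio_mul2 _ _ _ _ _ _ _ _
        · exact fun x hx => ⟨⟨hx.1.1.1, hx.1.2.1⟩, hx.2.1⟩
        · exact fun x hx => ⟨⟨hx.1.1.2, hx.1.2.2⟩, hx.2.2⟩ }
  delta_θ x σ β h := by
    let v := VectorFamily.some G.L x
    let w := VectorFamily.some K.L x
    refine Eq.trans ?_ (VectorFamily.delta3_delta2 (v.tensor w) σ β h)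
    have hG := ratio_eq_one.2 (G.delta_θ x v β h)
    have hK := ratio_eq_one.2 (K.delta_θ x w β h)
    have key : ∀ (α : Fin 3 → ι) (hα : x ∈ inter U α),
        ratio (mul2 (G.θ.at x α hα) (K.θ.at x α hα)) ((v.tensor w).delta2 α hα) =
          ratio (G.θ.at x α hα) (v.delta2 α hα) * ratio (K.θ.at x α hα) (w.delta2 α hα) :=
      fun α hα => ratio_mul2 _ _ _ _ _ _ _ _
    rw [VectorFamily.ratio_delta3] at hG hK
    refine ratio_eq_one.1 ((VectorFamily.ratio_delta3 _ _ β h).trans ?_)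
    refine Eq.trans ?_ ((congrArg₂ (· * ·) hG hK).trans (one_mul 1))
    refine (congrArg₂ (· * ·) (congrArg₂ (· * ·) (congrArg₂ (· * ·) (key _ _)
      (congrArg _ (key _ _))) (key _ _)) (congrArg _ (key _ _))).trans ?_
    simp only [mul_inv]
    ac_rfl

/-- The dual of a gerbe: the line bundles `L⁻¹` and the sections `θ⁻¹`. -/
def dual (G : Gerbe I U) : Gerbe I U where
  L α := (G.L α).dual
  θ α :=
    { val := fun x => inv2 ((G.θ α).val x)
      smooth := fun a => ((G.θ α).smooth a).inv.congr fun x _ => ratio_inv2 _ _ _ _ }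
  delta_θ x σ β h := by
    let v := VectorFamily.some G.L x
    refine Eq.trans ?_ (VectorFamily.delta3_delta2 v.inv σ β h)
    have hG := ratio_eq_one.2 (G.delta_θ x v β h)
    have key : ∀ (α : Fin 3 → ι) (hα : x ∈ inter U α),
        ratio (inv2 (G.θ.at x α hα)) (v.inv.delta2 α hα) =
          (ratio (G.θ.at x α hα) (v.delta2 α hα))⁻¹ :=
      fun α hα => ratio_inv2 _ _ _ _
    rw [VectorFamily.ratio_delta3] at hG
    refine ratio_eq_one.1 ((VectorFamily.ratio_delta3 _ _ β h).trans ?_)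
    refine Eq.trans ?_ ((congrArg (·⁻¹) hG).trans inv_one)
    refine (congrArg₂ (· * ·) (congrArg₂ (· * ·) (congrArg₂ (· * ·) (key _ _)
      (congrArg _ (key _ _))) (key _ _)) (congrArg _ (key _ _))).trans ?_
    simp only [mul_inv]

end Gerbe

namespace QuasiLineBundle

/-- The pull-back of a family of unitary sections of `(δ E)⁻¹ ⊗ L` to one of
`(δ (f^* E))⁻¹ ⊗ f^* L`. -/
def _root_.RelGerbe.SectionFamily.pullbackQuasi {K : BundleFamily I' V 1} {L : BundleFamily I' V 2}
    (s : SectionFamily (K.quasi L)) (f : C^∞⟮I, X; I', Y⟯) {r : ι → κ}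
    (h : ∀ i, ∀ x ∈ U i, f x ∈ V (r i)) :
    SectionFamily ((K.pullback f h).quasi (L.pullback f h)) :=
  fun α =>
    { val := fun x => (s (r ∘ α)).val (restrictMap f (mapsTo_inter h α) x)
      smooth := fun a => by
        have h1 := ((s (r ∘ α)).smooth (restrictMap f (mapsTo_inter h α) a)).comp
          (restrictMap f (mapsTo_inter h α)).contMDiff.contMDiffOn (fun _ hx => hx)
        refine ContMDiffOn.mono (ContMDiffOn.congr h1 fun x _ => ?_) fun x hx => ?_
        · rfl
        · exact hx }

/-- The pull-back of a quasi-line bundle. -/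
def pullback {G : Gerbe I' V} (Q : QuasiLineBundle G) (f : C^∞⟮I, X; I', Y⟯) {r : ι → κ}
    (h : ∀ i, ∀ x ∈ U i, f x ∈ V (r i)) : QuasiLineBundle (G.pullback f h) where
  E := Q.E.pullback f h
  ψ := SectionFamily.pullbackQuasi Q.ψ f h
  delta_ψ x lam σ β hβ := by
    let v := VectorFamily.some G.L (f x)
    let w := VectorFamily.some Q.E (f x)
    have h0 := Q.delta_ψ (f x) w v (r ∘ β) (mapsTo_inter h β x hβ)
    have h1 := VectorFamily.ratio_quasi_delta2 (w.pullback h) lam (v.pullback h) σ β hβ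
    refine (ratio_mul _ (((w.pullback h).quasi (v.pullback h)).delta2 β hβ) _).symm.trans ?_
    exact (congrArg₂ (· * ·) h0 h1).trans (ratio_mul _ _ _)

/-- The product of quasi-line bundles: the line bundles `E ⊗ E'` and the sections `ψ ⊗ ψ'`. -/
def tensor {G K : Gerbe I U} (Q : QuasiLineBundle G) (R : QuasiLineBundle K) :
    QuasiLineBundle (G.tensor K) where
  E α := (Q.E α).tensor (R.E α)
  ψ α :=
    { val := fun x => mulq ((Q.ψ α).val x) ((R.ψ α).val x)
      smooth := fun a => by
        refine (((Q.ψ α).smooth a).mono ?_).mul (((R.ψ α).smooth a).mono ?_) |>.congr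
          fun x _ => ratio_mulq _ _ _ _ _ _ _ _
        · exact fun x hx => ⟨⟨hx.1.1.1, hx.1.2.1⟩, hx.2.1⟩
        · exact fun x hx => ⟨⟨hx.1.1.2, hx.1.2.2⟩, hx.2.2⟩ }
  delta_ψ x lam σ β h := by
    let v := VectorFamily.some G.L x
    let v' := VectorFamily.some K.L x
    let w := VectorFamily.some Q.E x
    let w' := VectorFamily.some R.E x
    have hQ := Q.delta_ψ x w v β h
    have hR := R.delta_ψ x w' v' β h
    have key : ∀ (α : Fin 2 → ι) (hα : x ∈ inter U α),
        ratio (mulq (Q.ψ.at x α hα) (R.ψ.at x α hα)) ((w.tensor w').quasi (v.tensor v') α hα) =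
          ratio (Q.ψ.at x α hα) (w.quasi v α hα) * ratio (R.ψ.at x α hα) (w'.quasi v' α hα) :=
      fun α hα => ratio_mulq _ _ _ _ _ _ _ _
    have hθ : ratio ((G.tensor K).θ.at x β h) ((v.tensor v').delta2 β h) =
        ratio (G.θ.at x β h) (v.delta2 β h) * ratio (K.θ.at x β h) (v'.delta2 β h) :=
      ratio_mul2 _ _ _ _ _ _ _ _
    have h1 := VectorFamily.ratio_quasi_delta2 (w.tensor w') lam (v.tensor v') σ β h
    rw [VectorFamily.ratio_delta2] at hQ hR
    refine (ratio_mul _ (((w.tensor w').quasi (v.tensor v')).delta2 β h) _).symm.trans ?_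
    refine (congrArg₂ (· * ·) ?_ h1).trans (ratio_mul _ _ _)
    refine (VectorFamily.ratio_delta2 _ _ β h).trans ?_
    refine Eq.trans ?_ ((congrArg₂ (· * ·) hQ hR).trans hθ.symm)
    refine (congrArg₂ (· * ·) (congrArg₂ (· * ·) (key _ _)
      (congrArg _ (key _ _))) (key _ _)).trans ?_
    simp only [mul_inv]
    ac_rfl

/-- The dual quasi-line bundle: the line bundles `E⁻¹` and the sections `ψ⁻¹`. -/
def dual {G : Gerbe I U} (Q : QuasiLineBundle G) : QuasiLineBundle G.dual where
  E α := (Q.E α).dual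
  ψ α :=
    { val := fun x => invq ((Q.ψ α).val x)
      smooth := fun a => ((Q.ψ α).smooth a).inv.congr fun x _ => ratio_invq _ _ _ _ }
  delta_ψ x lam σ β h := by
    let v := VectorFamily.some G.L x
    let w := VectorFamily.some Q.E x
    have hQ := Q.delta_ψ x w v β h
    have key : ∀ (α : Fin 2 → ι) (hα : x ∈ inter U α),
        ratio (invq (Q.ψ.at x α hα)) (w.inv.quasi v.inv α hα) =
          (ratio (Q.ψ.at x α hα) (w.quasi v α hα))⁻¹ :=
      fun α hα => ratio_invq _ _ _ _
    have hθ : ratio (G.dual.θ.at x β h) (v.inv.delta2 β h) =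
        (ratio (G.θ.at x β h) (v.delta2 β h))⁻¹ :=
      ratio_inv2 _ _ _ _
    have h1 := VectorFamily.ratio_quasi_delta2 w.inv lam v.inv σ β h
    rw [VectorFamily.ratio_delta2] at hQ
    refine (ratio_mul _ ((w.inv.quasi v.inv).delta2 β h) _).symm.trans ?_
    refine (congrArg₂ (· * ·) ?_ h1).trans (ratio_mul _ _ _)
    refine (VectorFamily.ratio_delta2 _ _ β h).trans ?_
    refine Eq.trans ?_ ((congrArg (·⁻¹) hQ).trans hθ.symm)
    refine (congrArg₂ (· * ·) (congrArg₂ (· * ·) (key _ _)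
      (congrArg _ (key _ _))) (key _ _)).trans ?_
    simp only [mul_inv]

end QuasiLineBundle

end Gerbe

section Symm

variable {E H : Type*} [NormedAddCommGroup E] [NormedSpace ℝ E] [TopologicalSpace H]
  {I : ModelWithCorners ℝ E H} {X : Type*} [TopologicalSpace X] [ChartedSpace H X]
  {ι : Type*} {U : ι → Opens X}

open HermLine

/-- A family of unit vectors is a unitary section if it is smooth near each point `a` with respect
to the frame at `a`. -/
def UnitarySection.ofContMDiffAt {L : HermLineBundle I X} (s : ∀ x, (L.fibre x).Unit)
    (h : ∀ a, ContMDiffAt I (𝓡 1) ∞ (fun x => ratio (s x) (L.frame a x)) a) :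
    UnitarySection L where
  val := s
  smooth a b hb := by
    have h1 := (L.smooth b a).contMDiffAt
      (((L.dom b ⊓ L.dom a).isOpen).mem_nhds ⟨L.mem_dom b, hb⟩)
    refine (((h b).mul h1).congr_of_eventuallyEq (.of_forall fun x => ?_)).contMDiffWithinAt
    simp only [Pi.mul_apply]
    rw [ratio_mul]

theorem inter_le_comp (U : ι → Opens X) {m n : ℕ} (α : Fin n → ι) (φ : Fin m → Fin n) :
    inter U α ≤ inter U (α ∘ φ) :=
  fun _ hx => mem_inter.2 fun l => mem_inter.1 hx (φ l)

/-- The line bundle `L_{i i'} ⊗ L_{i' i}` of a gerbe has a unitary section, that is,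
`L_{i i'} ≅ L_{i' i}⁻¹`. -/
theorem Gerbe.nonempty_symm (G : Gerbe I U) (α : Fin 2 → ι) :
    Nonempty (UnitarySection ((G.L α).tensor
      ((G.L (α ∘ ![1, 0])).pullback (inclMap I (inter_le_comp U α ![1, 0]))))) := by
  have h1 := inter_le_comp U α ![0, 1, 0]
  have h0 := inter_le_comp U α ![0, 0, 0]
  have hr := inter_le_comp U α ![1, 0]
  let c (x : inter U α) (σ : VectorFamily G.L x.1) : Circle :=
    ratio (G.θ.at x.1 (α ∘ ![0, 1, 0]) (h1 x.2)) (σ.delta2 _ (h1 x.2)) *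
      ratio (G.θ.at x.1 (α ∘ ![0, 0, 0]) (h0 x.2)) (σ.delta2 _ (h0 x.2))
  let s (x : inter U α) (σ : VectorFamily G.L x.1) :=
    c x σ • tmul (σ α x.2) (σ (α ∘ ![1, 0]) (hr x.2))
  have indep : ∀ (x : inter U α) (σ τ : VectorFamily G.L x.1), s x σ = s x τ := by
    intro x σ τ
    have key : ∀ β β' : Fin 2 → ι, β = β' → ∀ (hβ : x.1 ∈ inter U β) (hβ' : x.1 ∈ inter U β'),
        ratio (τ β hβ) (σ β hβ) = ratio (τ β' hβ') (σ β' hβ') := by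
      rintro β _ rfl _ _
      rfl
    have e : ∀ (φ : Fin 3 → Fin 2) (k : Fin 3) (φ' : Fin 2 → Fin 2)
        (_ : ∀ m, φ (k.succAbove m) = φ' m),
        ratio (τ.face (α ∘ φ) k (inter_le_comp U α φ x.2))
          (σ.face (α ∘ φ) k (inter_le_comp U α φ x.2)) =
        ratio (τ (α ∘ φ') (inter_le_comp U α φ' x.2)) (σ (α ∘ φ') (inter_le_comp U α φ' x.2)) :=
      fun φ k φ' hφ => key _ _ (funext fun m => congrArg α (hφ m)) _ _
    have eα := key (α ∘ ![0, 1]) α (funext fun m => congrArg α (by fin_cases m <;> rfl))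
      (inter_le_comp U α _ x.2) x.2
    have cc : c x σ = c x τ * (ratio (τ α x.2) (σ α x.2) *
        ratio (τ (α ∘ ![1, 0]) (hr x.2)) (σ (α ∘ ![1, 0]) (hr x.2))) := by
      have a1 := (ratio_mul (G.θ.at x.1 (α ∘ ![0, 1, 0]) (h1 x.2)) (τ.delta2 _ (h1 x.2))
        (σ.delta2 _ (h1 x.2))).symm
      have a0 := (ratio_mul (G.θ.at x.1 (α ∘ ![0, 0, 0]) (h0 x.2)) (τ.delta2 _ (h0 x.2))
        (σ.delta2 _ (h0 x.2))).symm
      rw [VectorFamily.ratio_delta2 τ σ, e _ 0 ![1, 0] (by decide), e _ 1 ![0, 0] (by decide),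
        e _ 2 ![0, 1] (by decide), eα] at a1
      rw [VectorFamily.ratio_delta2 τ σ, e _ 0 ![0, 0] (by decide), e _ 1 ![0, 0] (by decide),
        e _ 2 ![0, 0] (by decide)] at a0
      refine (congrArg₂ (· * ·) a1 a0).trans ?_
      change _ = ratio _ _ * ratio _ _ * (_ * _)
      refine Additive.ofMul.injective ?_
      simp only [ofMul_mul, ofMul_inv]
      abel
    refine ratio_eq_one.1 ?_
    change ratio (c x σ • _) (c x τ • _) = 1
    rw [ratio_smul_left, ratio_smul_right, ratio_tmul, cc, ← inv_ratio (τ α x.2),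
      ← inv_ratio (τ (α ∘ ![1, 0]) (hr x.2))]
    refine Additive.ofMul.injective ?_
    simp only [ofMul_mul, ofMul_inv, ofMul_one]
    abel
  refine ⟨UnitarySection.ofContMDiffAt (fun x => s x (VectorFamily.some G.L x.1)) fun a => ?_⟩
  classical
  let τ (x : inter U α) : VectorFamily G.L x.1 := fun β hβ =>
    if ha : a.1 ∈ inter U β then (G.L β).frame ⟨a.1, ha⟩ ⟨x.1, hβ⟩ else HermLine.some _
  have hτ : ∀ x β (hβ : x.1 ∈ inter U β) (ha : a.1 ∈ inter U β),
      τ x β hβ = (G.L β).frame ⟨a.1, ha⟩ ⟨x.1, hβ⟩ := fun x β hβ ha => dif_pos ha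
  have hs : ∀ x, ratio (s x (VectorFamily.some G.L x.1)) (((G.L α).tensor
      ((G.L (α ∘ ![1, 0])).pullback (inclMap I (inter_le_comp U α ![1, 0])))).frame a x) =
        c x (τ x) := by
    intro x
    rw [indep x _ (τ x)]
    change ratio (c x (τ x) • _) (tmul ((G.L α).frame a x)
      ((G.L (α ∘ ![1, 0])).frame ⟨a.1, hr a.2⟩ ⟨x.1, hr x.2⟩)) = _
    rw [hτ x α x.2 a.2, hτ x _ (hr x.2) (hr a.2)]
    exact ratio_smul _ _
  refine ContMDiffAt.congr_of_eventuallyEq (f := fun x => c x (τ x)) ?_ (.of_forall hs)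
  have sm : ∀ φ : Fin 3 → Fin 2, ContMDiffAt I (𝓡 1) ∞ (fun x : inter U α =>
      ratio (G.θ.at x.1 (α ∘ φ) (inter_le_comp U α φ x.2))
        ((τ x).delta2 _ (inter_le_comp U α φ x.2))) a := by
    intro φ
    have h := ((G.θ (α ∘ φ)).pullback (inclMap I (inter_le_comp U α φ))).smooth a a
      (HermLineBundle.mem_dom _ a)
    refine (h.contMDiffAt ((Opens.isOpen _).mem_nhds
      (HermLineBundle.mem_dom _ a))).congr_of_eventuallyEq (.of_forall fun x => ?_)
    refine congrArg (ratio _) ?_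
    have hf := fun k => hτ x ((α ∘ φ) ∘ k.succAbove)
      (inter_le_face U _ k (inter_le_comp U α φ x.2))
      (inter_le_face U _ k (inter_le_comp U α φ a.2))
    exact congr (congrArg₂ v2 (hf 0) (hf 1)) (hf 2)
  exact (sm _).mul (sm _)

end Symm

/-! ### Relative gerbes -/

section RelGerbe

variable {E H : Type*} [NormedAddCommGroup E] [NormedSpace ℝ E] [TopologicalSpace H]
  {I : ModelWithCorners ℝ E H} {M : Type u} [TopologicalSpace M] [ChartedSpace H M]
  {E' H' : Type*} [NormedAddCommGroup E'] [NormedSpace ℝ E'] [TopologicalSpace H']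
  {I' : ModelWithCorners ℝ E' H'} {N : Type u} [TopologicalSpace N] [ChartedSpace H' N]

/-- A relative gerbe for `Φ` on the cover `c` of `Φ`: a gerbe `G` on the cover of `N` and a
quasi-line bundle `Q` for the pull-back gerbe `Φ^* G` on the cover of `M`. -/
structure RelGerbeOn (Φ : C^∞⟮I, M; I', N⟯) (c : Cover Φ) where
  G : Gerbe I' c.V
  Q : QuasiLineBundle (G.pullback Φ c.mapsTo)

namespace RelGerbeOn

attribute [local irreducible] HermLine.tensor HermLine.dual HermLine.Unit HermLine.ratio
  HermLine.tmul HermLine.inv HermLine.mul2 HermLine.mulq HermLine.inv2 HermLine.invq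

variable {Φ : C^∞⟮I, M; I', N⟯} {c c' : Cover Φ}

/-- The product of relative gerbes on the same cover. -/
def tensor (g k : RelGerbeOn Φ c) : RelGerbeOn Φ c where
  G := g.G.tensor k.G
  Q :=
    { E := (g.Q.tensor k.Q).E
      ψ := fun α =>
        { val := ((g.Q.tensor k.Q).ψ α).val
          smooth := fun a => by
            refine ContMDiffOn.mono (ContMDiffOn.congr (((g.Q.tensor k.Q).ψ α).smooth a)
              fun x _ => ?_) fun x hx => ?_
            · rfl
            · exact hx }
      delta_ψ := (g.Q.tensor k.Q).delta_ψ }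

/-- The dual of a relative gerbe. -/
def dual (g : RelGerbeOn Φ c) : RelGerbeOn Φ c where
  G := g.G.dual
  Q := ⟨g.Q.dual.E, g.Q.dual.ψ, g.Q.dual.delta_ψ⟩

/-- The restriction of a relative gerbe to a refinement. -/
def refine (g : RelGerbeOn Φ c) (ρ : Cover.Refinement c c') : RelGerbeOn Φ c' where
  G := g.G.pullback ContMDiffMap.id ρ.V_le
  Q :=
    { E := g.Q.E.pullback ContMDiffMap.id ρ.le_a
      ψ := fun α =>
        { val := ((g.Q.pullback ContMDiffMap.id ρ.le_a).ψ α).val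
          smooth := fun a => by
            refine ContMDiffOn.mono (ContMDiffOn.congr
              (((g.Q.pullback ContMDiffMap.id ρ.le_a).ψ α).smooth a) fun x _ => ?_) fun x hx => ?_
            · rfl
            · exact hx }
      delta_ψ := (g.Q.pullback ContMDiffMap.id ρ.le_a).delta_ψ }

open HermLine

/-- An isomorphism of relative gerbes on the same cover: isomorphisms of the line bundles
`L_{j j'}` and `E_i` which map `θ` and `ψ` to `θ'` and `ψ'`.  (The coordinates of `θ` with respect
to `δ σ` are those of `θ'` with respect to the image of `δ σ`, and similarly for `ψ`.) -/
def Isomorphic (g k : RelGerbeOn Φ c) : Prop :=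
  ∃ (f : ∀ α, HermLineBundle.Iso (g.G.L α) (k.G.L α))
    (e : ∀ α, HermLineBundle.Iso (g.Q.E α) (k.Q.E α)),
    (∀ (y : N) (σ : VectorFamily g.G.L y) (α : Fin 3 → c.J) (h : y ∈ inter c.V α),
      ratio (g.G.θ.at y α h) (σ.delta2 α h) =
        ratio (k.G.θ.at y α h) (VectorFamily.delta2 (L := k.G.L)
          (fun β hβ => (σ β hβ).map ((f β).map ⟨y, hβ⟩)) α h)) ∧
    ∀ (x : M) (lam : VectorFamily g.Q.E x) (σ : VectorFamily g.G.L (Φ x)) (α : Fin 2 → c.I)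
      (h : x ∈ inter c.U α),
      ratio (g.Q.ψ.at x α h) (lam.quasi (σ.pullback c.mapsTo) α h) =
        ratio (k.Q.ψ.at x α h) (VectorFamily.quasi (K := k.Q.E)
          (fun β hβ => (lam β hβ).map ((e β).map ⟨x, hβ⟩))
          (VectorFamily.pullback (L := k.G.L)
            (fun β hβ => (σ β hβ).map ((f β).map ⟨Φ x, hβ⟩)) c.mapsTo) α h)

end RelGerbeOn

/-- For two quasi-line bundles `(E, ψ)` and `(E', ψ')` for the same gerbe, the line bundles
`E_i ⊗ E'_i⁻¹` are glued by the sections `ψ ⊗ ψ'⁻¹` to a line bundle.  This says that it admits a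
unitary section: there are unitary sections `u_i` of `E_i ⊗ E'_i⁻¹` with `δ u = ψ⁻¹ ⊗ ψ'` under
the canonical isomorphism `δ (E ⊗ E'⁻¹) ≅ ((δ E)⁻¹ ⊗ L)⁻¹ ⊗ ((δ E')⁻¹ ⊗ L)`. -/
def QuasiLineBundle.DifferenceHasSection {X : Type*} [TopologicalSpace X] [ChartedSpace H X]
    {ι : Type*} {U : ι → Opens X} {G : Gerbe I U} (Q R : QuasiLineBundle G) : Prop :=
  ∃ u : SectionFamily (fun α => (Q.E α).tensor (R.E α).dual),
    ∀ (x : X) (lam : VectorFamily Q.E x) (lam' : VectorFamily R.E x) (σ : VectorFamily G.L x)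
      (α : Fin 2 → ι) (h : x ∈ inter U α),
      HermLine.ratio ((u.at x).delta1 α h) ((lam.tensor lam'.inv).delta1 α h) =
        (HermLine.ratio (Q.ψ.at x α h) (lam.quasi σ α h))⁻¹ *
          HermLine.ratio (R.ψ.at x α h) (lam'.quasi σ α h)

variable (Φ : C^∞⟮I, M; I', N⟯)

/-- A relative gerbe for `Φ`. -/
structure RelativeGerbe where
  cover : Cover Φ
  data : RelGerbeOn Φ cover

variable {Φ}

namespace RelativeGerbe

/-- The product of two relative gerbes, on the common refinement of their covers. -/
def tensor (g k : RelativeGerbe Φ) : RelativeGerbe Φ where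
  cover := g.cover.prod k.cover
  data := (g.data.refine (g.cover.prodFst k.cover)).tensor
    (k.data.refine (g.cover.prodSnd k.cover))

/-- The dual of a relative gerbe. -/
def dual (g : RelativeGerbe Φ) : RelativeGerbe Φ where
  cover := g.cover
  data := g.data.dual

/-- The relative gerbe `k` is isomorphic to the restriction of `g` to a refinement. -/
def Refines (g k : RelativeGerbe Φ) : Prop :=
  ∃ ρ : Cover.Refinement g.cover k.cover, (g.data.refine ρ).Isomorphic k.data

/-- The gerbe `G` of `g = (Q, G)` admits a quasi-line bundle `R` such that the line bundle
`Q ⊗ (Φ^* R)⁻¹` on `M` admits a unitary section. -/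
def IsTrivial (g : RelativeGerbe Φ) : Prop :=
  ∃ R : QuasiLineBundle g.data.G,
    g.data.Q.DifferenceHasSection (R.pullback Φ g.cover.mapsTo)

/-- The cochain `t = (δ σ) θ⁻¹` on `N`, for unitary sections `σ` of the bundles `L_{j j'}`. -/
def cochainN (g : RelativeGerbe Φ) (σ : SectionFamily g.data.G.L) :
    (circleCoeff Φ).onN.Cochain g.cover.V 2 :=
  fun α => ⟨fun y => Additive.ofMul
    (HermLine.ratio ((σ.delta2 α).val y) ((g.data.G.θ α).val y)),
    (σ.delta2 α).contMDiff_ratio (g.data.G.θ α)⟩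

/-- The cochain `s = ψ⁻¹ ((δ lam)⁻¹ ⊗ Φ^* σ)` on `M`, for unitary sections `lam` of the bundles
`E_i` and `σ` of the bundles `L_{j j'}`. -/
def cochainM (g : RelativeGerbe Φ) (σ : SectionFamily g.data.G.L)
    (lam : SectionFamily g.data.Q.E) : (circleCoeff Φ).onM.Cochain g.cover.U 1 :=
  fun α => ⟨fun x => Additive.ofMul
    (HermLine.ratio ((lam.quasi (σ.pullback Φ g.cover.mapsTo) α).val x) ((g.data.Q.ψ α).val x)),
    (lam.quasi (σ.pullback Φ g.cover.mapsTo) α).contMDiff_ratio (g.data.Q.ψ α)⟩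

end RelativeGerbe

variable (Φ)

/-- The group `Ger(Φ)`: relative gerbes up to isomorphism, in the direct limit over all
refinements of covers. -/
def Ger : Type _ := Quot (RelativeGerbe.Refines (Φ := Φ))

variable {Φ}

/-- The element of `Ger(Φ)` given by a relative gerbe. -/
def Ger.mk (g : RelativeGerbe Φ) : Ger Φ := Quot.mk _ g

variable (Φ)

/-- The subset `Ger_0(Φ)` of `Ger(Φ)`: the relative gerbes `(Q, G)` such that `G` admits a
quasi-line bundle `R` for which `Q ⊗ (Φ^* R)⁻¹` admits a unitary section. -/
def Ger0 : Set (Ger Φ) := {x | ∃ g : RelativeGerbe Φ, Ger.mk g = x ∧ g.IsTrivial}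

/-- `H²(Φ, U(1))`, with coefficients in the sheaves of smooth `U(1)`-valued functions. -/
abbrev H2U1 : Type _ := (circleCoeff Φ).H 0

/-- `H³(Φ, ℤ)`. -/
abbrev H3Z : Type _ := (intCoeff Φ).H 1

end RelGerbe

end RelGerbe

end

/-!
Relative gerbes are compared with relative Čech cocycles with values in `U(1)`.  The map `κ` turns
out to be a bijection, so that `Ger_0(Φ)` consists of the zero class alone, and the group structure
of `Ger(Φ)` is the one transported from `H²(Φ, U(1))` along the bijection `gerEquiv`.

*From relative gerbes to classes.*  On a suitable refinement, all the line bundles of a relative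
gerbe have unitary sections (`RelGerbeOn.exists_trivialization`).  For the bundles `E_i`, and for
single bundles `L_{jj'}`, this holds near each point; but the double intersections
`(V_j ∩ W_j y) ∩ (V_{j'} ∩ W_{j'} y')` of small sets require sections of infinitely many `L_{jj'}`
near the same point.  These are obtained from finitely many of them by composition with `θ`
(`Gerbe.exists_nhds_hasSection`).  With respect to unitary sections, `θ` and `ψ` have coordinates in
`U(1)`, whose inverses are the pair `(s, t)`.  The equations `δ θ = 1` and `δ ψ = Φ^* θ` say that it
is a cocycle, and a change of the sections changes it by a coboundary
(`Trivialization.cochain_smul`).  This gives the class of a relative gerbe, which can be computed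
from arbitrary sections on an arbitrary refinement (`RelativeGerbe.classOf_eq`); products and duals
of sections show that it is additive (`RelativeGerbe.classOf_tensor`, `RelativeGerbe.classOf_dual`).

*Bijectivity.*  Every cocycle is that of a relative gerbe of trivial line bundles
(`RelGerbeOn.ofCocycle`).  Relative gerbes with the same cocycle are isomorphic
(`Trivialization.isomorphic`).  Cocycles with the same class differ by a coboundary on some
refinement (`Coeff.exists_refine_eq_relD`), which can be absorbed into the sections.  The last
statement is the description of the zero class of a direct limit; the limit, defined by generators
and relations over all covers and all refinements, is one over a directed preorder since parallel
refinements are homotopic by a prism operator (`Coeff.relD_prism`).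

*Trivial relative gerbes.*  If the cocycle of some unitary sections is trivial, so is the relative
gerbe (`Trivialization.isTrivial`).  Conversely, if a relative gerbe is trivial, then on a
refinement where the auxiliary quasi-line bundle has unitary sections too, comparing the
sections exhibits the cocycle as a coboundary (`Trivialization.cls_eq_zero`).  Hence the
relative gerbes with class zero are those which are trivial on some refinement.

*The connecting isomorphism.*  It is constructed from its inverse, which maps `[df]` to
`[exp (2 π √-1 f)]` (`connectingInv`).  Every integer cocycle is of the form `df`, as the relative
cohomology of the smooth real-valued functions vanishes by means of a partition of unity
(`exists_relD_eq`).  Injectivity and surjectivity hold since `U(1)`-valued cochains have logarithms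
on a refinement (`exists_log_shrinking`): if small sets, each contained in a ball whose radius is a
fraction of the distance to the boundary, have a common point, then the smallest of them is
contained in the domain of the function.
-/

noncomputable section

namespace RelGerbe

/-! ### The Čech differential on values at a point -/

section AltSum

variable {A : Type*} [AddCommGroup A] {ι : Type*}

/-- The alternating sum over the faces of a tuple, for an arbitrary function of tuples.  Čech
cochains, evaluated at a point, are such functions of the tuples whose intersection contains the
point. -/
def altSum {n : ℕ} (f : (Fin n → ι) → A) (α : Fin (n + 1) → ι) : A :=
  ∑ k : Fin (n + 1), (-1 : ℤ) ^ (k : ℕ) • f (α ∘ k.succAbove)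

theorem altSum_sub {n : ℕ} (f g : (Fin n → ι) → A) :
    altSum (fun α => f α - g α) = fun α => altSum f α - altSum g α := by
  funext α
  simp [altSum, smul_sub]

/-- The cone over a tuple is a contracting homotopy. -/
theorem altSum_cons {n : ℕ} (f : (Fin (n + 1) → ι) → A) (i : ι) (α : Fin (n + 1) → ι) :
    altSum f (Fin.cons i α : Fin (n + 2) → ι) =
      f α - altSum (fun β => f (Fin.cons i β)) α := by
  have h0 : (Fin.cons i α : Fin (n + 2) → ι) ∘ (0 : Fin (n + 2)).succAbove = α := by
    funext k
    simp
  have hs : ∀ k : Fin (n + 1), (Fin.cons i α : Fin (n + 2) → ι) ∘ k.succ.succAbove =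
      Fin.cons i (α ∘ k.succAbove) := by
    intro k
    funext l
    refine Fin.cases ?_ (fun m => ?_) l
    · simp
    · simp [Fin.succ_succAbove_succ]
  simp only [altSum]
  rw [Fin.sum_univ_succ, h0]
  simp only [hs, Fin.val_zero, pow_zero, one_smul, Fin.val_succ, pow_succ, mul_neg, mul_one,
    neg_smul, Finset.sum_neg_distrib, sub_eq_add_neg]

theorem altSum_altSum {n : ℕ} (f : (Fin n → ι) → A) (α : Fin (n + 2) → ι) :
    altSum (altSum f) α = 0 := by
  induction n with
  | zero =>
    have h : ∀ β γ : Fin 0 → ι, f β = f γ := fun β γ => congrArg f (Subsingleton.elim _ _)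
    simp only [altSum, Fin.sum_univ_succ, Fin.sum_univ_zero]
    simp [h _ (fun x => Fin.elim0 x)]
  | succ n ih =>
    obtain ⟨i, β, rfl⟩ : ∃ i β, α = Fin.cons i β := ⟨α 0, Fin.tail α, (Fin.cons_self_tail α).symm⟩
    rw [altSum_cons]
    have h : (fun γ => altSum f (Fin.cons i γ)) =
        fun γ => f γ - altSum (fun δ => f (Fin.cons i δ)) γ := funext fun γ => altSum_cons f i γ
    rw [h, altSum_sub]
    simp only [ih, sub_zero, sub_self]

theorem altSum_three {f : (Fin 3 → ι) → A} (α : Fin 4 → ι) :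
    altSum f α = f ![α 1, α 2, α 3] - f ![α 0, α 2, α 3] + f ![α 0, α 1, α 3] -
      f ![α 0, α 1, α 2] := by
  have h (k : Fin 4) (a b c : Fin 4) (h0 : k.succAbove 0 = a) (h1 : k.succAbove 1 = b)
      (h2 : k.succAbove 2 = c) : α ∘ k.succAbove = ![α a, α b, α c] := by
    subst h0 h1 h2
    funext l
    fin_cases l <;> rfl
  change ∑ k : Fin 4, (-1 : ℤ) ^ (k : ℕ) • f (α ∘ k.succAbove) = _
  rw [Fin.sum_univ_four]
  rw [h 0 1 2 3 rfl rfl rfl, h 1 0 2 3 rfl rfl rfl, h 2 0 1 3 rfl rfl rfl, h 3 0 1 2 rfl rfl rfl]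
  simp [pow_succ]
  abel

theorem altSum_two {f : (Fin 2 → ι) → A} (α : Fin 3 → ι) :
    altSum f α = f ![α 1, α 2] - f ![α 0, α 2] + f ![α 0, α 1] := by
  have h (k : Fin 3) (a b : Fin 3) (h0 : k.succAbove 0 = a) (h1 : k.succAbove 1 = b) :
      α ∘ k.succAbove = ![α a, α b] := by
    subst h0 h1
    funext l
    fin_cases l <;> rfl
  change ∑ k : Fin 3, (-1 : ℤ) ^ (k : ℕ) • f (α ∘ k.succAbove) = _
  rw [Fin.sum_univ_three]
  rw [h 0 1 2 rfl rfl, h 1 0 2 rfl rfl, h 2 0 1 rfl rfl]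
  simp [pow_succ]
  abel

theorem altSum_one {f : (Fin 1 → ι) → A} (α : Fin 2 → ι) :
    altSum f α = f ![α 1] - f ![α 0] := by
  have h (k : Fin 2) (a : Fin 2) (h0 : k.succAbove 0 = a) : α ∘ k.succAbove = ![α a] := by
    subst h0
    funext l
    fin_cases l
    rfl
  change ∑ k : Fin 2, (-1 : ℤ) ^ (k : ℕ) • f (α ∘ k.succAbove) = _
  rw [Fin.sum_univ_two]
  rw [h 0 1 rfl, h 1 0 rfl]
  simp
  abel

end AltSum

namespace FunctionPresheaf

variable {X : Type*} [TopologicalSpace X] {A : Type*} [AddCommGroup A]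
  (F : FunctionPresheaf X A) {ι κ : Type*} {U : ι → Opens X}

open Classical in
/-- The values of a cochain at the point `x`, extended by zero to all tuples of indices. -/
def valueAt {p : ℕ} (f : F.Cochain U p) (x : X) (α : Fin (p + 1) → ι) : A :=
  if h : x ∈ inter U α then (f α).1 ⟨x, h⟩ else 0

variable {F}

theorem valueAt_of_mem {p : ℕ} (f : F.Cochain U p) {x : X} {α : Fin (p + 1) → ι}
    (h : x ∈ inter U α) : F.valueAt f x α = (f α).1 ⟨x, h⟩ :=
  dif_pos h

theorem cochain_ext {p : ℕ} {f g : F.Cochain U p}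
    (h : ∀ x α, x ∈ inter U α → F.valueAt f x α = F.valueAt g x α) : f = g := by
  funext α
  refine Subtype.ext (funext fun x => ?_)
  have := h x.1 α x.2
  rwa [valueAt_of_mem f x.2, valueAt_of_mem g x.2] at this

theorem val_sum {W : Opens X} {σ : Type*} (s : Finset σ) (f : σ → F.sec W) (x : W) :
    (∑ k ∈ s, f k).1 x = ∑ k ∈ s, (f k).1 x := by
  rw [AddSubgroup.val_finsetSum, Finset.sum_apply]

theorem d_apply {p : ℕ} (f : F.Cochain U p) (α : Fin (p + 2) → ι) (x : inter U α) :
    (F.d U p f α).1 x = ∑ k : Fin (p + 2), (-1 : ℤ) ^ (k : ℕ) •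
      (f (α ∘ k.succAbove)).1 ⟨x.1, inter_le_face U α k x.2⟩ := by
  change (∑ k : Fin (p + 2), (-1 : ℤ) ^ (k : ℕ) •
    F.res (inter_le_face U α k) (f (α ∘ k.succAbove))).1 x = _
  rw [val_sum]
  rfl

theorem valueAt_d {p : ℕ} (f : F.Cochain U p) {x : X} {α : Fin (p + 2) → ι}
    (h : x ∈ inter U α) : F.valueAt (F.d U p f) x α = altSum (F.valueAt f x) α := by
  rw [valueAt_of_mem _ h, d_apply]
  refine Finset.sum_congr rfl fun k _ => ?_
  rw [valueAt_of_mem f (inter_le_face U α k h)]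

theorem d_d {p : ℕ} (f : F.Cochain U p) : F.d U (p + 1) (F.d U p f) = 0 := by
  refine cochain_ext fun x α h => ?_
  rw [valueAt_d _ h]
  refine Eq.trans ?_ ((altSum_altSum (F.valueAt f x) α).trans
    (valueAt_of_mem (0 : F.Cochain U (p + 2)) h).symm)
  refine Finset.sum_congr rfl fun k _ => ?_
  rw [valueAt_d f (inter_le_face U α k h)]

end FunctionPresheaf

namespace Cover

variable {M N : Type u} [TopologicalSpace M] [TopologicalSpace N] {Φ : M → N}

/-- The composition of refinements. -/
def Refinement.comp {c c' c'' : Cover Φ} (ρ : Refinement c c') (τ : Refinement c' c'') :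
    Refinement c c'' where
  b := ρ.b ∘ τ.b
  fibMap j i := ρ.fibMap (τ.b j) (τ.fibMap j i)
  V_le j := (τ.V_le j).trans (ρ.V_le (τ.b j))
  U_le i := (τ.U_le i).trans (ρ.U_le ⟨τ.b i.1, τ.fibMap i.1 i.2⟩)

/-- Every cover refines itself. -/
def Refinement.id (c : Cover Φ) : Refinement c c where
  b := _root_.id
  fibMap _ := _root_.id
  V_le _ := le_rfl
  U_le _ := le_rfl

/-- The common refinement of two refinements refines the common refinement. -/
def Refinement.prodMap {c c' d d' : Cover Φ} (ρ : Refinement c c') (τ : Refinement d d') :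
    Refinement (c.prod d) (c'.prod d') where
  b := Prod.map ρ.b τ.b
  fibMap j := Prod.map (ρ.fibMap j.1) (τ.fibMap j.2)
  V_le j := inf_le_inf (ρ.V_le j.1) (τ.V_le j.2)
  U_le i := inf_le_inf (ρ.U_le ⟨i.1.1, i.2.1⟩) (τ.U_le ⟨i.1.2, i.2.2⟩)

end Cover

section

variable {X ι : Type*} [TopologicalSpace X] {U : ι → Opens X} {x : X} {i j k : ι}

theorem mem_inter_two (hi : x ∈ U i) (hj : x ∈ U j) : x ∈ inter U ![i, j] :=
  mem_inter.2 fun l => by fin_cases l <;> assumption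

theorem mem_inter_three (hi : x ∈ U i) (hj : x ∈ U j) (hk : x ∈ U k) : x ∈ inter U ![i, j, k] :=
  mem_inter.2 fun l => by fin_cases l <;> assumption

end

namespace Coeff

variable {M N : Type u} [TopologicalSpace M] [TopologicalSpace N] {Φ : M → N}
  {A : Type*} [AddCommGroup A] (F : Coeff Φ A)

theorem pull_d (c : Cover Φ) (p : ℕ) (f : F.onN.Cochain c.V p) :
    F.pull c (p + 1) (F.onN.d c.V p f) = F.onM.d c.U p (F.pull c p f) := by
  funext α
  refine Subtype.ext (funext fun x => ?_)
  rw [FunctionPresheaf.d_apply]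
  exact FunctionPresheaf.d_apply f (c.r ∘ α) ⟨Φ x.1, mapsTo_inter c.mapsTo α x.1 x.2⟩

variable {F} in
theorem RelCochain.ext {c : Cover Φ} {p : ℕ} {w w' : F.RelCochain c p}
    (hM : ∀ α x, (w.1 α).1 x = (w'.1 α).1 x) (hN : ∀ α y, (w.2 α).1 y = (w'.2 α).1 y) : w = w' :=
  Prod.ext (funext fun α => Subtype.ext (funext fun x => hM α x))
    (funext fun α => Subtype.ext (funext fun y => hN α y))

variable {F} in
theorem relD_fst_apply {c : Cover Φ} {p : ℕ} (w : F.RelCochain c p) (α : Fin (p + 2) → c.I)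
    (x : inter c.U α) :
    ((F.relD c p w).1 α).1 x = (w.2 (c.r ∘ α)).1 ⟨Φ x.1, mapsTo_inter c.mapsTo α x.1 x.2⟩ -
      (F.onM.d c.U p w.1 α).1 x := rfl

theorem relD_relD (c : Cover Φ) (p : ℕ) (f : F.RelCochain c p) :
    F.relD c (p + 1) (F.relD c p f) = 0 := by
  refine Prod.ext ?_ (FunctionPresheaf.d_d f.2)
  change F.pull c (p + 2) (F.onN.d c.V (p + 1) f.2) -
    F.onM.d c.U (p + 1) (F.pull c (p + 1) f.2 - F.onM.d c.U p f.1) = 0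
  rw [map_sub, FunctionPresheaf.d_d, pull_d, sub_zero, sub_self]

variable {F}

/-! ### Parallel refinements -/

section Parallel

variable {c c' : Cover Φ} (ρ τ : Cover.Refinement c c') (z : F.RelCochain c 1)

/-- The prism operator between two parallel refinements, applied to a relative cochain `(s, t)`:
`s_{a a'}` on `M` and `t_{b_0 b_1 b'_1} - t_{b_0 b'_0 b'_1}` on `N`. -/
def prism : F.RelCochain c' 0 :=
  (fun α => F.onM.res (W := inter c.U ![ρ.a (α 0), τ.a (α 0)])
      (fun _ hx => mem_inter_two (ρ.le_a _ (mem_inter.1 hx 0)) (τ.le_a _ (mem_inter.1 hx 0)))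
      (z.1 _),
    fun α => F.onN.res (W := inter c.V ![ρ.b (α 0), ρ.b (α 1), τ.b (α 1)])
      (fun _ hx => mem_inter_three (ρ.V_le _ (mem_inter.1 hx 0)) (ρ.V_le _ (mem_inter.1 hx 1))
        (τ.V_le _ (mem_inter.1 hx 1))) (z.2 _) -
      F.onN.res (W := inter c.V ![ρ.b (α 0), τ.b (α 0), τ.b (α 1)])
      (fun _ hx => mem_inter_three (ρ.V_le _ (mem_inter.1 hx 0)) (τ.V_le _ (mem_inter.1 hx 0))
        (τ.V_le _ (mem_inter.1 hx 1))) (z.2 _))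

/-- Parallel refinements are homotopic: the prism operator is a homotopy on relative cocycles. -/
theorem relD_prism (hz : F.relD c 1 z = 0) :
    F.relRefine ρ 1 z - F.relRefine τ 1 z = F.relD c' 0 (prism ρ τ z) := by
  have hM : F.pull c 2 z.2 - F.onM.d c.U 1 z.1 = 0 := congrArg Prod.fst hz
  have hN : F.onN.d c.V 2 z.2 = 0 := congrArg Prod.snd hz
  have key : ∀ y (j : Fin 4 → c.J), (∀ l, y ∈ c.V (j l)) →
      altSum (F.onN.valueAt z.2 y) j = 0 := fun y j h => by
    have hj : y ∈ inter c.V j := mem_inter.2 h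
    rw [← FunctionPresheaf.valueAt_d _ hj, hN, FunctionPresheaf.valueAt_of_mem _ hj]
    rfl
  have keyM : ∀ x (i : Fin 3 → c.I), (∀ l, x ∈ c.U (i l)) →
      altSum (F.onM.valueAt z.1 x) i = F.onN.valueAt z.2 (Φ x) (c.r ∘ i) := fun x i h => by
    have hi : x ∈ inter c.U i := mem_inter.2 h
    rw [← FunctionPresheaf.valueAt_d _ hi, FunctionPresheaf.valueAt_of_mem _ hi,
      FunctionPresheaf.valueAt_of_mem _ (mapsTo_inter c.mapsTo i x hi), ← sub_eq_zero.1 hM]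
    rfl
  have vN : ∀ y (α : Fin 2 → c'.J), y ∈ inter c'.V α →
      F.onN.valueAt (prism ρ τ z).2 y α =
        F.onN.valueAt z.2 y ![ρ.b (α 0), ρ.b (α 1), τ.b (α 1)] -
          F.onN.valueAt z.2 y ![ρ.b (α 0), τ.b (α 0), τ.b (α 1)] := fun y α h => by
    have h0 := mem_inter.1 h 0
    have h1 := mem_inter.1 h 1
    rw [FunctionPresheaf.valueAt_of_mem _ h, FunctionPresheaf.valueAt_of_mem z.2 (mem_inter_three
      (ρ.V_le _ h0) (ρ.V_le _ h1) (τ.V_le _ h1)), FunctionPresheaf.valueAt_of_mem z.2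
      (mem_inter_three (ρ.V_le _ h0) (τ.V_le _ h0) (τ.V_le _ h1))]
    rfl
  have vM : ∀ x (α : Fin 1 → c'.I), x ∈ inter c'.U α →
      F.onM.valueAt (prism ρ τ z).1 x α = F.onM.valueAt z.1 x ![ρ.a (α 0), τ.a (α 0)] :=
    fun x α h => by
    have h0 := mem_inter.1 h 0
    rw [FunctionPresheaf.valueAt_of_mem _ h, FunctionPresheaf.valueAt_of_mem z.1 (mem_inter_two
      (ρ.le_a _ h0) (τ.le_a _ h0))]
    rfl
  have comp3 : ∀ {κ κ' : Type u} (f : κ → κ') (α : Fin 3 → κ),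
      f ∘ α = ![f (α 0), f (α 1), f (α 2)] := fun f α => by
    funext l
    fin_cases l <;> rfl
  have comp2 : ∀ {κ κ' : Type u} (f : κ → κ') (α : Fin 2 → κ),
      f ∘ α = ![f (α 0), f (α 1)] := fun f α => by
    funext l
    fin_cases l <;> rfl
  refine Prod.ext (FunctionPresheaf.cochain_ext fun x α h => ?_)
    (FunctionPresheaf.cochain_ext fun y α h => ?_)
  · have h0 := mem_inter.1 h 0
    have h1 := mem_inter.1 h 1
    have e1 : F.onM.valueAt (F.relRefine ρ 1 z - F.relRefine τ 1 z).1 x α =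
        F.onM.valueAt z.1 x ![ρ.a (α 0), ρ.a (α 1)] -
          F.onM.valueAt z.1 x ![τ.a (α 0), τ.a (α 1)] := by
      rw [← comp2, ← comp2, FunctionPresheaf.valueAt_of_mem _ h,
        FunctionPresheaf.valueAt_of_mem z.1 (x := x) (mapsTo_inter (f := id) ρ.le_a α x h),
        FunctionPresheaf.valueAt_of_mem z.1 (x := x) (mapsTo_inter (f := id) τ.le_a α x h)]
      rfl
    have e2 : F.onM.valueAt (F.relD c' 0 (prism ρ τ z)).1 x α =
        F.onN.valueAt (prism ρ τ z).2 (Φ x) (c'.r ∘ α) -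
          F.onM.valueAt (F.onM.d c'.U 0 (prism ρ τ z).1) x α := by
      rw [FunctionPresheaf.valueAt_of_mem _ h, FunctionPresheaf.valueAt_of_mem _ h,
        FunctionPresheaf.valueAt_of_mem _ (mapsTo_inter c'.mapsTo α x h)]
      rfl
    have k1 := keyM x ![ρ.a (α 0), ρ.a (α 1), τ.a (α 1)] (fun l => by
      fin_cases l
      exacts [ρ.le_a _ h0, ρ.le_a _ h1, τ.le_a _ h1])
    have k2 := keyM x ![ρ.a (α 0), τ.a (α 0), τ.a (α 1)] (fun l => by
      fin_cases l
      exacts [ρ.le_a _ h0, τ.le_a _ h0, τ.le_a _ h1])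
    rw [altSum_two, comp3] at k1 k2
    rw [e1, e2, FunctionPresheaf.valueAt_d _ h, altSum_one,
      vM x _ (mem_inter.2 fun l => by fin_cases l; exact h1),
      vM x _ (mem_inter.2 fun l => by fin_cases l; exact h0),
      vN _ _ (mapsTo_inter c'.mapsTo α x h)]
    change _ = (F.onN.valueAt z.2 (Φ x) ![ρ.b (α 0).1, ρ.b (α 1).1, τ.b (α 1).1] -
      F.onN.valueAt z.2 (Φ x) ![ρ.b (α 0).1, τ.b (α 0).1, τ.b (α 1).1]) - _
    refine Eq.trans ?_ (congrArg (· - _) (congrArg₂ (· - ·) k1 k2))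
    simp
    abel
  · have h0 := mem_inter.1 h 0
    have h1 := mem_inter.1 h 1
    have h2 := mem_inter.1 h 2
    have e1 : F.onN.valueAt (F.relRefine ρ 1 z - F.relRefine τ 1 z).2 y α =
        F.onN.valueAt z.2 y ![ρ.b (α 0), ρ.b (α 1), ρ.b (α 2)] -
          F.onN.valueAt z.2 y ![τ.b (α 0), τ.b (α 1), τ.b (α 2)] := by
      rw [← comp3, ← comp3, FunctionPresheaf.valueAt_of_mem _ h,
        FunctionPresheaf.valueAt_of_mem z.2 (x := y) (mapsTo_inter (f := id) ρ.V_le α y h),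
        FunctionPresheaf.valueAt_of_mem z.2 (x := y) (mapsTo_inter (f := id) τ.V_le α y h)]
      rfl
    have e2 : F.onN.valueAt (F.relD c' 0 (prism ρ τ z)).2 y α =
        F.onN.valueAt (F.onN.d c'.V 1 (prism ρ τ z).2) y α := rfl
    have k1 := key y ![ρ.b (α 0), ρ.b (α 1), ρ.b (α 2), τ.b (α 2)] (fun l => by
      fin_cases l
      exacts [ρ.V_le _ h0, ρ.V_le _ h1, ρ.V_le _ h2, τ.V_le _ h2])
    have k2 := key y ![ρ.b (α 0), ρ.b (α 1), τ.b (α 1), τ.b (α 2)] (fun l => by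
      fin_cases l
      exacts [ρ.V_le _ h0, ρ.V_le _ h1, τ.V_le _ h1, τ.V_le _ h2])
    have k3 := key y ![ρ.b (α 0), τ.b (α 0), τ.b (α 1), τ.b (α 2)] (fun l => by
      fin_cases l
      exacts [ρ.V_le _ h0, τ.V_le _ h0, τ.V_le _ h1, τ.V_le _ h2])
    rw [altSum_three] at k1 k2 k3
    rw [e1, e2, FunctionPresheaf.valueAt_d _ h, altSum_two, vN y _ (mem_inter_two h1 h2),
      vN y _ (mem_inter_two h0 h2), vN y _ (mem_inter_two h0 h1)]
    have k := congrArg₂ (· + ·) (congrArg₂ (· - ·) k1 k2) k3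
    simp only [sub_zero, add_zero] at k
    refine (sub_eq_zero.1 (Eq.trans ?_ k)).symm
    simp
    abel

/-- Refinement maps in relative cohomology do not depend on the index maps. -/
theorem coverHRefine_eq : F.coverHRefine ρ 0 = F.coverHRefine τ 0 := by
  refine QuotientAddGroup.addMonoidHom_ext _ (AddMonoidHom.ext fun z => ?_)
  refine (QuotientAddGroup.eq (s := (F.relD c' 0).range.addSubgroupOf (F.Cocycle c' 0))).2 ?_
  refine ⟨prism τ ρ z.1, ?_⟩
  rw [← relD_prism τ ρ z.1 z.2]
  change _ = - F.relRefine ρ 1 z.1 + F.relRefine τ 1 z.1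
  abel

end Parallel

/-! ### The direct limit -/

variable (F) in
open Classical in
/-- The projection onto the direct limit, as a homomorphism out of the direct sum. -/
def toH (p : ℕ) : (⨁ c : Cover Φ, F.CoverH c p) →+ F.H p :=
  QuotientAddGroup.mk' _

variable (F) in
open Classical in
/-- The map from the cohomology of a cover to the direct limit. -/
def ofCoverH (c : Cover Φ) (p : ℕ) : F.CoverH c p →+ F.H p :=
  (toH F p).comp (DirectSum.of (fun c : Cover Φ => F.CoverH c p) c)

variable (F) in
/-- The cohomology class on a cover of a relative cocycle. -/
def mkCoverH (c : Cover Φ) (p : ℕ) : F.Cocycle c p →+ F.CoverH c p :=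
  QuotientAddGroup.mk' _

theorem mkCoverH_surjective (c : Cover Φ) (p : ℕ) : Function.Surjective (mkCoverH F c p) :=
  QuotientAddGroup.mk'_surjective _

theorem mkCoverH_eq_zero {c : Cover Φ} {p : ℕ} {z : F.Cocycle c p} :
    mkCoverH F c p z = 0 ↔ ∃ u, F.relD c p u = z.1 :=
  QuotientAddGroup.eq_zero_iff z

theorem cls_eq (c : Cover Φ) (p : ℕ) (z : F.Cocycle c p) :
    F.cls c p z = ofCoverH F c p (mkCoverH F c p z) := rfl

theorem coverHRefine_mkCoverH {c c' : Cover Φ} (ρ : Cover.Refinement c c') (p : ℕ)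
    (z : F.Cocycle c p) :
    F.coverHRefine ρ p (mkCoverH F c p z) = mkCoverH F c' p (F.cocycleRefine ρ p z) := rfl

theorem ofCoverH_refine {c c' : Cover Φ} (ρ : Cover.Refinement c c') (p : ℕ) (h : F.CoverH c p) :
    ofCoverH F c' p (F.coverHRefine ρ p h) = ofCoverH F c p h := by
  classical
  refine Eq.symm (sub_eq_zero.1 ?_)
  have e : toH F p (DirectSum.of _ c h - DirectSum.of _ c' (F.coverHRefine ρ p h)) = 0 :=
    (QuotientAddGroup.eq_zero_iff _).2 (AddSubgroup.subset_closure ⟨c, c', ρ, h, rfl⟩)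
  rw [map_sub] at e
  exact e

theorem cls_eq_zero {c : Cover Φ} {p : ℕ} {z : F.Cocycle c p} {u : F.RelCochain c p}
    (h : F.relD c p u = z.1) : F.cls c p z = 0 := by
  rw [cls_eq, mkCoverH_eq_zero.2 ⟨u, h⟩, map_zero]

theorem cls_eq_of_sub {c : Cover Φ} {p : ℕ} {z w : F.Cocycle c p} {u : F.RelCochain c p}
    (h : F.relD c p u = z.1 - w.1) : F.cls c p z = F.cls c p w := by
  rw [← sub_eq_zero, ← map_sub]
  exact cls_eq_zero h

theorem cls_refine {c c' : Cover Φ} (ρ : Cover.Refinement c c') (p : ℕ) (z : F.Cocycle c p) :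
    F.cls c' p (F.cocycleRefine ρ p z) = F.cls c p z :=
  ofCoverH_refine ρ p (mkCoverH F c p z)

/-- Every class of the direct limit is that of a cocycle on one cover: two covers have a common
refinement. -/
theorem exists_cls {p : ℕ} (h : F.H p) : ∃ c z, F.cls c p z = h := by
  classical
  obtain ⟨x, rfl⟩ : ∃ x, toH F p x = h := QuotientAddGroup.mk'_surjective _ h
  induction x using DirectSum.induction_on with
  | zero =>
    refine ⟨⟨PUnit, fun _ => PUnit, fun _ => ⊤, fun _ => ⊤, fun _ => ⟨⟨⟩, trivial⟩,
      fun _ => ⟨⟨⟨⟩, ⟨⟩⟩, trivial⟩, fun _ _ _ => trivial⟩, 0, ?_⟩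
    rw [map_zero, map_zero]
  | of c z =>
    obtain ⟨z, rfl⟩ := mkCoverH_surjective c p z
    refine ⟨c, z, ?_⟩
    rw [cls_eq, ofCoverH, AddMonoidHom.comp_apply]
  | add x y hx hy =>
    obtain ⟨c, z, hz⟩ := hx
    obtain ⟨c', z', hz'⟩ := hy
    refine ⟨c.prod c', F.cocycleRefine (c.prodFst c') p z + F.cocycleRefine (c.prodSnd c') p z', ?_⟩
    rw [map_add, cls_refine, cls_refine, hz, hz', map_add]

section Lift

variable {B : Type*} [AddCommGroup B] {p : ℕ} (φ : ∀ c : Cover Φ, F.Cocycle c p →+ B)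
  (h0 : ∀ c u (z : F.Cocycle c p), F.relD c p u = z.1 → φ c z = 0)
  (h1 : ∀ (c c' : Cover Φ) (ρ : Cover.Refinement c c') z, φ c' (F.cocycleRefine ρ p z) = φ c z)

open Classical in
/-- The universal property of the relative cohomology group. -/
def liftH : F.H p →+ B :=
  QuotientAddGroup.lift _ (DirectSum.toAddMonoid fun c => QuotientAddGroup.lift _ (φ c)
    fun z hz => by
      obtain ⟨u, hu⟩ := hz
      exact h0 c u z hu) <| by
    rw [AddSubgroup.closure_le]
    rintro _ ⟨c, c', ρ, h, rfl⟩
    obtain ⟨z, rfl⟩ := QuotientAddGroup.mk'_surjective _ h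
    change DirectSum.toAddMonoid _ (_ - _) = 0
    rw [map_sub, DirectSum.toAddMonoid_of, DirectSum.toAddMonoid_of, sub_eq_zero]
    exact (h1 c c' ρ z).symm

theorem liftH_cls (c : Cover Φ) (z : F.Cocycle c p) : liftH φ h0 h1 (F.cls c p z) = φ c z := by
  classical
  refine Eq.trans (b := DirectSum.toAddMonoid (fun c => QuotientAddGroup.lift
      ((F.relD c p).range.addSubgroupOf (F.Cocycle c p)) (φ c) _)
      (DirectSum.of (fun c : Cover Φ => F.CoverH c p) c (mkCoverH F c p z))) rfl ?_
  rw [DirectSum.toAddMonoid_of]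
  rfl

end Lift

/-- A cocycle whose class in the direct limit vanishes is a coboundary on some refinement. -/
theorem exists_refine_eq_relD {c : Cover Φ} {z : F.Cocycle c 0} (h : F.cls c 0 z = 0) :
    ∃ (c' : Cover Φ) (ρ : Cover.Refinement c c') (u : F.RelCochain c' 0),
      F.relD c' 0 u = (F.cocycleRefine ρ 0 z).1 := by
  classical
  -- Parallel refinements agree in cohomology, so the limit is one over a directed preorder.
  let _ : Preorder (Cover Φ) :=
    { le := fun c c' => Nonempty (Cover.Refinement c c')
      le_refl := fun c => ⟨.id c⟩
      le_trans := fun _ _ _ h h' => ⟨h.some.comp h'.some⟩ }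
  have : IsDirectedOrder (Cover Φ) :=
    ⟨fun c c' => ⟨c.prod c', ⟨c.prodFst c'⟩, ⟨c.prodSnd c'⟩⟩⟩
  let f : ∀ c c' : Cover Φ, c ≤ c' → F.CoverH c 0 →+ F.CoverH c' 0 :=
    fun c c' hc => F.coverHRefine (Nonempty.some hc) 0
  have : DirectedSystem (fun c => F.CoverH c 0) fun c c' hc => f c c' hc :=
    { map_self := fun c x => by
        obtain ⟨z, rfl⟩ := mkCoverH_surjective c 0 x
        exact DFunLike.congr_fun (coverHRefine_eq _ (Cover.Refinement.id c)) _
      map_map := fun c'' c' c hc hc' x => by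
        obtain ⟨z, rfl⟩ := mkCoverH_surjective _ 0 x
        exact DFunLike.congr_fun (coverHRefine_eq (F := F)
          ((Nonempty.some hc).comp (Nonempty.some hc')) _) (mkCoverH F _ 0 z) }
  let φ (c : Cover Φ) : F.Cocycle c 0 →+ AddCommGroup.DirectLimit (fun c => F.CoverH c 0) f :=
    AddMonoidHom.mk' (fun z => AddCommGroup.DirectLimit.of (fun c => F.CoverH c 0) f c
      (mkCoverH F c 0 z)) fun z w => by
        rw [map_add]
        exact map_add (AddCommGroup.DirectLimit.of (fun c => F.CoverH c 0) f c) _ _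
  have φ0 : ∀ c u (z : F.Cocycle c 0), F.relD c 0 u = z.1 → φ c z = 0 := fun c u z hu => by
    change AddCommGroup.DirectLimit.of (fun c => F.CoverH c 0) f c (mkCoverH F c 0 z) = 0
    rw [mkCoverH_eq_zero.2 ⟨u, hu⟩]
    exact map_zero _
  have φ1 : ∀ (c c' : Cover Φ) (ρ : Cover.Refinement c c') z,
      φ c' (F.cocycleRefine ρ 0 z) = φ c z := fun c c' ρ z => by
    have h : f c c' ⟨ρ⟩ (mkCoverH F c 0 z) = mkCoverH F c' 0 (F.cocycleRefine ρ 0 z) :=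
      DFunLike.congr_fun (coverHRefine_eq (F := F) _ ρ) _
    change AddCommGroup.DirectLimit.of (fun c => F.CoverH c 0) f c' _ = _
    rw [← h]
    exact AddCommGroup.DirectLimit.of_f _ _
  have hq := congrArg (liftH φ φ0 φ1) h
  rw [map_zero, liftH_cls] at hq
  obtain ⟨c', hc, h'⟩ := AddCommGroup.DirectLimit.of.zero_exact _ _ hq
  obtain ⟨u, hu⟩ := mkCoverH_eq_zero.1
    ((coverHRefine_mkCoverH (F := F) (Nonempty.some hc) 0 z).symm.trans h')
  exact ⟨c', Nonempty.some hc, u, hu⟩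

end Coeff

/-! ### Refinements by neighbourhoods of points -/

namespace Cover

variable {M N : Type u} [TopologicalSpace M] [TopologicalSpace N] {Φ : M → N}

/-- A choice of neighbourhoods `W_j y` of the points `y ∈ V_j`, and `W'_i x` of the points
`x ∈ U_i`, of a cover. -/
structure Shrinking (c : Cover Φ) where
  W : c.J → N → Opens N
  W' : c.I → M → Opens M
  mem_W : ∀ j y, y ∈ c.V j → y ∈ W j y
  mem_W' : ∀ i x, x ∈ c.U i → x ∈ W' i x

namespace Shrinking

variable {c c' : Cover Φ}

/-- The refinement of a cover given by a choice of neighbourhoods: the sets `V_j ∩ W_j y` on `N`,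
indexed by all `j` and `y`, and the sets `U_i ∩ Φ⁻¹ (W_{r i} y) ∩ W'_i x` on `M`.  No index `j` is
dropped, since a point of `M` may lie in sets `U_i` for one single value of `r i` only. -/
def cover (S : Shrinking c) (hΦ : Continuous Φ) : Cover Φ where
  J := c.J × N
  fib j := c.fib j.1 × M
  V j := c.V j.1 ⊓ S.W j.1 j.2
  U i := c.U ⟨i.1.1, i.2.1⟩ ⊓ (S.W i.1.1 i.1.2).comap ⟨Φ, hΦ⟩ ⊓ S.W' ⟨i.1.1, i.2.1⟩ i.2.2
  cover_V y := by
    obtain ⟨j, hj⟩ := c.cover_V y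
    exact ⟨(j, y), hj, S.mem_W j y hj⟩
  cover_U x := by
    obtain ⟨⟨j, i⟩, hi⟩ := c.cover_U x
    exact ⟨⟨(j, Φ x), (i, x)⟩, ⟨hi, S.mem_W _ _ (c.mapsTo _ x hi)⟩, S.mem_W' _ _ hi⟩
  mapsTo i x hx := ⟨c.mapsTo _ x hx.1.1, hx.1.2⟩

/-- The refinement of a cover given by a choice of neighbourhoods. -/
def ref (S : Shrinking c) (hΦ : Continuous Φ) : Refinement c (S.cover hΦ) where
  b := Prod.fst
  fibMap _ := Prod.fst
  V_le _ := inf_le_left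
  U_le _ := inf_le_left.trans inf_le_left

/-- Smaller neighbourhoods on a finer cover give a refinement. -/
def refOfLE {S : Shrinking c} {T : Shrinking c'} (hΦ : Continuous Φ) (ρ : Refinement c c')
    (h : ∀ j y, T.W j y ≤ S.W (ρ.b j) y) (h' : ∀ i x, T.W' i x ≤ S.W' (ρ.a i) x) :
    Refinement (S.cover hΦ) (T.cover hΦ) where
  b j := (ρ.b j.1, j.2)
  fibMap j i := (ρ.fibMap j.1 i.1, i.2)
  V_le j := inf_le_inf (ρ.V_le j.1) (h j.1 j.2)
  U_le i := inf_le_inf (inf_le_inf (ρ.U_le ⟨i.1.1, i.2.1⟩) fun _ hx => h _ _ hx) (h' _ _)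

end Shrinking

end Cover

/-! ### Logarithms of `U(1)`-valued cochains -/

section Log

variable {E H : Type*} [NormedAddCommGroup E] [NormedSpace ℝ E] [TopologicalSpace H]
  {I : ModelWithCorners ℝ E H} {X : Type*} [TopologicalSpace X] [ChartedSpace H X]

/-- A continuous logarithm of a smooth `U(1)`-valued function is smooth: near each point it differs
by a constant from the principal branch of the argument of a translate of the function. -/
theorem contMDiff_of_exp {f : X → ℝ} (hf : Continuous f)
    (h : ContMDiff I (𝓡 1) ∞ fun x => Circle.exp (2 * Real.pi * f x)) :
    ContMDiff I 𝓘(ℝ, ℝ) ∞ f := by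
  intro a
  have := finrank_real_complex_fact'
  let z (x : X) : Circle := Circle.exp (2 * Real.pi * f x) * (Circle.exp (2 * Real.pi * f a))⁻¹
  have hz : ContMDiff I (𝓡 1) ∞ z := h.mul contMDiff_const
  have hz' : ContMDiff I 𝓘(ℝ, ℂ) ∞ fun x => (z x : ℂ) :=
    (contMDiff_coe_sphere (E := ℂ) (n := 1)).comp hz
  have hza : (z a : ℂ) = 1 := by simp [z]
  have harg : ContDiffAt ℝ ∞ Complex.arg (z a : ℂ) := by
    rw [hza]
    have h1 : ContDiffAt ℝ ∞ Complex.log 1 :=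
      (Complex.contDiffAt_log (n := ∞) Complex.one_mem_slitPlane).restrict_scalars ℝ
    have h2 : ContDiffAt ℝ ∞ (fun w => (Complex.log w).im) 1 :=
      Complex.imCLM.contDiff.contDiffAt.comp _ h1
    exact h2.congr_of_eventuallyEq (.of_forall fun w => (Complex.log_im w).symm)
  have h3 : ContMDiffAt I 𝓘(ℝ, ℝ) ∞ (fun x => Complex.arg (z x)) a :=
    ContMDiffAt.comp (g := Complex.arg) (f := fun x => (z x : ℂ)) a harg.contMDiffAt (hz' a)
  have h4 : ContMDiffAt I 𝓘(ℝ, ℝ) ∞ (fun x => f a + (2 * Real.pi)⁻¹ * Complex.arg (z x)) a := by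
    have h5 : ContDiff ℝ ∞ fun t : ℝ => f a + (2 * Real.pi)⁻¹ * t :=
      contDiff_const.add (contDiff_const.mul contDiff_id)
    exact ContMDiffAt.comp (g := fun t : ℝ => f a + (2 * Real.pi)⁻¹ * t) a
      h5.contMDiff.contMDiffAt h3
  refine h4.congr_of_eventuallyEq ?_
  have hnear : ∀ᶠ x in nhds a, |2 * Real.pi * f x - 2 * Real.pi * f a| < Real.pi := by
    have hc : Continuous fun x => |2 * Real.pi * f x - 2 * Real.pi * f a| := by fun_prop
    refine hc.continuousAt.eventually_lt continuousAt_const ?_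
    simpa using Real.pi_pos
  filter_upwards [hnear] with x hx
  have hzx : z x = Circle.exp (2 * Real.pi * f x - 2 * Real.pi * f a) := by
    rw [Circle.exp_sub, div_eq_mul_inv]
  rw [hzx, Circle.arg_exp (abs_lt.1 hx).1 (abs_lt.1 hx).2.le]
  have : Real.pi ≠ 0 := Real.pi_ne_zero
  field_simp
  ring

/-- Every point has arbitrarily small open neighbourhoods `S` on which continuous `U(1)`-valued
functions have logarithms: the inverse images of small balls in a chart.  These are star-shaped
around the point, so that the homotopy lifting property of the exponential map applies. -/
theorem exists_log_nhds (I : ModelWithCorners ℝ E H) (O : Opens X) {a : X} (ha : a ∈ O) :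
    ∃ S : Opens X, a ∈ S ∧ S ≤ O ∧ ∀ u : S → Circle, Continuous u →
      ∃ f : S → ℝ, Continuous f ∧ ∀ x, u x = Circle.exp (2 * Real.pi * f x) := by
  let φ := extChartAt I a
  have hO : φ.symm ⁻¹' O ∩ φ.target ∈ nhdsWithin (φ a) (Set.range I) :=
    Filter.inter_mem ((continuousAt_extChartAt_symm a).continuousWithinAt.preimage_mem_nhdsWithin
      (by
        refine O.isOpen.mem_nhds ?_
        rw [extChartAt_to_inv]
        exact ha)) (extChartAt_target_mem_nhdsWithin a)
  obtain ⟨ε, hε, hball⟩ := Metric.mem_nhdsWithin_iff.1 hO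
  have hopen : IsOpen (φ.source ∩ φ ⁻¹' Metric.ball (φ a) ε) :=
    (continuousOn_extChartAt a).isOpen_inter_preimage (isOpen_extChartAt_source a)
      Metric.isOpen_ball
  let S : Opens X := ⟨_, hopen⟩
  have haS : a ∈ S := ⟨mem_extChartAt_source a, Metric.mem_ball_self hε⟩
  have hconv : Convex ℝ (Metric.ball (φ a) ε ∩ Set.range I) :=
    (convex_ball _ _).inter I.convex_range
  have hmem : ∀ x ∈ S, φ x ∈ Metric.ball (φ a) ε ∩ Set.range I := fun x hx =>
    ⟨hx.2, extChartAt_target_subset_range (I := I) a (φ.map_source hx.1)⟩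
  have hline : ∀ (t : unitInterval) (x : X), x ∈ S →
      AffineMap.lineMap (φ a) (φ x) (t : ℝ) ∈ Metric.ball (φ a) ε ∩ Set.range I := fun t x hx =>
    hconv.lineMap_mem (hmem a haS) (hmem x hx) t.2
  have hsymm : ∀ v ∈ Metric.ball (φ a) ε ∩ Set.range I, φ.symm v ∈ S := fun v hv => by
    refine ⟨φ.map_target (hball hv).2, ?_⟩
    change φ (φ.symm v) ∈ Metric.ball (φ a) ε
    rw [φ.right_inv (hball hv).2]
    exact hv.1
  refine ⟨S, haS, fun x hx => ?_, fun u hu => ?_⟩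
  · have := (hball (hmem x hx)).1
    rw [Set.mem_preimage, φ.left_inv hx.1] at this
    exact this
  · have hcφ : Continuous fun x : S => φ x.1 :=
      ((continuousOn_extChartAt a).mono fun _ hx => hx.1).domRestrict
    have hcl : Continuous fun q : unitInterval × S =>
        AffineMap.lineMap (φ a) (φ q.2.1) (q.1 : ℝ) := by
      simp only [AffineMap.lineMap_apply_module]
      have := hcφ.comp (continuous_snd (X := unitInterval))
      have h1 : Continuous fun q : unitInterval × S => (q.1 : ℝ) :=
        continuous_subtype_val.comp continuous_fst
      exact ((continuous_const.sub h1).smul continuous_const).add (h1.smul this)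
    let G : C(unitInterval × S, Circle) :=
      ⟨fun q => u ⟨φ.symm (AffineMap.lineMap (φ a) (φ q.2.1) (q.1 : ℝ)),
          hsymm _ (hline q.1 q.2.1 q.2.2)⟩,
        hu.comp (((continuousOn_extChartAt_symm a).comp_continuous hcl
          fun q => (hball (hline q.1 q.2.1 q.2.2)).2).subtype_mk _)⟩
    let c0 : C(S, ℝ) := .const _ (Complex.arg (u ⟨a, haS⟩))
    have h0 : ∀ x, G (0, x) = Circle.exp (c0 x) := fun x => by
      change u _ = Circle.exp (Complex.arg _)
      rw [Circle.exp_arg]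
      refine congrArg u (Subtype.ext ?_)
      change φ.symm (AffineMap.lineMap (φ a) (φ x.1) ((0 : unitInterval) : ℝ)) = a
      rw [Set.Icc.coe_zero, AffineMap.lineMap_apply_zero, extChartAt_to_inv]
    let K := Circle.isCoveringMap_exp.liftHomotopy G c0 h0
    have hK : ∀ x, Circle.exp (K (1, x)) = u x := fun x => by
      have h1 := congrFun (Circle.isCoveringMap_exp.liftHomotopy_lifts G c0 h0) (1, x)
      refine h1.trans (congrArg u (Subtype.ext ?_))
      change φ.symm (AffineMap.lineMap (φ a) (φ x.1) ((1 : unitInterval) : ℝ)) = x.1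
      rw [Set.Icc.coe_one, AffineMap.lineMap_apply_one, φ.left_inv x.2.1]
    refine ⟨fun x => K (1, x) / (2 * Real.pi), ?_, fun x => ?_⟩
    · exact (K.continuous.comp (Continuous.prodMk_right 1)).div_const _
    · rw [mul_div_cancel₀ _ (by positivity), hK]

theorem inter_inf_le {ι : Type*} (U : ι → Opens X) (W : ι → X → Opens X) {n : ℕ}
    (α : Fin n → ι × X) :
    inter (fun a : ι × X => U a.1 ⊓ W a.1 a.2) α ≤ inter U (Prod.fst ∘ α) :=
  fun _ hx => mem_inter.2 fun k => (mem_inter.1 hx k).1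

/-- For every family `U` of open sets there are neighbourhoods `W_i x` of the points `x ∈ U_i`
such that smooth `U(1)`-valued functions on the intersections of members of `U` have logarithms on
the intersections of the corresponding sets `U_i ∩ W_i x`.  The set `W_i x` is contained in a ball
around `x` of radius one third of the distance to the complement of `U_i`.  If some sets of this
type have a common point, then the one with the smallest radius is contained in all members of `U`
involved. -/
theorem exists_log_shrinking [FiniteDimensional ℝ E] [T2Space X] [SigmaCompactSpace X]
    (I : ModelWithCorners ℝ E H) {ι : Type*} (U : ι → Opens X) :
    ∃ W : ι → X → Opens X, (∀ i x, x ∈ U i → x ∈ W i x) ∧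
      ∀ (n : ℕ) (α : Fin (n + 1) → ι × X) (u : inter U (Prod.fst ∘ α) → Circle),
        ContMDiff I (𝓡 1) ∞ u →
        ∃ f : inter (fun a : ι × X => U a.1 ⊓ W a.1 a.2) α → ℝ, ContMDiff I 𝓘(ℝ, ℝ) ∞ f ∧
          ∀ x, u ⟨x.1, inter_inf_le U W α x.2⟩ =
            Circle.exp (2 * Real.pi * f x) := by
  have := Manifold.metrizableSpace I X
  let _ := metrizableSpaceMetric X
  have h1 : ∀ i x, ∃ r : ℝ, x ∈ U i → 0 < r ∧ Metric.ball x (3 * r) ⊆ U i := fun i x => by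
    by_cases hx : x ∈ U i
    · obtain ⟨ε, hε, h⟩ := Metric.isOpen_iff.1 (U i).isOpen x hx
      exact ⟨ε / 3, fun _ => ⟨by positivity, by rwa [mul_div_cancel₀ _ (by norm_num)]⟩⟩
    · exact ⟨0, fun h => absurd h hx⟩
  choose r hr using h1
  have h2 : ∀ i x, ∃ S : Opens X, (x ∈ U i → x ∈ S) ∧
      (S : Set X) ⊆ Metric.ball x (r i x) ∧ ((S : Set X).Nonempty → x ∈ U i) ∧
      ∀ u : S → Circle, Continuous u →
        ∃ f : S → ℝ, Continuous f ∧ ∀ x, u x = Circle.exp (2 * Real.pi * f x) := fun i x => by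
    by_cases hx : x ∈ U i
    · obtain ⟨S, h, h', h''⟩ := exists_log_nhds I ⟨Metric.ball x (r i x), Metric.isOpen_ball⟩
        (Metric.mem_ball_self (hr i x hx).1)
      exact ⟨S, fun _ => h, h', fun _ => hx, h''⟩
    · exact ⟨⊥, fun h => absurd h hx, fun _ h => h.elim, fun ⟨_, h⟩ => h.elim,
        fun u _ => ⟨fun _ => 0, continuous_const, fun x => x.2.elim⟩⟩
  choose W hW hWball hWne hWlog using h2
  refine ⟨W, hW, fun n α u hu => ?_⟩
  by_cases hne : (inter (fun a : ι × X => U a.1 ⊓ W a.1 a.2) α : Set X).Nonempty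
  -- The member with the smallest radius `r` lies in all the sets of `U` which are involved.
  · obtain ⟨p, hp⟩ := hne
    have hp' : ∀ k, p ∈ W (α k).1 (α k).2 := fun k => (mem_inter.1 hp k).2
    obtain ⟨k, hk⟩ := Finite.exists_min fun k => r (α k).1 (α k).2
    have hsub : W (α k).1 (α k).2 ≤ inter U (Prod.fst ∘ α) := fun x hx => mem_inter.2 fun l => by
      have hl := hr (α l).1 (α l).2 (hWne _ _ ⟨p, hp' l⟩)
      refine hl.2 ?_
      have e1 : dist x (α k).2 < r (α k).1 (α k).2 := hWball _ _ hx
      have e2 : dist p (α k).2 < r (α k).1 (α k).2 := hWball _ _ (hp' k)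
      have e3 : dist p (α l).2 < r (α l).1 (α l).2 := hWball _ _ (hp' l)
      have e4 := hk l
      have e5 := dist_triangle x (α k).2 (α l).2
      have e6 := dist_triangle_left (α k).2 (α l).2 p
      rw [Metric.mem_ball]
      linarith
    obtain ⟨f, hf, huf⟩ := hWlog _ _ (fun x => u ⟨x.1, hsub x.2⟩)
      (hu.continuous.comp (Opens.isOpenEmbedding_of_le hsub).continuous)
    have hle : inter (fun a : ι × X => U a.1 ⊓ W a.1 a.2) α ≤ W (α k).1 (α k).2 :=
      fun x hx => (mem_inter.1 hx k).2
    have hfs : ContMDiff I 𝓘(ℝ, ℝ) ∞ f := by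
      refine contMDiff_of_exp hf ?_
      simp only [← huf]
      exact hu.comp (contMDiff_inclusion hsub)
    exact ⟨fun x => f ⟨x.1, hle x.2⟩, hfs.comp (contMDiff_inclusion hle), fun x =>
      huf ⟨x.1, hle x.2⟩⟩
  · have he : IsEmpty (inter (fun a : ι × X => U a.1 ⊓ W a.1 a.2) α) :=
      ⟨fun x => hne ⟨x.1, x.2⟩⟩
    exact ⟨fun _ => 0, contMDiff_const, fun x => isEmptyElim x⟩

end Log

/-! ### Acyclicity of the smooth real-valued functions -/

section Acyclic

variable {E H : Type*} [NormedAddCommGroup E] [NormedSpace ℝ E] [TopologicalSpace H]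
  {I : ModelWithCorners ℝ E H} {X : Type*} [TopologicalSpace X] [ChartedSpace H X]
  {ι : Type*} {U : ι → Opens X}

theorem contMDiffAt_valueAt {p : ℕ} (f : (realPresheaf I X).Cochain U p) {α : Fin (p + 1) → ι}
    {x : X} (h : x ∈ inter U α) :
    ContMDiffAt I 𝓘(ℝ, ℝ) ∞ (fun y => (realPresheaf I X).valueAt f y α) x := by
  refine (contMDiffAt_subtype_iff (U := inter U α) (x := ⟨x, h⟩)).1 ?_
  exact ((f α).2 ⟨x, h⟩).congr_of_eventuallyEq
    (.of_forall fun y => FunctionPresheaf.valueAt_of_mem f y.2)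

/-- With a partition of unity `χ`, the sums `∑ i, χ_i f_{i i_0 ⋯ i_p}` are a primitive of the real
cocycle `f`. -/
theorem exists_d_eq [FiniteDimensional ℝ E] [IsManifold I ∞ X] [T2Space X] [SigmaCompactSpace X]
    (hU : ∀ x, ∃ i, x ∈ U i) {p : ℕ} (f : (realPresheaf I X).Cochain U (p + 1))
    (hf : (realPresheaf I X).d U (p + 1) f = 0) : ∃ g, (realPresheaf I X).d U p g = f := by
  obtain ⟨χ, hχ⟩ := SmoothPartitionOfUnity.exists_isSubordinate I (isClosed_univ (X := X))
    (fun i => (U i : Set X)) (fun i => (U i).isOpen)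
    (fun x _ => Set.mem_iUnion.2 (hU x))
  have hmem : ∀ (i : ι) {n : ℕ} (α : Fin n → ι) (x : X), x ∈ U i → x ∈ inter U α →
      x ∈ inter U (Fin.cons i α : Fin (n + 1) → ι) := fun i n α x hi hα =>
    mem_inter.2 (Fin.cases hi (mem_inter.1 hα))
  let g : (realPresheaf I X).Cochain U p := fun α =>
    ⟨fun x => ∑ᶠ i, χ i x.1 • (realPresheaf I X).valueAt f x.1 (Fin.cons i α), fun x =>
      (contMDiffAt_subtype_iff (U := inter U α) (f := fun x : X =>
        ∑ᶠ i, χ i x • (realPresheaf I X).valueAt f x (Fin.cons i α))).2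
        (χ.contMDiffAt_finsum fun i hi => contMDiffAt_valueAt f (hmem i α x.1 (hχ i hi) x.2))⟩
  have hg : ∀ (x : X) (α : Fin (p + 1) → ι), x ∈ inter U α → (realPresheaf I X).valueAt g x α =
      ∑ i ∈ χ.finsupport x, χ i x • (realPresheaf I X).valueAt f x (Fin.cons i α) :=
    fun x α h => by
    rw [FunctionPresheaf.valueAt_of_mem g h]
    exact (χ.sum_finsupport_smul_eq_finsum x
      (fun i x => (realPresheaf I X).valueAt f x (Fin.cons i α))).symm
  refine ⟨g, FunctionPresheaf.cochain_ext fun x α h => ?_⟩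
  have hcone : ∀ i ∈ χ.finsupport x, altSum (fun β => (realPresheaf I X).valueAt f x
      (Fin.cons i β)) α = (realPresheaf I X).valueAt f x α := fun i hi => by
    have hxi : x ∈ U i := hχ i (subset_tsupport _ ((χ.mem_finsupport x).1 hi))
    have h1 := altSum_cons ((realPresheaf I X).valueAt f x) i α
    rw [← FunctionPresheaf.valueAt_d f (hmem i α x hxi h), hf,
      FunctionPresheaf.valueAt_of_mem _ (hmem i α x hxi h)] at h1
    exact (sub_eq_zero.1 h1.symm).symm
  have hsum : altSum ((realPresheaf I X).valueAt g x) α = ∑ i ∈ χ.finsupport x, χ i x •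
      altSum (fun β => (realPresheaf I X).valueAt f x (Fin.cons i β)) α := by
    have e : altSum ((realPresheaf I X).valueAt g x) α = ∑ k : Fin (p + 2), (-1 : ℤ) ^ (k : ℕ) •
        ∑ i ∈ χ.finsupport x, χ i x • (realPresheaf I X).valueAt f x
          (Fin.cons i (α ∘ k.succAbove)) :=
      Finset.sum_congr rfl fun k _ => congrArg _ (hg x _ (inter_le_face U α k h))
    rw [e]
    simp only [altSum, Finset.smul_sum]
    rw [Finset.sum_comm]
    refine Finset.sum_congr rfl fun i _ => Finset.sum_congr rfl fun k _ => smul_comm _ _ _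
  rw [FunctionPresheaf.valueAt_d g h, hsum, Finset.sum_congr rfl fun i hi =>
    congrArg (χ i x • ·) (hcone i hi), ← Finset.sum_smul, χ.sum_finsupport x (Set.mem_univ x),
    one_smul]

variable {M : Type u} [TopologicalSpace M] [ChartedSpace H M]
  {E' H' : Type*} [NormedAddCommGroup E'] [NormedSpace ℝ E'] [TopologicalSpace H']
  {I' : ModelWithCorners ℝ E' H'} {N : Type u} [TopologicalSpace N]
  [ChartedSpace H' N]

/-- The relative real cohomology with respect to any cover vanishes in degrees at least two. -/
theorem exists_relD_eq [FiniteDimensional ℝ E] [FiniteDimensional ℝ E'] [IsManifold I ∞ M]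
    [T2Space M] [SigmaCompactSpace M]
    [IsManifold I' ∞ N] [T2Space N] [SigmaCompactSpace N] {Φ : C^∞⟮I, M; I', N⟯} {c : Cover Φ}
    {p : ℕ} (z : (realCoeff Φ).RelCochain c (p + 1)) (hz : (realCoeff Φ).relD c (p + 1) z = 0) :
    ∃ f, (realCoeff Φ).relD c p f = z := by
  have hM : (realCoeff Φ).pull c (p + 2) z.2 - (realCoeff Φ).onM.d c.U (p + 1) z.1 = 0 :=
    congrArg Prod.fst hz
  have hN : (realCoeff Φ).onN.d c.V (p + 2) z.2 = 0 := congrArg Prod.snd hz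
  obtain ⟨b, hb⟩ : ∃ b : (realCoeff Φ).onN.Cochain c.V (p + 1),
      (realCoeff Φ).onN.d c.V (p + 1) b = z.2 := exists_d_eq (I := I') c.cover_V z.2 hN
  obtain ⟨a, ha⟩ : ∃ a : (realCoeff Φ).onM.Cochain c.U p,
      (realCoeff Φ).onM.d c.U p a = (realCoeff Φ).pull c (p + 1) b - z.1 :=
    exists_d_eq (I := I) c.cover_U ((realCoeff Φ).pull c (p + 1) b - z.1) (by
      refine (map_sub ((realCoeff Φ).onM.d c.U (p + 1)) _ _).trans ?_
      rw [← Coeff.pull_d, hb]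
      exact hM)
  refine ⟨(a, b), Prod.ext ?_ hb⟩
  change (realCoeff Φ).pull c (p + 1) b - (realCoeff Φ).onM.d c.U p a = _
  rw [ha, sub_sub_cancel]

end Acyclic

/-! ### The exponential sequence -/

section Exponential

variable {E H : Type*} [NormedAddCommGroup E] [NormedSpace ℝ E] [TopologicalSpace H]
  {I : ModelWithCorners ℝ E H} {M : Type u} [TopologicalSpace M] [ChartedSpace H M]
  {E' H' : Type*} [NormedAddCommGroup E'] [NormedSpace ℝ E'] [TopologicalSpace H']
  {I' : ModelWithCorners ℝ E' H'} {N : Type u} [TopologicalSpace N] [ChartedSpace H' N]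
  {Φ : C^∞⟮I, M; I', N⟯} {c c' : Cover Φ} {p : ℕ}

/-- The homomorphism `t ↦ exp (2 π √-1 t)`. -/
def expHom : ℝ →+ Additive Circle where
  toFun t := Additive.ofMul (Circle.exp (2 * Real.pi * t))
  map_zero' := by simp
  map_add' s t := by rw [mul_add, Circle.exp_add, ofMul_mul]

theorem expHom_eq_zero {t : ℝ} : expHom t = 0 ↔ ∃ n : ℤ, t = n := by
  change Circle.exp (2 * Real.pi * t) = 1 ↔ _
  rw [Circle.exp_eq_one]
  refine exists_congr fun n => ?_
  have : Real.pi ≠ 0 := Real.pi_ne_zero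
  constructor
  · intro h
    field_simp at h
    linarith
  · rintro rfl
    ring

/-- A homomorphism of coefficient groups which preserves sections commutes with the differential:
the version for cochains `f` and `g` with `g = φ ∘ f`. -/
theorem d_comp {X : Type*} [TopologicalSpace X] {A B : Type*} [AddCommGroup A] [AddCommGroup B]
    {F : FunctionPresheaf X A} {G : FunctionPresheaf X B} {ι : Type*} {U : ι → Opens X}
    (φ : A →+ B) (f : F.Cochain U p) (g : G.Cochain U p)
    (h : ∀ α x, (g α).1 x = φ ((f α).1 x)) (α : Fin (p + 2) → ι) (x : inter U α) :
    (G.d U p g α).1 x = φ ((F.d U p f α).1 x) := by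
  rw [FunctionPresheaf.d_apply, FunctionPresheaf.d_apply, map_sum]
  refine Finset.sum_congr rfl fun k _ => ?_
  rw [map_zsmul, h]

section Comp

variable {A B : Type*} [AddCommGroup A] [AddCommGroup B] {F : Coeff Φ A} {G : Coeff Φ B}

/-- The relative cochain `g` is the image of `f` under the homomorphism `φ` of coefficients. -/
def IsImage (φ : A →+ B) (f : F.RelCochain c p) (g : G.RelCochain c p) : Prop :=
  (∀ α x, (g.1 α).1 x = φ ((f.1 α).1 x)) ∧ ∀ α x, (g.2 α).1 x = φ ((f.2 α).1 x)

variable {φ : A →+ B} {f f₁ f₂ : F.RelCochain c p} {g g₁ g₂ : G.RelCochain c p}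

theorem IsImage.relD (h : IsImage φ f g) : IsImage φ (F.relD c p f) (G.relD c p g) := by
  refine ⟨fun α x => ?_, fun α x => d_comp φ f.2 g.2 h.2 α x⟩
  change (g.2 (c.r ∘ α)).1 _ - (G.onM.d c.U p g.1 α).1 x =
    φ ((f.2 (c.r ∘ α)).1 _ - (F.onM.d c.U p f.1 α).1 x)
  rw [map_sub, h.2, d_comp φ f.1 g.1 h.1]

theorem IsImage.sub (h₁ : IsImage φ f₁ g₁) (h₂ : IsImage φ f₂ g₂) :
    IsImage φ (f₁ - f₂) (g₁ - g₂) := by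
  refine ⟨fun α x => ?_, fun α x => ?_⟩
  · change (g₁.1 α).1 x - (g₂.1 α).1 x = φ ((f₁.1 α).1 x - (f₂.1 α).1 x)
    rw [map_sub, h₁.1, h₂.1]
  · change (g₁.2 α).1 x - (g₂.2 α).1 x = φ ((f₁.2 α).1 x - (f₂.2 α).1 x)
    rw [map_sub, h₁.2, h₂.2]

theorem IsImage.add (h₁ : IsImage φ f₁ g₁) (h₂ : IsImage φ f₂ g₂) :
    IsImage φ (f₁ + f₂) (g₁ + g₂) := by
  refine ⟨fun α x => ?_, fun α x => ?_⟩
  · change (g₁.1 α).1 x + (g₂.1 α).1 x = φ ((f₁.1 α).1 x + (f₂.1 α).1 x)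
    rw [map_add, h₁.1, h₂.1]
  · change (g₁.2 α).1 x + (g₂.2 α).1 x = φ ((f₁.2 α).1 x + (f₂.2 α).1 x)
    rw [map_add, h₁.2, h₂.2]

theorem IsImage.refine (h : IsImage φ f g) (ρ : Cover.Refinement c c') :
    IsImage φ (F.relRefine ρ p f) (G.relRefine ρ p g) :=
  ⟨fun α x => h.1 (ρ.a ∘ α) ⟨x.1, mapsTo_inter (f := id) ρ.le_a α x.1 x.2⟩,
    fun α x => h.2 (ρ.b ∘ α) ⟨x.1, mapsTo_inter (f := id) ρ.V_le α x.1 x.2⟩⟩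

theorem IsImage.unique (h₁ : IsImage φ f g₁) (h₂ : IsImage φ f g₂) : g₁ = g₂ :=
  Prod.ext (funext fun α => Subtype.ext (funext fun x => (h₁.1 α x).trans (h₂.1 α x).symm))
    (funext fun α => Subtype.ext (funext fun x => (h₁.2 α x).trans (h₂.2 α x).symm))

theorem IsImage.injective (hφ : Function.Injective φ) (h₁ : IsImage φ f₁ g)
    (h₂ : IsImage φ f₂ g) : f₁ = f₂ :=
  Prod.ext (funext fun α => Subtype.ext (funext fun x => hφ ((h₁.1 α x).symm.trans (h₂.1 α x))))
    (funext fun α => Subtype.ext (funext fun x => hφ ((h₁.2 α x).symm.trans (h₂.2 α x))))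

theorem IsImage.zero : IsImage φ (0 : F.RelCochain c p) (0 : G.RelCochain c p) :=
  ⟨fun _ _ => (map_zero φ).symm, fun _ _ => (map_zero φ).symm⟩

end Comp

/-- The relative cochain `w` is `exp (2 π √-1 f)`. -/
abbrev IsExp (f : (realCoeff Φ).RelCochain c p) (w : (circleCoeff Φ).RelCochain c p) : Prop :=
  IsImage expHom f w

/-- The real relative cochain `f` is the integer relative cochain `z`. -/
abbrev IsCast (z : (intCoeff Φ).RelCochain c p) (f : (realCoeff Φ).RelCochain c p) : Prop :=
  IsImage (Int.castAddHom ℝ) z f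

theorem isExp_expCochain (f : (realCoeff Φ).RelCochain c p) : IsExp f (expCochain f) :=
  ⟨fun _ _ => rfl, fun _ _ => rfl⟩

theorem isCast_realCochain (z : (intCoeff Φ).RelCochain c p) : IsCast z (realCochain z) :=
  ⟨fun _ _ => rfl, fun _ _ => rfl⟩

theorem IsCast.isExp {z : (intCoeff Φ).RelCochain c p} {f : (realCoeff Φ).RelCochain c p}
    (h : IsCast z f) : IsExp f 0 :=
  ⟨fun α x => (expHom_eq_zero.2 ⟨_, h.1 α x⟩).symm, fun α x => (expHom_eq_zero.2 ⟨_, h.2 α x⟩).symm⟩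

/-- A relative cochain `f` with `exp (2 π √-1 f) = 1` is integral: continuous functions with values
in the integers are locally constant. -/
theorem exists_isCast {f : (realCoeff Φ).RelCochain c p} (h : IsExp f 0) :
    ∃ z : (intCoeff Φ).RelCochain c p, IsCast z f := by
  have key : ∀ {X : Type u} [TopologicalSpace X] (f : X → ℝ), Continuous f →
      (∀ x, expHom (f x) = 0) → ∃ n : X → ℤ, IsLocallyConstant n ∧ ∀ x, f x = n x := by
    intro X _ f hf h
    choose n hn using fun x => expHom_eq_zero.1 (h x)
    refine ⟨n, IsLocallyConstant.iff_continuous n |>.2 ?_, hn⟩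
    refine Int.isClosedEmbedding_coe_real.isInducing.continuous_iff.2 ?_
    exact hf.congr hn
  choose z hz hfz using fun α => key (f.1 α).1 (f.1 α).2.continuous fun x => (h.1 α x).symm
  choose z' hz' hfz' using fun α => key (f.2 α).1 (f.2 α).2.continuous fun x => (h.2 α x).symm
  exact ⟨(fun α => ⟨z α, hz α⟩, fun α => ⟨z' α, hz' α⟩), hfz, hfz'⟩

/-- The cocycles `w` and `z` are of the form `w = exp (2 π √-1 f)` and `z = df`: the connecting
homomorphism maps the class of `w` to that of `z`. -/
def IsConnecting (w : (circleCoeff Φ).Cocycle c p) (z : (intCoeff Φ).Cocycle c (p + 1)) : Prop :=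
  ∃ f : (realCoeff Φ).RelCochain c (p + 1),
    IsExp f w.1 ∧ IsCast z.1 ((realCoeff Φ).relD c (p + 1) f)

theorem IsConnecting.refine {w : (circleCoeff Φ).Cocycle c p} {z : (intCoeff Φ).Cocycle c (p + 1)}
    (h : IsConnecting w z) (ρ : Cover.Refinement c c') :
    IsConnecting ((circleCoeff Φ).cocycleRefine ρ p w)
      ((intCoeff Φ).cocycleRefine ρ (p + 1) z) := by
  obtain ⟨f, h1, h2⟩ := h
  refine ⟨(realCoeff Φ).relRefine ρ (p + 1) f, h1.refine ρ, ?_⟩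
  rw [← Coeff.relRefine_relD]
  exact h2.refine ρ

theorem IsConnecting.add {w w' : (circleCoeff Φ).Cocycle c p}
    {z z' : (intCoeff Φ).Cocycle c (p + 1)} (h : IsConnecting w z) (h' : IsConnecting w' z') :
    IsConnecting (w + w') (z + z') := by
  obtain ⟨f, h1, h2⟩ := h
  obtain ⟨f', h1', h2'⟩ := h'
  refine ⟨f + f', h1.add h1', ?_⟩
  rw [map_add]
  exact h2.add h2'

theorem IsConnecting.sub {w w' : (circleCoeff Φ).Cocycle c p}
    {z z' : (intCoeff Φ).Cocycle c (p + 1)} (h : IsConnecting w z) (h' : IsConnecting w' z') :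
    IsConnecting (w - w') (z - z') := by
  obtain ⟨f, h1, h2⟩ := h
  obtain ⟨f', h1', h2'⟩ := h'
  refine ⟨f - f', h1.sub h1', ?_⟩
  rw [map_sub]
  exact h2.sub h2'

/-- If `w = exp (2 π √-1 f)` is the coboundary of `exp (2 π √-1 g)`, then `f - dg` has integer
values, and `df` is the coboundary of an integer cochain. -/
theorem IsConnecting.exists_relD_int {w : (circleCoeff Φ).Cocycle c p}
    {z : (intCoeff Φ).Cocycle c (p + 1)} (h : IsConnecting w z)
    {g : (realCoeff Φ).RelCochain c p} {u : (circleCoeff Φ).RelCochain c p} (hu : IsExp g u)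
    (huw : (circleCoeff Φ).relD c p u = w.1) :
    ∃ n, (intCoeff Φ).relD c (p + 1) n = z.1 := by
  obtain ⟨f, h1, h2⟩ := h
  have h3 := h1.sub hu.relD
  rw [huw, sub_self] at h3
  obtain ⟨n, hn⟩ := exists_isCast h3
  refine ⟨n, IsImage.injective Int.cast_injective hn.relD ?_⟩
  rwa [map_sub, Coeff.relD_relD, sub_zero]

/-- A cocycle with logarithm has a connecting integer cocycle. -/
theorem exists_isConnecting_of_isExp {w : (circleCoeff Φ).Cocycle c p}
    {f : (realCoeff Φ).RelCochain c (p + 1)} (hf : IsExp f w.1) :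
    ∃ z : (intCoeff Φ).Cocycle c (p + 1), IsConnecting w z := by
  have hw : (circleCoeff Φ).relD c (p + 1) w.1 = 0 := w.2
  obtain ⟨z, hz⟩ := exists_isCast (hw ▸ hf.relD)
  refine ⟨⟨z, ?_⟩, f, hf, hz⟩
  refine IsImage.injective Int.cast_injective hz.relD ?_
  rw [Coeff.relD_relD]
  exact .zero

section FiniteDimensional

variable [FiniteDimensional ℝ E] [FiniteDimensional ℝ E'] [T2Space M] [SigmaCompactSpace M]
  [T2Space N] [SigmaCompactSpace N]

variable (Φ) in
/-- On a suitable refinement of a cover, given by neighbourhoods of points, all `U(1)`-valued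
relative cochains of the cover have logarithms. -/
theorem exists_shrinking_isExp (c : Cover Φ) :
    ∃ S : c.Shrinking, ∀ (p : ℕ) (w : (circleCoeff Φ).RelCochain c p),
      ∃ f, IsExp f ((circleCoeff Φ).relRefine (S.ref Φ.contMDiff.continuous) p w) := by
  obtain ⟨W, hW, hlog⟩ := exists_log_shrinking I' c.V
  obtain ⟨W', hW', hlog'⟩ := exists_log_shrinking I c.U
  refine ⟨⟨W, W', hW, hW'⟩, fun p w => ?_⟩
  let S : c.Shrinking := ⟨W, W', hW, hW'⟩
  choose f hf hwf using fun α : Fin (p + 2) → c.J × N =>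
    hlog (p + 1) α (fun x => ((w.2 (Prod.fst ∘ α)).1 x).toMul) (w.2 (Prod.fst ∘ α)).2
  let q (α : Fin (p + 1) → (S.cover Φ.contMDiff.continuous).I) (k : Fin (p + 1)) : c.I × M :=
    (⟨(α k).1.1, (α k).2.1⟩, (α k).2.2)
  have hq : ∀ α, inter (S.cover Φ.contMDiff.continuous).U α ≤
      inter (fun a : c.I × M => c.U a.1 ⊓ W' a.1 a.2) (q α) := fun α x hx =>
    mem_inter.2 fun k => ⟨(mem_inter.1 hx k).1.1, (mem_inter.1 hx k).2⟩
  choose g hg hwg using fun α : Fin (p + 1) → (S.cover Φ.contMDiff.continuous).I =>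
    hlog' p (q α) (fun x => ((w.1 (Prod.fst ∘ q α)).1 x).toMul) (w.1 (Prod.fst ∘ q α)).2
  exact ⟨(fun α => ⟨fun x => g α ⟨x.1, hq α x.2⟩, (hg α).comp (contMDiff_inclusion (hq α))⟩,
    fun α => ⟨f α, hf α⟩), fun α x => hwg α ⟨x.1, hq α x.2⟩, fun α x => hwf α x⟩

variable [IsManifold I ∞ M] [IsManifold I' ∞ N]

/-- Every integer cocycle is of the form `df`, as the real cohomology vanishes. -/
theorem exists_isConnecting (z : (intCoeff Φ).Cocycle c (p + 1)) :
    ∃ w : (circleCoeff Φ).Cocycle c p, IsConnecting w z := by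
  have hz : (intCoeff Φ).relD c (p + 2) z.1 = 0 := z.2
  have h := isCast_realCochain z.1
  obtain ⟨f, hf⟩ := exists_relD_eq (realCochain z.1)
    (IsImage.unique (h.relD) (by rw [hz]; exact .zero))
  refine ⟨⟨expCochain f, ?_⟩, f, isExp_expCochain f, hf ▸ h⟩
  exact IsImage.unique (isExp_expCochain f).relD (hf ▸ h.isExp)

/-- If `df` is the coboundary of an integer cochain `n`, then `f - n` is a real coboundary, hence
`exp (2 π √-1 f)` is a coboundary. -/
theorem IsConnecting.cls_eq_zero {w : (circleCoeff Φ).Cocycle c p}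
    {z : (intCoeff Φ).Cocycle c (p + 1)} (h : IsConnecting w z)
    {n : (intCoeff Φ).RelCochain c (p + 1)} (hn : (intCoeff Φ).relD c (p + 1) n = z.1) :
    (circleCoeff Φ).cls c p w = 0 := by
  obtain ⟨f, h1, h2⟩ := h
  have h3 := (isCast_realCochain n).relD
  rw [hn] at h3
  obtain ⟨g, hg⟩ := exists_relD_eq (f - realCochain n) (by
    rw [map_sub, IsImage.unique h2 h3, sub_self])
  refine Coeff.cls_eq_zero (u := expCochain g) (IsImage.unique (isExp_expCochain g).relD ?_)
  rw [hg]
  have := h1.sub (isCast_realCochain n).isExp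
  rwa [sub_zero] at this

theorem IsConnecting.cls_eq {w w' : (circleCoeff Φ).Cocycle c p}
    {z : (intCoeff Φ).Cocycle c (p + 1)} (h : IsConnecting w z) (h' : IsConnecting w' z) :
    (circleCoeff Φ).cls c p w = (circleCoeff Φ).cls c p w' := by
  rw [← sub_eq_zero, ← map_sub]
  refine (h.sub h').cls_eq_zero (n := 0) ?_
  rw [map_zero, sub_self]
  rfl

/-- The class of `exp (2 π √-1 f)` is additive in `df`. -/
theorem IsConnecting.cls_add {w w' v : (circleCoeff Φ).Cocycle c p}
    {z z' : (intCoeff Φ).Cocycle c (p + 1)} (h : IsConnecting w z) (h' : IsConnecting w' z')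
    (h'' : IsConnecting v (z + z')) :
    (circleCoeff Φ).cls c p v = (circleCoeff Φ).cls c p w + (circleCoeff Φ).cls c p w' :=
  (h''.cls_eq (h.add h')).trans (map_add ((circleCoeff Φ).cls c p) w w')

/-- A cocycle `exp (2 π √-1 f)` with `df = z`. -/
def expPrimitive (z : (intCoeff Φ).Cocycle c 1) : (circleCoeff Φ).Cocycle c 0 :=
  (exists_isConnecting z).choose

theorem isConnecting_expPrimitive (z : (intCoeff Φ).Cocycle c 1) :
    IsConnecting (expPrimitive z) z :=
  (exists_isConnecting z).choose_spec

variable (c) in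
/-- The map `[df] ↦ [exp (2 π √-1 f)]` on the integer cocycles of a cover. -/
def connectingInvOn : (intCoeff Φ).Cocycle c 1 →+ H2U1 Φ :=
  AddMonoidHom.mk' (fun z => (circleCoeff Φ).cls c 0 (expPrimitive z)) fun z z' =>
    (isConnecting_expPrimitive z).cls_add (isConnecting_expPrimitive z')
      (isConnecting_expPrimitive (z + z'))

theorem connectingInvOn_eq {w : (circleCoeff Φ).Cocycle c 0} {z : (intCoeff Φ).Cocycle c 1}
    (h : IsConnecting w z) : connectingInvOn c z = (circleCoeff Φ).cls c 0 w :=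
  (isConnecting_expPrimitive z).cls_eq h

theorem connectingInvOn_eq_zero (n : (intCoeff Φ).RelCochain c 1) (z : (intCoeff Φ).Cocycle c 1)
    (hn : (intCoeff Φ).relD c 1 n = z.1) : connectingInvOn c z = 0 := by
  obtain ⟨w, hw⟩ := exists_isConnecting z
  rw [connectingInvOn_eq hw]
  exact hw.cls_eq_zero hn

theorem connectingInvOn_refine (ρ : Cover.Refinement c c') (z : (intCoeff Φ).Cocycle c 1) :
    connectingInvOn c' ((intCoeff Φ).cocycleRefine ρ 1 z) = connectingInvOn c z := by
  obtain ⟨w, hw⟩ := exists_isConnecting z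
  rw [connectingInvOn_eq hw, connectingInvOn_eq (hw.refine ρ), Coeff.cls_refine]

variable (Φ) in
/-- The inverse of the connecting homomorphism of the exponential sequence: it maps the class of
`df` to the class of `exp (2 π √-1 f)`. -/
def connectingInv : H3Z Φ →+ H2U1 Φ :=
  Coeff.liftH (fun c => connectingInvOn c) (fun _ => connectingInvOn_eq_zero)
    fun _ _ ρ => connectingInvOn_refine ρ

theorem connectingInv_cls {w : (circleCoeff Φ).Cocycle c 0} {z : (intCoeff Φ).Cocycle c 1}
    (h : IsConnecting w z) :
    connectingInv Φ ((intCoeff Φ).cls c 1 z) = (circleCoeff Φ).cls c 0 w :=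
  (Coeff.liftH_cls _ _ _ c z).trans (connectingInvOn_eq h)

/-- If `exp (2 π √-1 f)` is the coboundary of `u` on some refinement, then `u` has a logarithm on a
further one, and `df` is a coboundary there. -/
theorem connectingInv_injective : Function.Injective (connectingInv Φ) := by
  refine (injective_iff_map_eq_zero _).2 fun x hx => ?_
  obtain ⟨c, z, rfl⟩ := Coeff.exists_cls x
  obtain ⟨w, hw⟩ := exists_isConnecting z
  rw [connectingInv_cls hw] at hx
  obtain ⟨c', ρ, u, hu⟩ := Coeff.exists_refine_eq_relD hx
  obtain ⟨S, hS⟩ := exists_shrinking_isExp Φ c'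
  obtain ⟨g, hg⟩ := hS 0 u
  let τ := S.ref Φ.contMDiff.continuous
  obtain ⟨n, hn⟩ := ((hw.refine ρ).refine τ).exists_relD_int hg (by
    rw [← Coeff.relRefine_relD, hu]
    rfl)
  rw [← Coeff.cls_refine ρ, ← Coeff.cls_refine τ]
  exact Coeff.cls_eq_zero hn

/-- Every cocycle has a logarithm on some refinement. -/
theorem connectingInv_surjective : Function.Surjective (connectingInv Φ) := by
  intro x
  obtain ⟨c, w, rfl⟩ := Coeff.exists_cls x
  obtain ⟨S, hS⟩ := exists_shrinking_isExp Φ c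
  obtain ⟨f, hf⟩ := hS 1 w.1
  obtain ⟨z, hz⟩ := exists_isConnecting_of_isExp
    (w := (circleCoeff Φ).cocycleRefine (S.ref Φ.contMDiff.continuous) 0 w) hf
  exact ⟨_, (connectingInv_cls hz).trans (Coeff.cls_refine _ _ _)⟩

variable (Φ) in
/-- The connecting isomorphism `H²(Φ, U(1)) ≅ H³(Φ, ℤ)` of the exponential sequence. -/
def connectingEquiv : H2U1 Φ ≃+ H3Z Φ :=
  (AddEquiv.ofBijective (connectingInv Φ) ⟨connectingInv_injective, connectingInv_surjective⟩).symm

theorem connectingEquiv_cls {w : (circleCoeff Φ).Cocycle c 0} {z : (intCoeff Φ).Cocycle c 1}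
    (h : IsConnecting w z) :
    connectingEquiv Φ ((circleCoeff Φ).cls c 0 w) = (intCoeff Φ).cls c 1 z := by
  rw [connectingEquiv, AddEquiv.symm_apply_eq]
  exact (connectingInv_cls h).symm

end FiniteDimensional

end Exponential

/-! ### Unit vectors and unitary sections -/

namespace HermLine

variable {A B : HermLine}

theorem eq_inner_smul (u : A.Unit) (w : A.carrier) : inner ℂ u.1 w • u.1 = w := by
  have hu : u.1 ≠ 0 := fun h => by simpa [h] using u.2
  obtain ⟨z, rfl⟩ := (finrank_eq_one_iff_of_nonzero' u.1 hu).1 A.finrank_eq_one w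
  rw [inner_smul_right, inner_self_eq_norm_sq_to_K, u.2]
  simp

/-- The isometry of Hermitian lines which maps the unit vector `u` to the unit vector `v`. -/
def isometryOfUnits (u : A.Unit) (v : B.Unit) : A.carrier ≃ₗᵢ[ℂ] B.carrier where
  toFun w := inner ℂ u.1 w • v.1
  invFun w := inner ℂ v.1 w • u.1
  map_add' w w' := by rw [inner_add_right, add_smul]
  map_smul' z w := by rw [inner_smul_right, mul_smul, RingHom.id_apply]
  left_inv w := by
    change inner ℂ v.1 (inner ℂ u.1 w • v.1) • u.1 = w
    rw [inner_smul_right, inner_self_eq_norm_sq_to_K, v.2]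
    simpa using eq_inner_smul u w
  right_inv w := by
    change inner ℂ u.1 (inner ℂ v.1 w • u.1) • v.1 = w
    rw [inner_smul_right, inner_self_eq_norm_sq_to_K, u.2]
    simpa using eq_inner_smul v w
  norm_map' w := by
    change ‖inner ℂ u.1 w • v.1‖ = ‖w‖
    rw [norm_smul, v.2, mul_one]
    conv_rhs => rw [← eq_inner_smul u w]
    rw [norm_smul, u.2, mul_one]

theorem map_isometryOfUnits (u : A.Unit) (v : B.Unit) :
    Unit.map (isometryOfUnits u v) u = v := by
  refine Subtype.ext ?_
  change inner ℂ u.1 u.1 • v.1 = v.1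
  rw [inner_self_eq_norm_sq_to_K, u.2]
  simp

@[simp] theorem ratio_map (f : A.carrier ≃ₗᵢ[ℂ] B.carrier) (u v : A.Unit) :
    ratio (u.map f) (v.map f) = ratio u v :=
  Circle.ext (f.inner_map_map v.1 u.1)

/-- The unit vector `v` with `v ⊗ t = s`. -/
def divRight (s : (A.tensor B).Unit) (t : B.Unit) : A.Unit :=
  ratio s (tmul A.some t) • A.some

theorem ratio_divRight (s : (A.tensor B).Unit) (t t' : B.Unit) (a : A.Unit) :
    ratio (divRight s t) a = ratio s (tmul a t') * (ratio t t')⁻¹ := by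
  have h : ratio (A.some) a * ratio t t' = ratio (tmul A.some t) (tmul a t') :=
    (ratio_tmul _ _ _ _).symm
  rw [divRight, ratio_smul_left, ← ratio_mul s (tmul A.some t) (tmul a t'), ← h, mul_assoc,
    mul_inv_cancel_right]

/-- The unit vector `v` with `s ⊗ v = t`. -/
def divLeft (t : (A.tensor B).Unit) (s : A.Unit) : B.Unit :=
  ratio t (tmul s B.some) • B.some

theorem ratio_divLeft (t : (A.tensor B).Unit) (s s' : A.Unit) (b : B.Unit) :
    ratio (divLeft t s) b = ratio t (tmul s' b) * (ratio s s')⁻¹ := by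
  have h : ratio s s' * ratio (B.some) b = ratio (tmul s B.some) (tmul s' b) :=
    (ratio_tmul _ _ _ _).symm
  rw [divLeft, ratio_smul_left, ← ratio_mul t (tmul s B.some) (tmul s' b), ← h,
    mul_comm (ratio s s'), mul_assoc, mul_inv_cancel_right]

/-- The unit vector `v` with `v⁻¹ = s`. -/
def ofDual (s : A.dual.Unit) : A.Unit :=
  (ratio s (inv A.some))⁻¹ • A.some

theorem ratio_ofDual (s : A.dual.Unit) (a : A.Unit) :
    ratio (ofDual s) a = (ratio s (inv a))⁻¹ := by
  have h : (ratio A.some a)⁻¹ = ratio (inv A.some) (inv a) := (ratio_inv _ _).symm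
  rw [ofDual, ratio_smul_left, ← ratio_mul s (inv A.some) (inv a), ← h, mul_inv, inv_inv]

/-- The line `ℂ`. -/
def trivial : HermLine where
  carrier := ℂ
  finrank_eq_one := Module.finrank_self ℂ

/-- The unit vector `1` of the line `ℂ`. -/
def one : trivial.Unit := ⟨(1 : ℂ), by
  change ‖(1 : ℂ)‖ = 1
  exact norm_one⟩

end HermLine

section Sections

variable {E H : Type*} [NormedAddCommGroup E] [NormedSpace ℝ E] [TopologicalSpace H]
  {I : ModelWithCorners ℝ E H} {X : Type*} [TopologicalSpace X] [ChartedSpace H X]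
  {L K : HermLineBundle I X}

open HermLine

theorem UnitarySection.ext {s t : UnitarySection L} (h : ∀ x, s.val x = t.val x) :
    s = t := by
  cases s
  cases t
  congr
  exact funext h

theorem UnitarySection.contMDiffAt_frame (s : UnitarySection L) (a : X) :
    ContMDiffAt I (𝓡 1) ∞ (fun x => ratio (s.val x) (L.frame a x)) a :=
  (s.smooth a).contMDiffAt ((L.dom a).isOpen.mem_nhds (L.mem_dom a))

/-- The product of a unitary section and a smooth `U(1)`-valued function. -/
def UnitarySection.smul (f : X → Circle) (hf : ContMDiff I (𝓡 1) ∞ f) (s : UnitarySection L) :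
    UnitarySection L where
  val x := f x • s.val x
  smooth a := (hf.contMDiffOn.mul (s.smooth a)).congr fun _ _ => ratio_smul_left _ _ _

/-- The image of a unitary section under an isomorphism. -/
def UnitarySection.map (s : UnitarySection L) (f : HermLineBundle.Iso L K) : UnitarySection K :=
  .ofContMDiffAt (fun x => (s.val x).map (f.map x)) fun a => by
    have h := (s.contMDiffAt_frame a).mul ((f.smooth a a).contMDiffAt
      (((L.dom a ⊓ K.dom a).isOpen).mem_nhds ⟨L.mem_dom a, K.mem_dom a⟩))
    refine h.congr_of_eventuallyEq (.of_forall fun x => ?_)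
    change _ = ratio _ _ * ratio _ _
    rw [← ratio_map (f.map x), ratio_mul]

/-- The isomorphism of line bundles which maps the unitary section `s` to the unitary section
`t`. -/
def HermLineBundle.Iso.ofSections (s : UnitarySection L) (t : UnitarySection K) :
    HermLineBundle.Iso L K where
  map x := isometryOfUnits (s.val x) (t.val x)
  smooth a b := by
    have h := (((s.smooth a).inv).mono Set.inter_subset_left).mul
      ((t.smooth b).mono Set.inter_subset_right)
    refine h.congr fun x _ => ?_
    change _ = (ratio _ _)⁻¹ * ratio _ _
    rw [inv_ratio, ← ratio_map (isometryOfUnits (s.val x) (t.val x)), map_isometryOfUnits,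
      ratio_mul]

theorem HermLineBundle.Iso.ratio_ofSections (s : UnitarySection L) (t : UnitarySection K) (x : X)
    (u : (L.fibre x).Unit) :
    ratio (t.val x) (u.map ((Iso.ofSections s t).map x)) = ratio (s.val x) u := by
  rw [← ratio_map ((Iso.ofSections s t).map x) (s.val x) u]
  congr
  exact (map_isometryOfUnits _ _).symm

/-- The identity isomorphism. -/
def HermLineBundle.Iso.refl (L : HermLineBundle I X) : HermLineBundle.Iso L L where
  map _ := LinearIsometryEquiv.refl ℂ _
  smooth := L.smooth

variable (I X) in
/-- The trivial line bundle. -/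
def HermLineBundle.trivial : HermLineBundle I X where
  fibre _ := HermLine.trivial
  dom _ := ⊤
  mem_dom _ := _root_.trivial
  frame _ _ := HermLine.one
  smooth a b := by
    simp only [ratio_self]
    exact contMDiffOn_const

variable (I X) in
/-- The section `1` of the trivial line bundle. -/
def UnitarySection.one : UnitarySection (HermLineBundle.trivial I X) where
  val _ := HermLine.one
  smooth a := (HermLineBundle.trivial I X).smooth a a |>.mono fun _ h => ⟨h, h⟩

end Sections

/-! ### Relative gerbes with unitary sections -/

section Trivialization

variable {E H : Type*} [NormedAddCommGroup E] [NormedSpace ℝ E] [TopologicalSpace H]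
  {I : ModelWithCorners ℝ E H} {M : Type u} [TopologicalSpace M] [ChartedSpace H M]
  {E' H' : Type*} [NormedAddCommGroup E'] [NormedSpace ℝ E'] [TopologicalSpace H']
  {I' : ModelWithCorners ℝ E' H'} {N : Type u} [TopologicalSpace N] [ChartedSpace H' N]
  {Φ : C^∞⟮I, M; I', N⟯} {c c' c'' : Cover Φ}

open HermLine

theorem FunctionPresheaf.d_apply_zero {X : Type*} [TopologicalSpace X] {A : Type*} [AddCommGroup A]
    {F : FunctionPresheaf X A} {ι : Type*} {U : ι → Opens X} (f : F.Cochain U 0) (α : Fin 2 → ι)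
    (x : inter U α) :
    (F.d U 0 f α).1 x = (f (α ∘ Fin.succAbove 0)).1 ⟨x.1, inter_le_face U α 0 x.2⟩ -
      (f (α ∘ Fin.succAbove 1)).1 ⟨x.1, inter_le_face U α 1 x.2⟩ := by
  rw [F.d_apply, Fin.sum_univ_two]
  simp [sub_eq_add_neg]

theorem FunctionPresheaf.d_apply_one {X : Type*} [TopologicalSpace X] {A : Type*} [AddCommGroup A]
    {F : FunctionPresheaf X A} {ι : Type*} {U : ι → Opens X} (f : F.Cochain U 1) (α : Fin 3 → ι)
    (x : inter U α) :
    (F.d U 1 f α).1 x = (f (α ∘ Fin.succAbove 0)).1 ⟨x.1, inter_le_face U α 0 x.2⟩ -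
      (f (α ∘ Fin.succAbove 1)).1 ⟨x.1, inter_le_face U α 1 x.2⟩ +
      (f (α ∘ Fin.succAbove 2)).1 ⟨x.1, inter_le_face U α 2 x.2⟩ := by
  rw [F.d_apply, Fin.sum_univ_three]
  simp [sub_eq_add_neg]

theorem FunctionPresheaf.d_apply_two {X : Type*} [TopologicalSpace X] {A : Type*} [AddCommGroup A]
    {F : FunctionPresheaf X A} {ι : Type*} {U : ι → Opens X} (f : F.Cochain U 2) (α : Fin 4 → ι)
    (x : inter U α) :
    (F.d U 2 f α).1 x = (f (α ∘ Fin.succAbove 0)).1 ⟨x.1, inter_le_face U α 0 x.2⟩ -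
      (f (α ∘ Fin.succAbove 1)).1 ⟨x.1, inter_le_face U α 1 x.2⟩ +
      (f (α ∘ Fin.succAbove 2)).1 ⟨x.1, inter_le_face U α 2 x.2⟩ -
      (f (α ∘ Fin.succAbove 3)).1 ⟨x.1, inter_le_face U α 3 x.2⟩ := by
  rw [F.d_apply, Fin.sum_univ_four]
  simp [sub_eq_add_neg, pow_succ]

/-- The coordinate of a family of unitary sections of `δ L`, at a point where unit vectors `σ` of
the lines `L_{j j'}` are given, with respect to `δ σ`, as an element of the additive group
`U(1)`. -/
def SectionFamily.coord2 {X : Type*} [TopologicalSpace X] [ChartedSpace H X] {ι : Type*}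
    {U : ι → Opens X} {L : BundleFamily I U 2} (θ : SectionFamily L.delta2) {x : X}
    (σ : VectorFamily L x) (α : Fin 3 → ι) (h : x ∈ inter U α) : Additive Circle :=
  .ofMul (ratio (θ.at x α h) (σ.delta2 α h))

/-- The coordinate of a family of unitary sections of `(δ E)⁻¹ ⊗ L` with respect to
`(δ lam)⁻¹ ⊗ σ`. -/
def SectionFamily.coordQuasi {X : Type*} [TopologicalSpace X] [ChartedSpace H X] {ι : Type*}
    {U : ι → Opens X} {K : BundleFamily I U 1} {L : BundleFamily I U 2}
    (ψ : SectionFamily (K.quasi L)) {x : X}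
    (lam : VectorFamily K x) (σ : VectorFamily L x) (α : Fin 2 → ι) (h : x ∈ inter U α) :
    Additive Circle :=
  .ofMul (ratio (ψ.at x α h) (lam.quasi σ α h))

/-- The quotient of two unit vectors, as an element of the additive group `U(1)`. -/
def HermLine.diff {A : HermLine} (u v : A.Unit) : Additive Circle := .ofMul (ratio u v)

section Coord

variable {X : Type*} [TopologicalSpace X] [ChartedSpace H X] {ι : Type*}
  {U : ι → Opens X} {K : BundleFamily I U 1} {L : BundleFamily I U 2} {x : X}

/-- The change of the coordinate of `θ` from `σ` to `τ` is the Čech differential of `σ / τ`. -/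
theorem SectionFamily.coord2_eq (θ : SectionFamily L.delta2) (σ τ : VectorFamily L x)
    (α : Fin 3 → ι) (h : x ∈ inter U α) :
    θ.coord2 τ α h = θ.coord2 σ α h + (diff (σ.face α 0 h) (τ.face α 0 h) -
      diff (σ.face α 1 h) (τ.face α 1 h) + diff (σ.face α 2 h) (τ.face α 2 h)) :=
  congrArg Additive.ofMul ((ratio_mul (θ.at x α h) (σ.delta2 α h) (τ.delta2 α h)).symm.trans
    (congrArg _ ((VectorFamily.ratio_delta2 σ τ α h).trans
      (by rw [← div_eq_mul_inv]; rfl))))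

/-- The change of the coordinate of `ψ` under a change of `lam` and `σ`: `σ / τ` minus the Čech
differential of `lam / lam'`. -/
theorem SectionFamily.coordQuasi_eq (ψ : SectionFamily (K.quasi L)) (lam lam' : VectorFamily K x)
    (σ τ : VectorFamily L x) (α : Fin 2 → ι) (h : x ∈ inter U α) :
    ψ.coordQuasi lam' τ α h = ψ.coordQuasi lam σ α h + (diff (σ α h) (τ α h) -
      (diff (lam.face α 0 h) (lam'.face α 0 h) - diff (lam.face α 1 h) (lam'.face α 1 h))) :=
  congrArg Additive.ofMul ((ratio_mul (ψ.at x α h) (lam.quasi σ α h) (lam'.quasi τ α h)).symm.trans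
    (congrArg _ ((VectorFamily.ratio_quasi lam lam' σ τ α h).trans
      (by rw [mul_comm, ← div_eq_mul_inv, ← div_eq_mul_inv]; rfl))))

/-- The equation `δ θ = 1` in coordinates. -/
theorem Gerbe.coord2_cocycle (G : Gerbe I U) (σ : VectorFamily G.L x) (α : Fin 4 → ι)
    (h : x ∈ inter U α) :
    G.θ.coord2 σ (α ∘ Fin.succAbove 0) (inter_le_face U α 0 h) -
      G.θ.coord2 σ (α ∘ Fin.succAbove 1) (inter_le_face U α 1 h) +
      G.θ.coord2 σ (α ∘ Fin.succAbove 2) (inter_le_face U α 2 h) -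
      G.θ.coord2 σ (α ∘ Fin.succAbove 3) (inter_le_face U α 3 h) = 0 := by
  have := congrArg Additive.ofMul ((VectorFamily.ratio_delta3 (G.θ.at x) σ.delta2 α h).symm.trans
    (ratio_eq_one.2 (G.delta_θ x σ α h)))
  simp only [← div_eq_mul_inv, ofMul_mul, ofMul_div, ofMul_one] at this
  exact this

/-- The equation `δ ψ = θ` in coordinates. -/
theorem QuasiLineBundle.coordQuasi_cocycle {G : Gerbe I U} (Q : QuasiLineBundle G)
    (lam : VectorFamily Q.E x) (σ : VectorFamily G.L x) (α : Fin 3 → ι) (h : x ∈ inter U α) :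
    Q.ψ.coordQuasi lam σ (α ∘ Fin.succAbove 0) (inter_le_face U α 0 h) -
      Q.ψ.coordQuasi lam σ (α ∘ Fin.succAbove 1) (inter_le_face U α 1 h) +
      Q.ψ.coordQuasi lam σ (α ∘ Fin.succAbove 2) (inter_le_face U α 2 h) =
    G.θ.coord2 σ α h := by
  have := congrArg Additive.ofMul
    ((VectorFamily.ratio_delta2 (Q.ψ.at x) (lam.quasi σ) α h).symm.trans (Q.delta_ψ x lam σ α h))
  simp only [← div_eq_mul_inv, ofMul_mul, ofMul_div] at this
  exact this

end Coord

namespace RelGerbeOn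

/-- The sections `ψ` of a relative gerbe, with the line bundles `Φ^* L` of the pulled back gerbe
written out in their type. -/
def ψ (D : RelGerbeOn Φ c) : SectionFamily (D.Q.E.quasi (D.G.L.pullback Φ c.mapsTo)) := D.Q.ψ

/-- The equation `δ ψ = Φ^* θ` in coordinates. -/
theorem coordQuasi_cocycle (D : RelGerbeOn Φ c) {x : M}
    (lam : VectorFamily D.Q.E x) (σ : VectorFamily D.G.L (Φ x)) (α : Fin 3 → c.I)
    (h : x ∈ inter c.U α) :
    D.ψ.coordQuasi lam (σ.pullback c.mapsTo) (α ∘ Fin.succAbove 0) (inter_le_face c.U α 0 h) -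
      D.ψ.coordQuasi lam (σ.pullback c.mapsTo) (α ∘ Fin.succAbove 1) (inter_le_face c.U α 1 h) +
      D.ψ.coordQuasi lam (σ.pullback c.mapsTo) (α ∘ Fin.succAbove 2) (inter_le_face c.U α 2 h) =
    D.G.θ.coord2 σ (c.r ∘ α) (mapsTo_inter c.mapsTo α x h) :=
  D.Q.coordQuasi_cocycle lam (σ.pullback c.mapsTo) α h

theorem Isomorphic.refl (D : RelGerbeOn Φ c) : D.Isomorphic D :=
  ⟨fun _ => .refl _, fun _ => .refl _, fun _ _ _ _ => rfl, fun _ _ _ _ _ => rfl⟩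

section Refine

-- Unification must not unfold the lines: the line bundles and sections of the two sides agree
-- definitionally as they stand.
attribute [local irreducible] HermLine.ratio HermLine.tensor HermLine.dual
  HermLine.tmul HermLine.inv HermLine.mul2 HermLine.mulq HermLine.inv2 HermLine.invq

theorem refine_refine (D : RelGerbeOn Φ c) (ρ : Cover.Refinement c c')
    (τ : Cover.Refinement c' c'') :
    ((D.refine ρ).refine τ).Isomorphic (D.refine (ρ.comp τ)) :=
  ⟨fun α => ⟨fun _ => LinearIsometryEquiv.refl ℂ _, (((D.refine ρ).refine τ).G.L α).smooth⟩,
    fun α => ⟨fun _ => LinearIsometryEquiv.refl ℂ _, (((D.refine ρ).refine τ).Q.E α).smooth⟩,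
    fun _ _ _ _ => rfl, fun _ _ _ _ _ => rfl⟩

theorem dual_refine (D : RelGerbeOn Φ c) (ρ : Cover.Refinement c c') :
    ((D.refine ρ).dual).Isomorphic (D.dual.refine ρ) :=
  ⟨fun α => ⟨fun _ => LinearIsometryEquiv.refl ℂ _, ((D.refine ρ).dual.G.L α).smooth⟩,
    fun α => ⟨fun _ => LinearIsometryEquiv.refl ℂ _, ((D.refine ρ).dual.Q.E α).smooth⟩,
    fun _ _ _ _ => rfl, fun _ _ _ _ _ => rfl⟩

/-- The restriction of the product of `g` and `k` to the product of refinements of their covers. -/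
theorem tensor_refine_prodMap (g k : RelativeGerbe Φ) (ρ : Cover.Refinement g.cover c)
    (ρ' : Cover.Refinement k.cover c') :
    (((g.data.refine ρ).refine (c.prodFst c')).tensor
      ((k.data.refine ρ').refine (c.prodSnd c'))).Isomorphic
        ((g.tensor k).data.refine (ρ.prodMap ρ')) :=
  let D := ((g.data.refine ρ).refine (c.prodFst c')).tensor
    ((k.data.refine ρ').refine (c.prodSnd c'))
  ⟨fun α => ⟨fun _ => LinearIsometryEquiv.refl ℂ _, (D.G.L α).smooth⟩,
    fun α => ⟨fun _ => LinearIsometryEquiv.refl ℂ _, (D.Q.E α).smooth⟩,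
    fun _ _ _ _ => rfl, fun _ _ _ _ _ => rfl⟩

end Refine

/-- Unitary sections `σ_{j j'}` and `lam_i` of all the line bundles of a relative gerbe. -/
structure Trivialization (D : RelGerbeOn Φ c) where
  σ : SectionFamily D.G.L
  lam : SectionFamily D.Q.E

namespace Trivialization

variable {D K : RelGerbeOn Φ c}

/-- The relative cochain `(s, t)` of a trivialization: the inverses of the coordinates of `ψ` and
`θ`. -/
def cochain (T : D.Trivialization) : (circleCoeff Φ).RelCochain c 1 :=
  ((RelativeGerbe.mk c D).cochainM T.σ T.lam, (RelativeGerbe.mk c D).cochainN T.σ)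

theorem cochain_snd (T : D.Trivialization) (α : Fin 3 → c.J) (y : inter c.V α) :
    (T.cochain.2 α).1 y = -D.G.θ.coord2 (T.σ.at y.1) α y.2 :=
  congrArg Additive.ofMul (inv_ratio _ _).symm

theorem cochain_fst (T : D.Trivialization) (α : Fin 2 → c.I) (x : inter c.U α) :
    (T.cochain.1 α).1 x =
      -D.ψ.coordQuasi (T.lam.at x.1) ((T.σ.at (Φ x.1)).pullback c.mapsTo) α x.2 :=
  congrArg Additive.ofMul (inv_ratio (D.ψ.at x.1 α x.2) _).symm

/-- `(s, t)` is a relative cocycle. -/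
theorem relD_cochain (T : D.Trivialization) : (circleCoeff Φ).relD c 1 T.cochain = 0 := by
  refine Coeff.RelCochain.ext (fun α x => ?_) fun α y => ?_
  · have h := D.coordQuasi_cocycle (T.lam.at x.1) (T.σ.at (Φ x.1)) α x.2
    refine (Coeff.relD_fst_apply _ α x).trans ?_
    rw [FunctionPresheaf.d_apply_one, cochain_snd, cochain_fst, cochain_fst, cochain_fst, ← h]
    change _ = (0 : Additive Circle)
    abel
  · have h := D.G.coord2_cocycle (T.σ.at y.1) α y.2
    refine (FunctionPresheaf.d_apply_two T.cochain.2 α y).trans ?_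
    rw [cochain_snd, cochain_snd, cochain_snd, cochain_snd]
    refine Eq.trans ?_ ((congrArg Neg.neg h).trans neg_zero)
    abel

/-- The relative cocycle `(s, t)` of a trivialization. -/
def cocycle (T : D.Trivialization) : (circleCoeff Φ).Cocycle c 0 := ⟨T.cochain, T.relD_cochain⟩

/-- The change of a trivialization by a relative cochain `u` of degree one. -/
def smul (u : (circleCoeff Φ).RelCochain c 0) (T : D.Trivialization) : D.Trivialization where
  σ α := (T.σ α).smul (fun y => ((u.2 α).1 y).toMul) (u.2 α).2
  lam α := (T.lam α).smul (fun x => ((u.1 α).1 x).toMul) (u.1 α).2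

/-- A change of the unitary sections changes `(s, t)` by a coboundary. -/
theorem cochain_smul (u : (circleCoeff Φ).RelCochain c 0) (T : D.Trivialization) :
    (T.smul u).cochain = T.cochain + (circleCoeff Φ).relD c 0 u := by
  have hσ : ∀ (y : N) (α : Fin 2 → c.J) (h : y ∈ inter c.V α),
      diff ((T.smul u).σ.at y α h) (T.σ.at y α h) = (u.2 α).1 ⟨y, h⟩ :=
    fun y α h => congrArg Additive.ofMul (ratio_smul _ _)
  have hlam : ∀ (x : M) (α : Fin 1 → c.I) (h : x ∈ inter c.U α),
      diff ((T.smul u).lam.at x α h) (T.lam.at x α h) = (u.1 α).1 ⟨x, h⟩ :=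
    fun x α h => congrArg Additive.ofMul (ratio_smul _ _)
  refine Coeff.RelCochain.ext (fun α x => ?_) fun α y => ?_
  · have e : diff (((T.smul u).σ.at (Φ x.1)).pullback c.mapsTo α x.2)
        ((T.σ.at (Φ x.1)).pullback c.mapsTo α x.2) =
        (u.2 (c.r ∘ α)).1 ⟨Φ x.1, mapsTo_inter c.mapsTo α x.1 x.2⟩ := hσ _ _ _
    change _ = (T.cochain.1 α).1 x + _
    rw [Coeff.relD_fst_apply, FunctionPresheaf.d_apply_zero, cochain_fst, cochain_fst,
      D.ψ.coordQuasi_eq ((T.smul u).lam.at x.1) (T.lam.at x.1)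
        (((T.smul u).σ.at (Φ x.1)).pullback c.mapsTo) ((T.σ.at (Φ x.1)).pullback c.mapsTo) α x.2,
      e, ← hlam, ← hlam]
    abel
  · change _ = (T.cochain.2 α).1 y + ((circleCoeff Φ).onN.d c.V 1 u.2 α).1 y
    rw [FunctionPresheaf.d_apply_one, cochain_snd, cochain_snd,
      D.G.θ.coord2_eq ((T.smul u).σ.at y.1) (T.σ.at y.1) α y.2, ← hσ, ← hσ, ← hσ]
    abel

/-- Any two choices of unitary sections differ by `U(1)`-valued functions. -/
theorem exists_eq_smul (T T' : D.Trivialization) : ∃ u, T' = T.smul u := by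
  refine ⟨(fun α => ⟨fun x => Additive.ofMul (ratio ((T'.lam α).val x) ((T.lam α).val x)),
    (T'.lam α).contMDiff_ratio (T.lam α)⟩,
    fun α => ⟨fun x => Additive.ofMul (ratio ((T'.σ α).val x) ((T.σ α).val x)),
    (T'.σ α).contMDiff_ratio (T.σ α)⟩), ?_⟩
  cases T
  cases T'
  congr 1
  · exact funext fun α => UnitarySection.ext fun x => (ratio_smul_self _ _).symm
  · exact funext fun α => UnitarySection.ext fun x => (ratio_smul_self _ _).symm

/-- The class of `(s, t)` does not depend on the choice of the unitary sections. -/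
theorem cls_cocycle_eq (T T' : D.Trivialization) :
    (circleCoeff Φ).cls c 0 T.cocycle = (circleCoeff Φ).cls c 0 T'.cocycle := by
  obtain ⟨u, rfl⟩ := exists_eq_smul T' T
  refine Coeff.cls_eq_of_sub (u := u) ?_
  change _ = (T'.smul u).cochain - T'.cochain
  rw [cochain_smul, add_sub_cancel_left]

/-- The restriction of a trivialization to a refinement. -/
def refine (T : D.Trivialization) (ρ : Cover.Refinement c c') : (D.refine ρ).Trivialization where
  σ := T.σ.pullback ContMDiffMap.id ρ.V_le
  lam := T.lam.pullback ContMDiffMap.id ρ.le_a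

theorem cochain_refine (T : D.Trivialization) (ρ : Cover.Refinement c c') :
    (T.refine ρ).cochain = (circleCoeff Φ).relRefine ρ 1 T.cochain := rfl

theorem cocycle_refine (T : D.Trivialization) (ρ : Cover.Refinement c c') :
    (T.refine ρ).cocycle = (circleCoeff Φ).cocycleRefine ρ 0 T.cocycle :=
  Subtype.ext (T.cochain_refine ρ)

theorem cls_refine (T : D.Trivialization) (ρ : Cover.Refinement c c') :
    (circleCoeff Φ).cls c' 0 (T.refine ρ).cocycle = (circleCoeff Φ).cls c 0 T.cocycle := by
  rw [cocycle_refine, Coeff.cls_refine]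

/-- The product of trivializations. -/
def tensor (T : D.Trivialization) (T' : K.Trivialization) : (D.tensor K).Trivialization where
  σ α := (T.σ α).tensor (T'.σ α)
  lam α := (T.lam α).tensor (T'.lam α)

theorem cochain_tensor (T : D.Trivialization) (T' : K.Trivialization) :
    (T.tensor T').cochain = T.cochain + T'.cochain := by
  refine Coeff.RelCochain.ext (fun α x => ?_) fun α y => ?_
  · change _ = (T.cochain.1 α).1 x + (T'.cochain.1 α).1 x
    rw [cochain_fst, cochain_fst, cochain_fst, ← neg_add]
    refine congrArg Neg.neg (congrArg Additive.ofMul ?_)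
    exact ratio_mulq (D.ψ.at x.1 α x.2) (K.ψ.at x.1 α x.2) _ _ _ _ _ _
  · change _ = (T.cochain.2 α).1 y + (T'.cochain.2 α).1 y
    rw [cochain_snd, cochain_snd, cochain_snd, ← neg_add]
    refine congrArg Neg.neg (congrArg Additive.ofMul ?_)
    exact ratio_mul2 (D.G.θ.at y.1 α y.2) (K.G.θ.at y.1 α y.2) _ _ _ _ _ _

/-- The dual trivialization. -/
def dual (T : D.Trivialization) : D.dual.Trivialization where
  σ α := (T.σ α).dual
  lam α := (T.lam α).dual

theorem cochain_dual (T : D.Trivialization) : T.dual.cochain = -T.cochain := by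
  refine Coeff.RelCochain.ext (fun α x => ?_) fun α y => ?_
  · change _ = -(T.cochain.1 α).1 x
    rw [cochain_fst, cochain_fst]
    refine congrArg Neg.neg (congrArg Additive.ofMul ?_)
    exact ratio_invq (D.ψ.at x.1 α x.2) _ _ _
  · change _ = -(T.cochain.2 α).1 y
    rw [cochain_snd, cochain_snd]
    refine congrArg Neg.neg (congrArg Additive.ofMul ?_)
    exact ratio_inv2 (D.G.θ.at y.1 α y.2) _ _ _

/-- An isomorphism of relative gerbes maps trivializations to trivializations with the same
cocycle. -/
theorem exists_cocycle_eq (h : D.Isomorphic K) (T : D.Trivialization) :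
    ∃ T' : K.Trivialization, T'.cocycle = T.cocycle := by
  obtain ⟨f, e, hθ, hψ⟩ := h
  refine ⟨⟨fun α => (T.σ α).map (f α), fun α => (T.lam α).map (e α)⟩, Subtype.ext <|
    Coeff.RelCochain.ext (fun α x => ?_) fun α y => ?_⟩
  · refine (cochain_fst _ α x).trans (Eq.trans ?_ (cochain_fst T α x).symm)
    refine congrArg Neg.neg (congrArg Additive.ofMul ?_)
    exact (hψ x.1 (T.lam.at x.1) (T.σ.at (Φ x.1)) α x.2).symm
  · refine (cochain_snd _ α y).trans (Eq.trans ?_ (cochain_snd T α y).symm)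
    refine congrArg Neg.neg (congrArg Additive.ofMul ?_)
    exact (hθ y.1 (T.σ.at y.1) α y.2).symm

/-- Relative gerbes with unitary sections which have the same cocycle are isomorphic, by the maps
that take the sections of one to those of the other. -/
theorem isomorphic (T : D.Trivialization) (T' : K.Trivialization)
    (h : T.cochain = T'.cochain) : D.Isomorphic K := by
  refine ⟨fun α => .ofSections (T.σ α) (T'.σ α), fun α => .ofSections (T.lam α) (T'.lam α),
    fun y σ α hy => ?_, fun x lam σ α hx => ?_⟩
  · have h1 : (T.cochain.2 α).1 ⟨y, hy⟩ = (T'.cochain.2 α).1 ⟨y, hy⟩ := by rw [h]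
    rw [cochain_snd, cochain_snd, neg_inj] at h1
    have hσ : ∀ β (hβ : y ∈ inter c.V β), diff (T'.σ.at y β hβ) ((σ β hβ).map
        ((HermLineBundle.Iso.ofSections (T.σ β) (T'.σ β)).map ⟨y, hβ⟩)) =
          diff (T.σ.at y β hβ) (σ β hβ) :=
      fun β hβ => congrArg Additive.ofMul (HermLineBundle.Iso.ratio_ofSections _ _ _ _)
    refine Additive.ofMul.injective ((D.G.θ.coord2_eq (T.σ.at y) σ α hy).trans (Eq.trans ?_
      (K.G.θ.coord2_eq (T'.σ.at y) _ α hy).symm))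
    rw [h1]
    simp only [VectorFamily.face, hσ]
  · have h1 : (T.cochain.1 α).1 ⟨x, hx⟩ = (T'.cochain.1 α).1 ⟨x, hx⟩ := by rw [h]
    rw [cochain_fst, cochain_fst, neg_inj] at h1
    have hσ : ∀ β (hβ : Φ x ∈ inter c.V β), diff (T'.σ.at (Φ x) β hβ) ((σ β hβ).map
        ((HermLineBundle.Iso.ofSections (T.σ β) (T'.σ β)).map ⟨Φ x, hβ⟩)) =
          diff (T.σ.at (Φ x) β hβ) (σ β hβ) :=
      fun β hβ => congrArg Additive.ofMul (HermLineBundle.Iso.ratio_ofSections _ _ _ _)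
    have hlam : ∀ β (hβ : x ∈ inter c.U β), diff (T'.lam.at x β hβ) ((lam β hβ).map
        ((HermLineBundle.Iso.ofSections (T.lam β) (T'.lam β)).map ⟨x, hβ⟩)) =
          diff (T.lam.at x β hβ) (lam β hβ) :=
      fun β hβ => congrArg Additive.ofMul (HermLineBundle.Iso.ratio_ofSections _ _ _ _)
    refine Additive.ofMul.injective ((D.ψ.coordQuasi_eq (T.lam.at x) lam
      ((T.σ.at (Φ x)).pullback c.mapsTo) (σ.pullback c.mapsTo) α hx).trans (Eq.trans ?_
      (K.ψ.coordQuasi_eq (T'.lam.at x) _ ((T'.σ.at (Φ x)).pullback c.mapsTo) _ α hx).symm))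
    rw [h1]
    simp only [VectorFamily.face, hlam]
    exact congrArg (_ + ·) (congrArg (fun z : Additive Circle => z - _)
      (hσ (c.r ∘ α) (mapsTo_inter c.mapsTo α x hx)).symm)

end Trivialization

end RelGerbeOn

theorem Ger.mk_refine (g : RelativeGerbe Φ) (ρ : Cover.Refinement g.cover c) :
    Ger.mk ⟨c, g.data.refine ρ⟩ = Ger.mk g :=
  (Quot.sound ⟨ρ, .refl _⟩).symm

theorem Ger.mk_eq_of_isomorphic {D K : RelGerbeOn Φ c} (h : D.Isomorphic K) :
    Ger.mk ⟨c, D⟩ = Ger.mk ⟨c, K⟩ := by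
  obtain ⟨f, e, h⟩ := h
  exact Quot.sound ⟨.id c, f, e, h⟩

end Trivialization

/-! ### Existence of unitary sections on a refinement -/

section LocalSections

variable {E H : Type*} [NormedAddCommGroup E] [NormedSpace ℝ E] [TopologicalSpace H]
  {I : ModelWithCorners ℝ E H} {X : Type*} [TopologicalSpace X] [ChartedSpace H X]

open HermLine

/-- The unitary section `s ⊗ t⁻¹` of `L`, for a unitary section `s` of `L ⊗ K`. -/
def UnitarySection.divRight {L K : HermLineBundle I X} (s : UnitarySection (L.tensor K))
    (t : UnitarySection K) : UnitarySection L :=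
  .ofContMDiffAt (fun x => HermLine.divRight (s.val x) (t.val x)) fun a =>
    ((s.contMDiffAt_frame a).mul (t.contMDiffAt_frame a).inv).congr_of_eventuallyEq
      (.of_forall fun _ => ratio_divRight _ _ _ _)

/-- The unitary section `s⁻¹ ⊗ t` of `K`, for a unitary section `t` of `L ⊗ K`. -/
def UnitarySection.divLeft {L K : HermLineBundle I X} (t : UnitarySection (L.tensor K))
    (s : UnitarySection L) : UnitarySection K :=
  .ofContMDiffAt (fun x => HermLine.divLeft (t.val x) (s.val x)) fun a =>
    ((t.contMDiffAt_frame a).mul (s.contMDiffAt_frame a).inv).congr_of_eventuallyEq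
      (.of_forall fun _ => ratio_divLeft _ _ _ _)

/-- The unitary section `s⁻¹` of `L`, for a unitary section `s` of `L⁻¹`. -/
def UnitarySection.ofDual {L : HermLineBundle I X} (s : UnitarySection L.dual) :
    UnitarySection L :=
  .ofContMDiffAt (fun x => HermLine.ofDual (s.val x)) fun a =>
    (s.contMDiffAt_frame a).inv.congr_of_eventuallyEq (.of_forall fun _ => ratio_ofDual _ _)

variable {ι : Type*} {V : ι → Opens X} {n : ℕ}

/-- The bundle `L_β` of a family has a unitary section over the open set `O`. -/
def BundleFamily.HasSection (L : BundleFamily I V n) (O : Opens X) (β : Fin n → ι) : Prop :=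
  ∃ h : O ≤ inter V β, Nonempty (UnitarySection ((L β).pullback (inclMap I h)))

namespace BundleFamily.HasSection

theorem mono {L : BundleFamily I V n} {O O' : Opens X} {β : Fin n → ι} (h : L.HasSection O β)
    (h' : O' ≤ O) : L.HasSection O' β := by
  obtain ⟨h, ⟨s⟩⟩ := h
  exact ⟨h'.trans h, ⟨s.pullback (inclMap I h')⟩⟩

theorem of_isEmpty (L : BundleFamily I V n) {O : Opens X} (h : ∀ x, x ∉ O) (β : Fin n → ι) :
    L.HasSection O β := by
  have : IsEmpty O := ⟨fun x => h x.1 x.2⟩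
  exact ⟨fun x hx => (h x hx).elim, ⟨⟨fun x => isEmptyElim x, fun x => isEmptyElim x⟩⟩⟩

/-- The bundles of a family have unitary sections near every point. -/
theorem exists_mem (L : BundleFamily I V n) {x : X} {β : Fin n → ι} (hx : x ∈ inter V β) :
    ∃ O : Opens X, x ∈ O ∧ L.HasSection O β := by
  let D := (L β).dom ⟨x, hx⟩
  have hD : IsOpen ((↑) '' (D : Set (inter V β)) : Set X) :=
    (inter V β).isOpen.isOpenMap_subtype_val _ D.isOpen
  have hle : (⟨_, hD⟩ : Opens X) ≤ inter V β := by
    rintro _ ⟨y, -, rfl⟩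
    exact y.2
  refine ⟨⟨_, hD⟩, ⟨⟨x, hx⟩, (L β).mem_dom _, rfl⟩, hle, ⟨⟨fun y =>
    (L β).frame ⟨x, hx⟩ (inclMap I hle y), fun a => ?_⟩⟩⟩
  refine ((L β).smooth ⟨x, hx⟩ (inclMap I hle a)).comp (inclMap I hle).contMDiff.contMDiffOn
    fun y hy => ⟨?_, hy⟩
  obtain ⟨⟨z, hz⟩, hzD, rfl⟩ : ∃ z : inter V β, z ∈ D ∧ z.1 = y.1 := y.2
  exact hzD

/-- The open set `O` is chosen for all `y`, and is empty if `y ∉ V j`. -/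
theorem exists_nhds (L : BundleFamily I V 1) (j : ι) (y : X) :
    ∃ O : Opens X, (y ∈ V j → y ∈ O) ∧ L.HasSection O fun _ => j := by
  by_cases hy : y ∈ V j
  · obtain ⟨O, hO, h⟩ := exists_mem L (β := fun _ => j) (mem_inter.2 fun _ => hy)
    exact ⟨O, fun _ => hO, h⟩
  · exact ⟨⊥, fun h => absurd h hy, of_isEmpty _ (O := ⊥) (fun x h => Set.notMem_empty x h) _⟩

/-- A bundle on the single sets `V_j` has unitary sections over the open sets which are
contained in a neighbourhood where it has one. -/
theorem nonempty_of_le {L : BundleFamily I V 1} {O O' : Opens X} {α : Fin 1 → ι}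
    (h : L.HasSection O fun _ => α 0) (hO : O' ≤ O) : L.HasSection O' α := by
  have e : (fun _ => α 0) = α := funext fun m => congrArg α (Subsingleton.elim 0 m)
  exact e ▸ h.mono hO

end BundleFamily.HasSection

namespace Gerbe

variable (G : Gerbe I V) {O : Opens X} {i j k : ι}

/-- The restriction of `θ` to an open set. -/
def restrictθ (γ : Fin 3 → ι) (h : O ≤ inter V γ) : UnitarySection
    ((((G.L (γ ∘ Fin.succAbove 0)).pullback (inclMap I (h.trans (inter_le_face V γ 0)))).tensor
      ((G.L (γ ∘ Fin.succAbove 1)).pullback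
        (inclMap I (h.trans (inter_le_face V γ 1)))).dual).tensor
      ((G.L (γ ∘ Fin.succAbove 2)).pullback (inclMap I (h.trans (inter_le_face V γ 2))))) :=
  .ofContMDiffAt (fun x => (G.θ γ).val (inclMap I h x))
    fun a => ((G.θ γ).pullback (inclMap I h)).contMDiffAt_frame a

theorem vec_face_zero : ![i, j, k] ∘ Fin.succAbove 0 = ![j, k] := by
  funext m
  fin_cases m <;> rfl

theorem vec_face_one : ![i, j, k] ∘ Fin.succAbove 1 = ![i, k] := by
  funext m
  fin_cases m <;> rfl

theorem vec_face_two : ![i, j, k] ∘ Fin.succAbove 2 = ![i, j] := by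
  funext m
  fin_cases m <;> rfl

variable {G}

/-- Unitary sections of `L_{j k}` and `L_{i j}` give one of `L_{i k}`, by means of `θ`. -/
theorem hasSection_trans (h₀ : G.L.HasSection O ![j, k]) (h₂ : G.L.HasSection O ![i, j]) :
    G.L.HasSection O ![i, k] := by
  have h : O ≤ inter V ![i, j, k] := fun x hx => mem_inter.2 fun m => by
    fin_cases m
    · exact mem_inter.1 (h₂.1 hx) 0
    · exact mem_inter.1 (h₂.1 hx) 1
    · exact mem_inter.1 (h₀.1 hx) 1
  rw [← vec_face_zero (i := i)] at h₀
  rw [← vec_face_two (k := k)] at h₂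
  rw [← vec_face_one (j := j)]
  obtain ⟨_, ⟨s₀⟩⟩ := h₀
  obtain ⟨_, ⟨s₂⟩⟩ := h₂
  exact ⟨_, ⟨(((G.restrictθ _ h).divRight s₂).divLeft s₀).ofDual⟩⟩

/-- Unitary sections of `L_{i k}` and `L_{i j}` give one of `L_{j k}`, by means of `θ`. -/
theorem hasSection_of_common (h₁ : G.L.HasSection O ![i, k]) (h₂ : G.L.HasSection O ![i, j]) :
    G.L.HasSection O ![j, k] := by
  have h : O ≤ inter V ![i, j, k] := fun x hx => mem_inter.2 fun m => by
    fin_cases m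
    · exact mem_inter.1 (h₂.1 hx) 0
    · exact mem_inter.1 (h₂.1 hx) 1
    · exact mem_inter.1 (h₁.1 hx) 1
  rw [← vec_face_one (j := j)] at h₁
  rw [← vec_face_two (k := k)] at h₂
  rw [← vec_face_zero (i := i)]
  obtain ⟨_, ⟨s₁⟩⟩ := h₁
  obtain ⟨_, ⟨s₂⟩⟩ := h₂
  exact ⟨_, ⟨((G.restrictθ _ h).divRight s₂).divRight s₁.dual⟩⟩

/-- For every gerbe there are neighbourhoods `W_j y` of the points `y ∈ V_j` such that the line
bundles `L_{j j'}` have unitary sections on the intersections of the sets `V_j ∩ W_j y`.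

A point-finite refinement `P_j` of the cover gives a member `P_{k(y)} ∋ y` for each point `y`, and
`W_j y` is so small that `L_{k(y) j}`, and `L_{k(y) l}` and `L_{l k(y)}` for the finitely many `l`
with `y ∈ P_l`, have unitary sections over it. If `W_j y` and `W_{j'} y'` meet, then `y ∈
P_{k(y')}` or `y' ∈ P_{k(y)}` when the sets are small, and the section of `L_{k(y) k(y')}` which
this gives is composed with those of `L_{k(y) j}` and `L_{k(y') j'}` by means of `θ`. -/
theorem exists_nhds_hasSection [FiniteDimensional ℝ E] [T2Space X] [SigmaCompactSpace X]
    (G : Gerbe I V) (hV : ∀ y, ∃ j, y ∈ V j) :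
    ∃ W : ι → X → Opens X, (∀ j y, y ∈ V j → y ∈ W j y) ∧
      ∀ (α : Fin 2 → ι × X) (O : Opens X), (∀ m, O ≤ W (α m).1 (α m).2) →
        G.L.HasSection O (Prod.fst ∘ α) := by
  have := Manifold.locallyCompact_of_finiteDimensional (M := X) I
  have := Manifold.metrizableSpace I X
  let _ := metrizableSpaceMetric X
  obtain ⟨P, hPo, hPc, hPf, hPV⟩ := precise_refinement (fun j => (V j : Set X))
    (fun j => (V j).isOpen) (Set.eq_univ_of_forall fun y => Set.mem_iUnion.2 (hV y))
  have h1 : ∀ y, ∃ k, y ∈ P k := fun y => by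
    simpa using (Set.ext_iff.1 hPc y).2 (Set.mem_univ y)
  choose k hk using h1
  have h2 : ∀ y, ∃ r : ℝ, 0 < r ∧ Metric.ball y (3 * r) ⊆ P (k y) := fun y => by
    obtain ⟨ε, hε, h⟩ := Metric.isOpen_iff.1 (hPo (k y)) y (hk y)
    exact ⟨ε / 3, by positivity, by rwa [mul_div_cancel₀ _ (by norm_num)]⟩
  choose r hr hrP using h2
  have h3 : ∀ y, ∃ D : Opens X, y ∈ D ∧ (D : Set X) ⊆ Metric.ball y (r y) ∧
      ∀ l, y ∈ P l → G.L.HasSection D ![k y, l] ∧ G.L.HasSection D ![l, k y] := fun y => by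
    have h : ∀ l, ∃ O : Opens X, y ∈ O ∧
        (y ∈ P l → G.L.HasSection O ![k y, l] ∧ G.L.HasSection O ![l, k y]) := fun l => by
      by_cases hl : y ∈ P l
      · obtain ⟨O, hO, h⟩ := BundleFamily.HasSection.exists_mem G.L
          (mem_inter_two (hPV _ (hk y)) (hPV l hl))
        obtain ⟨O', hO', h'⟩ := BundleFamily.HasSection.exists_mem G.L
          (mem_inter_two (hPV l hl) (hPV _ (hk y)))
        exact ⟨O ⊓ O', ⟨hO, hO'⟩, fun _ => ⟨h.mono inf_le_left, h'.mono inf_le_right⟩⟩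
      · exact ⟨⊤, trivial, fun h => absurd h hl⟩
    choose O hO hsec using h
    have hfin : {l | y ∈ P l}.Finite := hPf.point_finite y
    let D : Opens X := ⟨⋂ l ∈ {l | y ∈ P l}, (O l : Set X),
      hfin.isOpen_biInter fun l _ => (O l).isOpen⟩
    refine ⟨D ⊓ ⟨_, Metric.isOpen_ball⟩, ⟨Set.mem_iInter₂.2 fun l _ => hO l,
      Metric.mem_ball_self (hr y)⟩, fun x hx => hx.2, fun l hl => ?_⟩
    have hle : D ⊓ ⟨Metric.ball y (r y), Metric.isOpen_ball⟩ ≤ O l := fun x hx =>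
      Set.mem_iInter₂.1 hx.1 l hl
    exact ⟨(hsec l hl).1.mono hle, (hsec l hl).2.mono hle⟩
  choose D hyD hDr hDsec using h3
  have h4 : ∀ j y, ∃ W : Opens X, (y ∈ V j → y ∈ W) ∧ W ≤ D y ∧
      G.L.HasSection W ![k y, j] := fun j y => by
    by_cases hy : y ∈ V j
    · obtain ⟨O, hO, h⟩ := BundleFamily.HasSection.exists_mem G.L (mem_inter_two (hPV _ (hk y)) hy)
      exact ⟨D y ⊓ O, fun _ => ⟨hyD y, hO⟩, inf_le_left, h.mono inf_le_right⟩
    · exact ⟨⊥, fun h => absurd h hy, bot_le,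
        .of_isEmpty _ (O := ⊥) (fun x h => Set.notMem_empty x h) _⟩
  choose W hyW hWD hWsec using h4
  refine ⟨W, hyW, fun α O hO => ?_⟩
  by_cases hne : ∃ p, p ∈ O
  · obtain ⟨p, hp⟩ := hne
    have hOD : ∀ m, O ≤ D (α m).2 := fun m => (hO m).trans (hWD _ _)
    have e0 : dist p (α 0).2 < r (α 0).2 := hDr _ (hOD 0 hp)
    have e1 : dist p (α 1).2 < r (α 1).2 := hDr _ (hOD 1 hp)
    -- A section of `L_{k(y) k(y')}` comes from the point with the smaller radius.
    have hkk : G.L.HasSection O ![k (α 0).2, k (α 1).2] := by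
      rcases le_total (r (α 0).2) (r (α 1).2) with hle | hle
      · refine (hDsec (α 0).2 (k (α 1).2) (hrP _ ?_)).1.mono (hOD 0)
        have := dist_triangle_left (α 0).2 (α 1).2 p
        rw [Metric.mem_ball]
        linarith [hr (α 1).2]
      · refine (hDsec (α 1).2 (k (α 0).2) (hrP _ ?_)).2.mono (hOD 1)
        have := dist_triangle_left (α 1).2 (α 0).2 p
        rw [Metric.mem_ball]
        linarith [hr (α 0).2]
    have h := hasSection_of_common (hasSection_trans ((hWsec _ _).mono (hO 1)) hkk)
      ((hWsec _ _).mono (hO 0))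
    have e : Prod.fst ∘ α = ![(α 0).1, (α 1).1] := by
      funext m
      fin_cases m <;> rfl
    rwa [e]
  · exact .of_isEmpty _ (fun p hp => hne ⟨p, hp⟩) _

end Gerbe

end LocalSections

section Exists

variable {E H : Type*} [NormedAddCommGroup E] [NormedSpace ℝ E] [TopologicalSpace H]
  {I : ModelWithCorners ℝ E H} {M : Type u} [TopologicalSpace M] [ChartedSpace H M]
  {E' H' : Type*} [NormedAddCommGroup E'] [NormedSpace ℝ E'] [TopologicalSpace H']
  {I' : ModelWithCorners ℝ E' H'} {N : Type u} [TopologicalSpace N] [ChartedSpace H' N]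
  {Φ : C^∞⟮I, M; I', N⟯} {c : Cover Φ}

/-- Every relative gerbe has unitary sections on a refinement of its cover. -/
theorem RelGerbeOn.exists_trivialization [FiniteDimensional ℝ E'] [T2Space N]
    [SigmaCompactSpace N] (D : RelGerbeOn Φ c) :
    ∃ S : c.Shrinking, Nonempty (D.refine (S.ref Φ.contMDiff.continuous)).Trivialization := by
  obtain ⟨W, hW, h⟩ := D.G.exists_nhds_hasSection c.cover_V
  choose W' hW' hsec using BundleFamily.HasSection.exists_nhds D.Q.E
  let S : c.Shrinking := ⟨W, W', hW, hW'⟩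
  have hσ : ∀ α, Nonempty (UnitarySection
      ((D.refine (S.ref Φ.contMDiff.continuous)).G.L α)) := fun α =>
    (h α (inter (S.cover Φ.contMDiff.continuous).V α) fun m y hy => (mem_inter.1 hy m).2).2
  have hlam : ∀ α, Nonempty (UnitarySection
      ((D.refine (S.ref Φ.contMDiff.continuous)).Q.E α)) := fun α =>
    (BundleFamily.HasSection.nonempty_of_le (hsec _ (α 0).2.2)
      (O' := inter (S.cover Φ.contMDiff.continuous).U α) fun x hx => (mem_inter.1 hx 0).2).2
  exact ⟨S, ⟨⟨fun α => (hσ α).some, fun α => (hlam α).some⟩⟩⟩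

end Exists

/-! ### The relative gerbe of a cocycle -/

section Coordinates

variable {E H : Type*} [NormedAddCommGroup E] [NormedSpace ℝ E] [TopologicalSpace H]
  {I : ModelWithCorners ℝ E H} {X : Type*} [TopologicalSpace X] [ChartedSpace H X] {ι : Type*}
  {U : ι → Opens X} {x : X}

open HermLine

variable (I) in
/-- The family of trivial line bundles. -/
def BundleFamily.trivial (U : ι → Opens X) (n : ℕ) : BundleFamily I U n :=
  fun _ => HermLineBundle.trivial I _

variable (I) in
/-- The unitary sections `1` of the trivial line bundles. -/
def SectionFamily.one (U : ι → Opens X) (n : ℕ) : SectionFamily (BundleFamily.trivial I U n) :=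
  fun _ => UnitarySection.one I _

/-- The condition `δ θ = 1` may be checked in the coordinates given by one family `σ`. -/
theorem SectionFamily.delta3_eq {L : BundleFamily I U 2} (θ : SectionFamily L.delta2)
    (σ τ : VectorFamily L x) (β : Fin 4 → ι) (h : x ∈ inter U β)
    (hθ : θ.coord2 σ (β ∘ Fin.succAbove 0) (inter_le_face U β 0 h) -
      θ.coord2 σ (β ∘ Fin.succAbove 1) (inter_le_face U β 1 h) +
      θ.coord2 σ (β ∘ Fin.succAbove 2) (inter_le_face U β 2 h) -
      θ.coord2 σ (β ∘ Fin.succAbove 3) (inter_le_face U β 3 h) = 0) :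
    (θ.at x).delta3 β h = τ.delta2.delta3 β h := by
  refine (ratio_eq_one.1 ((VectorFamily.ratio_delta3 _ _ β h).trans ?_)).trans
    (VectorFamily.delta3_delta2 σ τ β h)
  refine Additive.ofMul.injective ?_
  simp only [← div_eq_mul_inv, ofMul_mul, ofMul_div, ofMul_one]
  exact hθ

/-- The condition `δ ψ = θ` may be checked in the coordinates given by one family of unit
vectors. -/
theorem SectionFamily.ratio_delta2_quasi {G : Gerbe I U} {K : BundleFamily I U 1}
    (ψ : SectionFamily (K.quasi G.L)) (lam lam' : VectorFamily K x) (σ τ : VectorFamily G.L x)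
    (β : Fin 3 → ι) (h : x ∈ inter U β)
    (hψ : ψ.coordQuasi lam σ (β ∘ Fin.succAbove 0) (inter_le_face U β 0 h) -
      ψ.coordQuasi lam σ (β ∘ Fin.succAbove 1) (inter_le_face U β 1 h) +
      ψ.coordQuasi lam σ (β ∘ Fin.succAbove 2) (inter_le_face U β 2 h) = G.θ.coord2 σ β h) :
    ratio ((ψ.at x).delta2 β h) ((lam'.quasi τ).delta2 β h) =
      ratio (G.θ.at x β h) (τ.delta2 β h) := by
  rw [← ratio_mul _ ((lam.quasi σ).delta2 β h) _,
    VectorFamily.ratio_quasi_delta2, ← ratio_mul (G.θ.at x β h) (σ.delta2 β h)]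
  refine congrArg (· * _) ((VectorFamily.ratio_delta2 _ _ β h).trans ?_)
  refine Additive.ofMul.injective ?_
  simp only [← div_eq_mul_inv, ofMul_mul, ofMul_div]
  exact hψ

/-- The gerbe of a Čech cocycle `t`: the line bundles are trivial, and the coordinates of `θ` are
`t⁻¹`. -/
def Gerbe.ofCocycle (t : (circlePresheaf I X).Cochain U 2)
    (ht : (circlePresheaf I X).d U 2 t = 0) : Gerbe I U where
  L := BundleFamily.trivial I U 2
  θ α := (SectionFamily.delta2 (SectionFamily.one I U 2) α).smul (fun y => ((-t α).1 y).toMul)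
    (-t α).2
  delta_θ x σ β h := by
    have ht' : ((circlePresheaf I X).d U 2 t β).1 ⟨x, h⟩ = 0 := by
      rw [ht]
      rfl
    rw [FunctionPresheaf.d_apply_two] at ht'
    refine SectionFamily.delta3_eq _ ((SectionFamily.one I U 2).at x) σ β h ?_
    have e : ∀ α (hα : x ∈ inter U α), SectionFamily.coord2 (fun α => (SectionFamily.delta2
        (SectionFamily.one I U 2) α).smul (fun y => ((-t α).1 y).toMul) (-t α).2)
        ((SectionFamily.one I U 2).at x) α hα = -(t α).1 ⟨x, hα⟩ :=
      fun α hα => congrArg Additive.ofMul (ratio_smul _ _)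
    rw [e, e, e, e]
    refine Eq.trans ?_ ((congrArg Neg.neg ht').trans neg_zero)
    abel

end Coordinates

section OfCocycle

variable {E H : Type*} [NormedAddCommGroup E] [NormedSpace ℝ E] [TopologicalSpace H]
  {I : ModelWithCorners ℝ E H} {M : Type u} [TopologicalSpace M] [ChartedSpace H M]
  {E' H' : Type*} [NormedAddCommGroup E'] [NormedSpace ℝ E'] [TopologicalSpace H']
  {I' : ModelWithCorners ℝ E' H'} {N : Type u} [TopologicalSpace N] [ChartedSpace H' N]
  {Φ : C^∞⟮I, M; I', N⟯} {c c' : Cover Φ}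

open HermLine

namespace RelGerbeOn

-- Unification must not unfold the lines: all computations with unit vectors use their ratios.
attribute [local irreducible] HermLine.tensor HermLine.dual HermLine.Unit HermLine.ratio
  HermLine.tmul HermLine.inv

theorem snd_cocycle (w : (circleCoeff Φ).Cocycle c 0) :
    (circlePresheaf I' N).d c.V 2 w.1.2 = 0 :=
  congrArg Prod.snd (show (circleCoeff Φ).relD c 1 w.1 = 0 from w.2)

/-- The sections `ψ` of `RelGerbeOn.ofCocycle`. -/
def ψOfCocycle (s : (circlePresheaf I M).Cochain c.U 1) : SectionFamily
    ((BundleFamily.trivial I c.U 1).quasi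
      ((BundleFamily.trivial I' c.V 2).pullback Φ c.mapsTo)) :=
  fun α => (SectionFamily.quasi (SectionFamily.one I c.U 1)
    ((SectionFamily.one I' c.V 2).pullback Φ c.mapsTo) α).smul (fun x => ((-s α).1 x).toMul)
      (-s α).2

theorem coordQuasi_ψOfCocycle (s : (circlePresheaf I M).Cochain c.U 1) (x : M) (α : Fin 2 → c.I)
    (h : x ∈ inter c.U α) :
    (ψOfCocycle (Φ := Φ) s).coordQuasi ((SectionFamily.one I c.U 1).at x)
      (((SectionFamily.one I' c.V 2).at (Φ x)).pullback c.mapsTo) α h = -(s α).1 ⟨x, h⟩ :=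
  congrArg Additive.ofMul (ratio_smul _ _)

/-- The relative gerbe of a relative cocycle `(s, t)`: the line bundles are trivial, and the
coordinates of `ψ` and `θ` are `s⁻¹` and `t⁻¹`. -/
def ofCocycle (w : (circleCoeff Φ).Cocycle c 0) : RelGerbeOn Φ c where
  G := Gerbe.ofCocycle w.1.2 (snd_cocycle w)
  Q :=
    { E := BundleFamily.trivial I c.U 1
      ψ := ψOfCocycle w.1.1
      delta_ψ := fun x lam σ β h => by
        have hw : ((circleCoeff Φ).relD c 1 w.1).1 β = 0 :=
          congrFun (congrArg Prod.fst (show (circleCoeff Φ).relD c 1 w.1 = 0 from w.2)) β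
        have hw' : (((circleCoeff Φ).relD c 1 w.1).1 β).1 ⟨x, h⟩ = 0 := by
          rw [hw]
          rfl
        rw [Coeff.relD_fst_apply, FunctionPresheaf.d_apply_one, sub_eq_zero] at hw'
        refine SectionFamily.ratio_delta2_quasi
          (G := (Gerbe.ofCocycle w.1.2 (snd_cocycle w)).pullback Φ c.mapsTo) _
          ((SectionFamily.one I c.U 1).at x) lam
          (((SectionFamily.one I' c.V 2).at (Φ x)).pullback c.mapsTo) σ β h ?_
        have e := coordQuasi_ψOfCocycle (Φ := Φ) w.1.1 x
        refine Eq.trans (congrArg₂ (· + ·) (congrArg₂ (· - ·) (e _ _) (e _ _)) (e _ _)) ?_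
        refine Eq.trans ?_ (congrArg Additive.ofMul (ratio_smul _ _)).symm
        refine Eq.trans ?_ (congrArg Neg.neg hw').symm
        abel }

/-- The sections `1` of the line bundles of `ofCocycle w`. -/
def ofCocycleTrivialization (w : (circleCoeff Φ).Cocycle c 0) :
    (ofCocycle w).Trivialization where
  σ := SectionFamily.one I' c.V 2
  lam := SectionFamily.one I c.U 1

theorem cocycle_ofCocycleTrivialization (w : (circleCoeff Φ).Cocycle c 0) :
    (ofCocycleTrivialization w).cocycle = w := by
  refine Subtype.ext (Coeff.RelCochain.ext (fun α x => ?_) fun α y => ?_)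
  · refine ((ofCocycleTrivialization w).cochain_fst α x).trans
      ((congrArg Neg.neg (coordQuasi_ψOfCocycle (Φ := Φ) w.1.1 x.1 α x.2)).trans ?_)
    exact neg_neg _
  · refine ((ofCocycleTrivialization w).cochain_snd α y).trans
      ((congrArg Neg.neg (congrArg Additive.ofMul (ratio_smul _ _))).trans ?_)
    exact neg_neg _

end RelGerbeOn

end OfCocycle

/-! ### Trivial relative gerbes -/

section Difference

variable {E H : Type*} [NormedAddCommGroup E] [NormedSpace ℝ E] [TopologicalSpace H]
  {I : ModelWithCorners ℝ E H} {X : Type*} [TopologicalSpace X] [ChartedSpace H X] {ι : Type*}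
  {U : ι → Opens X}

open HermLine

theorem HermLine.diff_self {A : HermLine} (u : A.Unit) : diff u u = 0 :=
  congrArg Additive.ofMul (ratio_self u)

theorem HermLine.diff_add_diff {A : HermLine} (u v w : A.Unit) : diff u v + diff v w = diff u w :=
  congrArg Additive.ofMul (ratio_mul u v w)

/-- The change of the coordinate of a unit vector of `A ⊗ B⁻¹`. -/
theorem HermLine.diff_tmul_inv {A B : HermLine} (w : (A.tensor B.dual).Unit) (u u' : A.Unit)
    (v v' : B.Unit) : diff w (tmul u' (inv v')) =
      diff w (tmul u (inv v)) + (diff u u' + -diff v v') := by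
  have e : diff (tmul u (inv v)) (tmul u' (inv v')) = diff u u' + -diff v v' :=
    congrArg Additive.ofMul ((ratio_tmul _ _ _ _).trans (congrArg _ (ratio_inv _ _)))
  rw [← diff_add_diff w (tmul u (inv v)), e]

variable {K K' : BundleFamily I U 1} {L : BundleFamily I U 2}

/-- For unitary sections `u` of `E ⊗ E'⁻¹`, and sections `ψ` and `ψ'` of `(δ E)⁻¹ ⊗ L` and
`(δ E')⁻¹ ⊗ L`, the equation `δ u = ψ⁻¹ ⊗ ψ'` in the coordinates given by unit vectors
of `E`, `E'` and `L` at a point. -/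
def DifferenceAt (ψ : SectionFamily (K.quasi L)) (ψ' : SectionFamily (K'.quasi L)) {x : X}
    (u : VectorFamily (fun α => (K α).tensor (K' α).dual) x) (lam : VectorFamily K x)
    (lam' : VectorFamily K' x) (σ : VectorFamily L x) (α : Fin 2 → ι) (h : x ∈ inter U α) : Prop :=
  diff (u.face α 0 h) (tmul (lam.face α 0 h) (inv (lam'.face α 0 h))) -
      diff (u.face α 1 h) (tmul (lam.face α 1 h) (inv (lam'.face α 1 h))) =
    ψ'.coordQuasi lam' σ α h - ψ.coordQuasi lam σ α h

/-- The equation `δ u = ψ⁻¹ ⊗ ψ'` does not depend on the coordinates. -/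
theorem DifferenceAt.congr {ψ : SectionFamily (K.quasi L)} {ψ' : SectionFamily (K'.quasi L)} {x : X}
    {u : VectorFamily (fun α => (K α).tensor (K' α).dual) x} {lam : VectorFamily K x}
    {lam' : VectorFamily K' x} {σ : VectorFamily L x} {α : Fin 2 → ι} {h : x ∈ inter U α}
    (H : DifferenceAt ψ ψ' u lam lam' σ α h) (μ : VectorFamily K x) (μ' : VectorFamily K' x)
    (τ : VectorFamily L x) : DifferenceAt ψ ψ' u μ μ' τ α h := by
  have key : ∀ k, diff (u.face α k h) (tmul (μ.face α k h) (inv (μ'.face α k h))) =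
      diff (u.face α k h) (tmul (lam.face α k h) (inv (lam'.face α k h))) +
        (diff (lam.face α k h) (μ.face α k h) + -diff (lam'.face α k h) (μ'.face α k h)) :=
    fun k => diff_tmul_inv (u.face α k h) (lam.face α k h) (μ.face α k h) (lam'.face α k h)
      (μ'.face α k h)
  refine (congrArg₂ (· - ·) (key 0) (key 1)).trans ((add_sub_add_comm _ _ _ _).trans ?_)
  refine (congrArg (· + _) H).trans ?_
  rw [ψ.coordQuasi_eq lam μ σ τ, ψ'.coordQuasi_eq lam' μ' σ τ]
  abel

/-- The multiplicative form of the equation `δ u = ψ⁻¹ ⊗ ψ'`. -/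
theorem differenceAt_iff {ψ : SectionFamily (K.quasi L)} {ψ' : SectionFamily (K'.quasi L)} {x : X}
    {u : VectorFamily (fun α => (K α).tensor (K' α).dual) x} {lam : VectorFamily K x}
    {lam' : VectorFamily K' x} {σ : VectorFamily L x} {α : Fin 2 → ι} {h : x ∈ inter U α} :
    DifferenceAt ψ ψ' u lam lam' σ α h ↔
      ratio (u.delta1 α h) ((lam.tensor lam'.inv).delta1 α h) =
        (ratio (ψ.at x α h) (lam.quasi σ α h))⁻¹ * ratio (ψ'.at x α h) (lam'.quasi σ α h) := by
  rw [VectorFamily.ratio_delta1, ← div_eq_mul_inv, mul_comm _ (ratio (ψ'.at x α h) _),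
    ← div_eq_mul_inv]
  exact Iff.rfl

end Difference

section Trivial

variable {E H : Type*} [NormedAddCommGroup E] [NormedSpace ℝ E] [TopologicalSpace H]
  {I : ModelWithCorners ℝ E H} {M : Type u} [TopologicalSpace M] [ChartedSpace H M]
  {E' H' : Type*} [NormedAddCommGroup E'] [NormedSpace ℝ E'] [TopologicalSpace H']
  {I' : ModelWithCorners ℝ E' H'} {N : Type u} [TopologicalSpace N] [ChartedSpace H' N]
  {Φ : C^∞⟮I, M; I', N⟯} {c c' : Cover Φ}

open HermLine

namespace RelGerbeOn

-- Unification must not unfold the lines: all computations with unit vectors use their ratios.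
attribute [local irreducible] HermLine.tensor HermLine.dual HermLine.Unit HermLine.ratio
  HermLine.tmul HermLine.inv

variable {D : RelGerbeOn Φ c}

/-- The sections `ψ` of the pull-back `Φ^* R` of a quasi-line bundle. -/
def pullψ {D : RelGerbeOn Φ c} (R : QuasiLineBundle D.G) : SectionFamily
    ((R.E.pullback Φ c.mapsTo).quasi (D.G.L.pullback Φ c.mapsTo)) :=
  (R.pullback Φ c.mapsTo).ψ

/-- The line bundle `Q ⊗ (Φ^* R)⁻¹` has a unitary section if there are unitary sections of the
bundles `E_i ⊗ Φ^* E'_i⁻¹` which satisfy the gluing condition in one system of coordinates at each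
point. -/
theorem differenceHasSection_iff (R : QuasiLineBundle D.G) :
    D.Q.DifferenceHasSection (R.pullback Φ c.mapsTo) ↔
      ∃ u : SectionFamily (fun α => (D.Q.E α).tensor (R.E.pullback Φ c.mapsTo α).dual),
        ∀ (x : M) (α : Fin 2 → c.I) (h : x ∈ inter c.U α), ∃ lam lam' σ,
          DifferenceAt D.ψ (pullψ R) (u.at x) lam lam' σ α h := by
  constructor
  · rintro ⟨u, hu⟩
    exact ⟨u, fun x α h => ⟨.some _ _, .some _ _, .some _ _, differenceAt_iff.2 (hu x _ _ _ α h)⟩⟩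
  · rintro ⟨u, hu⟩
    refine ⟨u, fun x lam lam' σ α h => ?_⟩
    obtain ⟨_, _, _, H⟩ := hu x α h
    exact differenceAt_iff.1 (H.congr lam lam' σ)

/-- A relative gerbe with unitary sections for which `(s, t) = 1` is trivial: the gerbe is
trivialized by trivial line bundles, with `ψ` given by the sections `σ`. -/
theorem Trivialization.isTrivial (T : D.Trivialization) (h : T.cochain = 0) :
    (RelativeGerbe.mk c D).IsTrivial := by
  have hM : ∀ (x : M) (α : Fin 2 → c.I) (hα : x ∈ inter c.U α),
      D.ψ.coordQuasi (T.lam.at x) ((T.σ.at (Φ x)).pullback c.mapsTo) α hα = 0 :=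
    fun x α hα => neg_eq_zero.1 ((T.cochain_fst α ⟨x, hα⟩).symm.trans (by rw [h]; rfl))
  have hN : ∀ (y : N) (α : Fin 3 → c.J) (hα : y ∈ inter c.V α),
      D.G.θ.coord2 (T.σ.at y) α hα = 0 :=
    fun y α hα => neg_eq_zero.1 ((T.cochain_snd α ⟨y, hα⟩).symm.trans (by rw [h]; rfl))
  let one := SectionFamily.one I' c.V 1
  have hψ : ∀ y α hα, (SectionFamily.quasi one T.σ).coordQuasi (one.at y) (T.σ.at y) α hα = 0 :=
    fun y α hα => diff_self _
  let R : QuasiLineBundle D.G :=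
    { E := BundleFamily.trivial I' c.V 1
      ψ := SectionFamily.quasi one T.σ
      delta_ψ := fun y lam σ β hβ => by
        refine SectionFamily.ratio_delta2_quasi _ (one.at y) lam (T.σ.at y) σ β hβ ?_
        rw [hψ, hψ, hψ, hN]
        abel }
  refine ⟨R, (differenceHasSection_iff (D := D) R).2
    ⟨fun α => (T.lam α).tensor (one.pullback Φ c.mapsTo α).dual, fun x α hα =>
      ⟨T.lam.at x, (one.at (Φ x)).pullback c.mapsTo, (T.σ.at (Φ x)).pullback c.mapsTo, ?_⟩⟩⟩
  have e := hψ (Φ x) (c.r ∘ α) (mapsTo_inter c.mapsTo α x hα)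
  refine Eq.trans ?_ (congrArg₂ (· - ·) e (hM x α hα)).symm
  exact (congrArg₂ (· - ·) (diff_self _) (diff_self _)).trans rfl

/-- Unitary sections of the line bundle `Q ⊗ (Φ^* R)⁻¹` restrict to refinements. -/
theorem differenceHasSection_refine {R : QuasiLineBundle D.G}
    (hR : D.Q.DifferenceHasSection (R.pullback Φ c.mapsTo)) (ρ : Cover.Refinement c c') :
    (D.refine ρ).Q.DifferenceHasSection
      (QuasiLineBundle.pullback (G := (D.refine ρ).G) (R.pullback ContMDiffMap.id ρ.V_le) Φ
        c'.mapsTo) := by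
  obtain ⟨u, hu⟩ := (differenceHasSection_iff (D := D) R).1 hR
  refine (differenceHasSection_iff (D := D.refine ρ) (R.pullback ContMDiffMap.id ρ.V_le)).2
    ⟨fun α => .ofContMDiffAt (fun x => (u (ρ.a ∘ α)).val
      (restrictMap ContMDiffMap.id (mapsTo_inter (f := id) ρ.le_a α) x)) fun a =>
      ((u (ρ.a ∘ α)).pullback (restrictMap ContMDiffMap.id
        (mapsTo_inter (f := id) ρ.le_a α))).contMDiffAt_frame a, fun x α hα => ?_⟩
  obtain ⟨lam, lam', σ, H⟩ := hu x (ρ.a ∘ α) (mapsTo_inter (f := id) ρ.le_a α x hα)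
  let σ₀ := VectorFamily.some D.G.L (Φ x)
  let μ₀ := VectorFamily.some R.E (Φ x)
  have H' := H.congr lam (μ₀.pullback c.mapsTo) (σ₀.pullback c.mapsTo)
  exact ⟨VectorFamily.pullback (f := ContMDiffMap.id) lam ρ.le_a,
    VectorFamily.pullback (VectorFamily.pullback (f := ContMDiffMap.id) μ₀ ρ.V_le) c'.mapsTo,
    VectorFamily.pullback (VectorFamily.pullback (f := ContMDiffMap.id) σ₀ ρ.V_le) c'.mapsTo, H'⟩

/-- If `(Q, G)` is trivialized by a quasi-line bundle `R`, and the line bundles of `Q`, `G` and `R`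
have unitary sections, then the cocycle `(s, t)` is a coboundary. -/
theorem Trivialization.cls_eq_zero (T : D.Trivialization) (R : QuasiLineBundle D.G)
    (hR : D.Q.DifferenceHasSection (R.pullback Φ c.mapsTo)) (r : SectionFamily R.E) :
    (circleCoeff Φ).cls c 0 T.cocycle = 0 := by
  obtain ⟨u, hu⟩ := (differenceHasSection_iff R).1 hR
  let v : SectionFamily (fun α => (D.Q.E α).tensor (R.E.pullback Φ c.mapsTo α).dual) :=
    fun α => (T.lam α).tensor (r.pullback Φ c.mapsTo α).dual
  let b : (circleCoeff Φ).onN.Cochain c.V 1 := fun α =>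
    ⟨fun y => Additive.ofMul (ratio ((SectionFamily.quasi r T.σ α).val y) ((R.ψ α).val y)),
      (SectionFamily.quasi r T.σ α).contMDiff_ratio (R.ψ α)⟩
  let a : (circleCoeff Φ).onM.Cochain c.U 0 := fun α =>
    ⟨fun x => Additive.ofMul (ratio ((v α).val x) ((u α).val x)), (v α).contMDiff_ratio (u α)⟩
  have hb : ∀ (y : N) (α : Fin 2 → c.J) (h : y ∈ inter c.V α),
      (b α).1 ⟨y, h⟩ = -R.ψ.coordQuasi (r.at y) (T.σ.at y) α h :=
    fun y α h => congrArg Additive.ofMul (inv_ratio _ _).symm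
  have ha : ∀ (x : M) (α : Fin 1 → c.I) (h : x ∈ inter c.U α),
      (a α).1 ⟨x, h⟩ = -diff (u.at x α h) (v.at x α h) :=
    fun x α h => congrArg Additive.ofMul (inv_ratio _ _).symm
  refine Coeff.cls_eq_zero (u := (a, b)) ?_
  refine Coeff.RelCochain.ext (fun α x => ?_) fun α y => ?_
  · obtain ⟨_, _, _, H⟩ := hu x.1 α x.2
    have H' : diff (u.at x.1 (α ∘ Fin.succAbove 0) (inter_le_face c.U α 0 x.2))
          (v.at x.1 (α ∘ Fin.succAbove 0) (inter_le_face c.U α 0 x.2)) -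
        diff (u.at x.1 (α ∘ Fin.succAbove 1) (inter_le_face c.U α 1 x.2))
          (v.at x.1 (α ∘ Fin.succAbove 1) (inter_le_face c.U α 1 x.2)) =
        R.ψ.coordQuasi (r.at (Φ x.1)) (T.σ.at (Φ x.1)) (c.r ∘ α)
          (mapsTo_inter c.mapsTo α x.1 x.2) -
        D.ψ.coordQuasi (T.lam.at x.1) ((T.σ.at (Φ x.1)).pullback c.mapsTo) α x.2 :=
      H.congr (T.lam.at x.1) ((r.at (Φ x.1)).pullback c.mapsTo)
        ((T.σ.at (Φ x.1)).pullback c.mapsTo)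
    refine Eq.trans ?_ (T.cochain_fst α x).symm
    refine (Coeff.relD_fst_apply _ α x).trans ?_
    rw [FunctionPresheaf.d_apply_zero, ha, ha, hb]
    rw [sub_eq_iff_eq_add] at H'
    refine Eq.trans (congrArg (fun z => _ - (-z - _)) H') ?_
    abel
  · refine Eq.trans ?_ (T.cochain_snd α y).symm
    refine (FunctionPresheaf.d_apply_one b α y).trans ?_
    rw [hb, hb, hb, ← R.coordQuasi_cocycle (r.at y.1) (T.σ.at y.1) α y.2]
    abel

end RelGerbeOn

end Trivial

/-! ### The class of a relative gerbe -/

section Classification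

variable {E H : Type*} [NormedAddCommGroup E] [NormedSpace ℝ E] [TopologicalSpace H]
  {I : ModelWithCorners ℝ E H} {M : Type u} [TopologicalSpace M] [ChartedSpace H M]
  {E' H' : Type*} [NormedAddCommGroup E'] [NormedSpace ℝ E'] [TopologicalSpace H']
  {I' : ModelWithCorners ℝ E' H'} {N : Type u} [TopologicalSpace N] [ChartedSpace H' N]
  {Φ : C^∞⟮I, M; I', N⟯} {c c' : Cover Φ}

open HermLine

/-- The neighbourhoods of points given by those of a coarser cover. -/
def Cover.Shrinking.pull {Φ : M → N} {c c' : Cover Φ} (S : c.Shrinking)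
    (ρ : Cover.Refinement c c') : c'.Shrinking where
  W j y := S.W (ρ.b j) y
  W' i x := S.W' (ρ.a i) x
  mem_W j _ h := S.mem_W _ _ (ρ.V_le j h)
  mem_W' i _ h := S.mem_W' _ _ (ρ.le_a i h)

/-- The cover of `S.pull ρ` refines that of `S`, by index maps for which the square of
refinements commutes. -/
def Cover.Shrinking.pullRef {Φ : M → N} {c c' : Cover Φ} (S : c.Shrinking) (hΦ : Continuous Φ)
    (ρ : Cover.Refinement c c') : Cover.Refinement (S.cover hΦ) ((S.pull ρ).cover hΦ) :=
  Cover.Shrinking.refOfLE hΦ ρ (fun _ _ => le_rfl) fun _ _ => le_rfl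

/-- The pull-back of an isomorphism of line bundles. -/
def HermLineBundle.Iso.pullback {L K : HermLineBundle I' N} (f : HermLineBundle.Iso L K)
    (g : C^∞⟮I, M; I', N⟯) : HermLineBundle.Iso (L.pullback g) (K.pullback g) where
  map x := f.map (g x)
  smooth a b := (f.smooth (g a) (g b)).comp g.contMDiff.contMDiffOn fun _ hx => hx

section Coord

variable {X : Type*} [TopologicalSpace X] [ChartedSpace H X] {ι : Type*}
  {U : ι → Opens X} {K K' : BundleFamily I U 1} {L L' : BundleFamily I U 2} {x : X}

/-- Whether isometries of the lines map `θ` to `θ'` may be checked on the coordinates given by one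
family `σ`. -/
theorem SectionFamily.coord2_map {θ : SectionFamily L.delta2} {θ' : SectionFamily L'.delta2}
    (f : ∀ α (h : x ∈ inter U α),
      ((L α).fibre ⟨x, h⟩).carrier ≃ₗᵢ[ℂ] ((L' α).fibre ⟨x, h⟩).carrier)
    (σ τ : VectorFamily L x) (α : Fin 3 → ι) (h : x ∈ inter U α)
    (e : θ.coord2 σ α h = θ'.coord2 (fun β hβ => (σ β hβ).map (f β hβ)) α h) :
    θ.coord2 τ α h = θ'.coord2 (fun β hβ => (τ β hβ).map (f β hβ)) α h := by
  have hf : ∀ β hβ, diff ((σ β hβ).map (f β hβ)) ((τ β hβ).map (f β hβ)) =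
      diff (σ β hβ) (τ β hβ) := fun β hβ => congrArg Additive.ofMul (ratio_map _ _ _)
  rw [θ.coord2_eq σ τ, θ'.coord2_eq (fun β hβ => (σ β hβ).map (f β hβ)), e]
  simp only [VectorFamily.face, hf]

/-- Whether isometries of the lines map `ψ` to `ψ'` may be checked on the coordinates given by one
family of unit vectors. -/
theorem SectionFamily.coordQuasi_map {ψ : SectionFamily (K.quasi L)}
    {ψ' : SectionFamily (K'.quasi L')}
    (e : ∀ α (h : x ∈ inter U α),
      ((K α).fibre ⟨x, h⟩).carrier ≃ₗᵢ[ℂ] ((K' α).fibre ⟨x, h⟩).carrier)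
    (f : ∀ α (h : x ∈ inter U α),
      ((L α).fibre ⟨x, h⟩).carrier ≃ₗᵢ[ℂ] ((L' α).fibre ⟨x, h⟩).carrier)
    (lam lam' : VectorFamily K x) (σ τ : VectorFamily L x) (α : Fin 2 → ι) (h : x ∈ inter U α)
    (H : ψ.coordQuasi lam σ α h = ψ'.coordQuasi (fun β hβ => (lam β hβ).map (e β hβ))
      (fun β hβ => (σ β hβ).map (f β hβ)) α h) :
    ψ.coordQuasi lam' τ α h = ψ'.coordQuasi (fun β hβ => (lam' β hβ).map (e β hβ))
      (fun β hβ => (τ β hβ).map (f β hβ)) α h := by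
  have hf : ∀ β hβ, diff ((σ β hβ).map (f β hβ)) ((τ β hβ).map (f β hβ)) =
      diff (σ β hβ) (τ β hβ) := fun β hβ => congrArg Additive.ofMul (ratio_map _ _ _)
  have he : ∀ β hβ, diff ((lam β hβ).map (e β hβ)) ((lam' β hβ).map (e β hβ)) =
      diff (lam β hβ) (lam' β hβ) := fun β hβ => congrArg Additive.ofMul (ratio_map _ _ _)
  rw [ψ.coordQuasi_eq lam lam' σ τ, ψ'.coordQuasi_eq (fun β hβ => (lam β hβ).map (e β hβ)) _
    (fun β hβ => (σ β hβ).map (f β hβ)), H]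
  simp only [VectorFamily.face, hf, he]

end Coord

namespace RelGerbeOn

-- Unification must not unfold the lines: all computations with unit vectors use their ratios.
attribute [local irreducible] HermLine.tensor HermLine.dual HermLine.Unit HermLine.ratio
  HermLine.tmul HermLine.inv

/-- Isomorphisms of relative gerbes restrict to refinements. -/
theorem Isomorphic.refine {D K : RelGerbeOn Φ c} (h : D.Isomorphic K)
    (ρ : Cover.Refinement c c') : (D.refine ρ).Isomorphic (K.refine ρ) := by
  obtain ⟨f, e, hθ, hψ⟩ := h
  let f' (α : Fin 2 → c'.J) : HermLineBundle.Iso ((D.refine ρ).G.L α) ((K.refine ρ).G.L α) :=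
    (f (ρ.b ∘ α)).pullback _
  let e' (α : Fin 1 → c'.I) : HermLineBundle.Iso ((D.refine ρ).Q.E α) ((K.refine ρ).Q.E α) :=
    (e (ρ.a ∘ α)).pullback _
  refine ⟨f', e', fun y σ α h => ?_, fun x lam σ α h => ?_⟩
  · let σ₀ := VectorFamily.some D.G.L y
    have H := congrArg Additive.ofMul
      (hθ y σ₀ (ρ.b ∘ α) (mapsTo_inter (f := id) ρ.V_le α y h))
    exact Additive.ofMul.injective (SectionFamily.coord2_map (θ := (D.refine ρ).G.θ)
      (θ' := (K.refine ρ).G.θ) (fun α h => (f' α).map ⟨y, h⟩)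
      (VectorFamily.pullback (f := ContMDiffMap.id) σ₀ ρ.V_le) σ α h H)
  · let σ₀ := VectorFamily.some D.G.L (Φ x)
    let lam₀ := VectorFamily.some D.Q.E x
    have H := congrArg Additive.ofMul
      (hψ x lam₀ σ₀ (ρ.a ∘ α) (mapsTo_inter (f := id) ρ.le_a α x h))
    exact Additive.ofMul.injective (SectionFamily.coordQuasi_map (ψ := (D.refine ρ).ψ)
      (ψ' := (K.refine ρ).ψ) (fun α h => (e' α).map ⟨x, h⟩)
      (fun α h => (f' (c'.r ∘ α)).map ⟨Φ x, mapsTo_inter c'.mapsTo α x h⟩)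
      (VectorFamily.pullback (f := ContMDiffMap.id) lam₀ ρ.le_a) lam
      ((VectorFamily.pullback (f := ContMDiffMap.id) σ₀ ρ.V_le).pullback c'.mapsTo)
      (σ.pullback c'.mapsTo) α h H)

end RelGerbeOn

variable [FiniteDimensional ℝ E'] [T2Space N] [SigmaCompactSpace N]

namespace RelativeGerbe

/-- The class of a relative gerbe: that of the cocycle `(s, t)` for unitary sections of the line
bundles on some refinement. -/
def classOf (g : RelativeGerbe Φ) : H2U1 Φ :=
  (circleCoeff Φ).cls _ 0 g.data.exists_trivialization.choose_spec.some.cocycle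

/-- The class of a relative gerbe is that of `(s, t)` for all unitary sections on all
refinements. -/
theorem classOf_eq (g : RelativeGerbe Φ) (ρ : Cover.Refinement g.cover c)
    (T : (g.data.refine ρ).Trivialization) :
    g.classOf = (circleCoeff Φ).cls c 0 T.cocycle := by
  let S := g.data.exists_trivialization.choose
  let T₀ : (g.data.refine (S.ref Φ.contMDiff.continuous)).Trivialization :=
    g.data.exists_trivialization.choose_spec.some
  -- Both restrict to the cover of `S.pull ρ`, where they are related by a change of sections.
  obtain ⟨T₁, h₁⟩ := RelGerbeOn.Trivialization.exists_cocycle_eq (g.data.refine_refine _ _)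
    (T₀.refine (S.pullRef Φ.contMDiff.continuous ρ))
  obtain ⟨T₂, h₂⟩ := RelGerbeOn.Trivialization.exists_cocycle_eq (g.data.refine_refine _ _)
    (T.refine ((S.pull ρ).ref Φ.contMDiff.continuous))
  have e := T₁.cls_cocycle_eq (D := g.data.refine (ρ.comp ((S.pull ρ).ref _))) T₂
  rw [h₂, T.cls_refine] at e
  exact (T₀.cls_refine _).symm.trans ((congrArg _ h₁.symm).trans e)

theorem classOf_eq_cls (g : RelativeGerbe Φ) (T : g.data.Trivialization) :
    g.classOf = (circleCoeff Φ).cls g.cover 0 T.cocycle :=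
  (g.classOf_eq (.id g.cover) (T.refine (.id g.cover))).trans (T.cls_refine _)

theorem exists_refinement (g : RelativeGerbe Φ) : ∃ (c : Cover Φ)
    (ρ : Cover.Refinement g.cover c), Nonempty (g.data.refine ρ).Trivialization :=
  let ⟨_, h⟩ := g.data.exists_trivialization
  ⟨_, _, h⟩

theorem Refines.classOf_eq {g k : RelativeGerbe Φ} (h : g.Refines k) : g.classOf = k.classOf := by
  obtain ⟨ρ, h⟩ := h
  obtain ⟨S, ⟨T⟩⟩ := (g.data.refine ρ).exists_trivialization
  obtain ⟨T₁, h₁⟩ := RelGerbeOn.Trivialization.exists_cocycle_eq (g.data.refine_refine _ _) T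
  obtain ⟨T₂, h₂⟩ := RelGerbeOn.Trivialization.exists_cocycle_eq (h.refine _) T
  rw [g.classOf_eq _ T₁, k.classOf_eq _ T₂, h₁, h₂]

/-- On a common refinement, `(s, t)` of the products of sections is the product of the
cocycles. -/
theorem classOf_tensor (g k : RelativeGerbe Φ) : (g.tensor k).classOf = g.classOf + k.classOf := by
  obtain ⟨c, ρ, ⟨T⟩⟩ := g.exists_refinement
  obtain ⟨c', ρ', ⟨T'⟩⟩ := k.exists_refinement
  let T₁ := T.refine (c.prodFst c')
  let T₂ := T'.refine (c.prodSnd c')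
  obtain ⟨T'', e⟩ := RelGerbeOn.Trivialization.exists_cocycle_eq
    (RelGerbeOn.tensor_refine_prodMap g k ρ ρ') (T₁.tensor T₂)
  have e' : (T₁.tensor T₂).cocycle = T₁.cocycle + T₂.cocycle := Subtype.ext (T₁.cochain_tensor T₂)
  rw [classOf_eq _ _ T'', e, e', map_add, T.cls_refine, T'.cls_refine, ← classOf_eq, ← classOf_eq]

theorem classOf_dual (g : RelativeGerbe Φ) : g.dual.classOf = -g.classOf := by
  obtain ⟨c, ρ, ⟨T⟩⟩ := g.exists_refinement
  obtain ⟨T', e⟩ := RelGerbeOn.Trivialization.exists_cocycle_eq (g.data.dual_refine ρ) T.dual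
  have e' : T.dual.cocycle = -T.cocycle := Subtype.ext T.cochain_dual
  exact (classOf_eq g.dual ρ T').trans ((congrArg _ (e.trans e')).trans
    ((map_neg _ _).trans (congrArg Neg.neg (classOf_eq g ρ T).symm)))

/-- A relative gerbe whose class vanishes has unitary sections with `(s, t) = 1` on some
refinement. -/
theorem exists_cochain_eq_zero {g : RelativeGerbe Φ} (h : g.classOf = 0) :
    ∃ (c : Cover Φ) (ρ : Cover.Refinement g.cover c) (T : (g.data.refine ρ).Trivialization),
      T.cochain = 0 := by
  obtain ⟨c, ρ, ⟨T⟩⟩ := g.exists_refinement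
  rw [g.classOf_eq ρ T] at h
  obtain ⟨c', τ, u, hu⟩ := Coeff.exists_refine_eq_relD h
  have e : ((T.refine τ).smul (-u)).cochain = 0 := by
    rw [RelGerbeOn.Trivialization.cochain_smul, map_neg, hu, T.cochain_refine]
    exact add_neg_cancel _
  obtain ⟨T', hT'⟩ := RelGerbeOn.Trivialization.exists_cocycle_eq (g.data.refine_refine ρ τ)
    ((T.refine τ).smul (-u))
  exact ⟨c', ρ.comp τ, T', (congrArg Subtype.val hT').trans e⟩

/-- Relative gerbes with the same class are isomorphic on some common refinement. -/
theorem mk_eq_of_classOf_eq {g k : RelativeGerbe Φ} (h : g.classOf = k.classOf) :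
    Ger.mk g = Ger.mk k := by
  obtain ⟨c, ρ, ⟨T⟩⟩ := g.exists_refinement
  obtain ⟨c', ρ', ⟨T'⟩⟩ := k.exists_refinement
  let T₁ := T.refine (c.prodFst c')
  let T₂ := T'.refine (c.prodSnd c')
  have h0 : (circleCoeff Φ).cls (c.prod c') 0 (T₁.cocycle - T₂.cocycle) = 0 := by
    rw [map_sub, T.cls_refine, T'.cls_refine, ← g.classOf_eq ρ T, ← k.classOf_eq ρ' T', h, sub_self]
  obtain ⟨d, τ, u, hu⟩ := Coeff.exists_refine_eq_relD h0
  have e : (T₁.refine τ).cochain = ((T₂.refine τ).smul u).cochain := by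
    rw [RelGerbeOn.Trivialization.cochain_smul, hu, map_sub]
    exact (add_sub_cancel _ _).symm
  have e' := Ger.mk_eq_of_isomorphic (RelGerbeOn.Trivialization.isomorphic _ _ e)
  have key : ∀ {g : RelativeGerbe Φ} {c d e : Cover Φ} (ρ : Cover.Refinement g.cover c)
      (σ : Cover.Refinement c d) (τ : Cover.Refinement d e),
      Ger.mk ⟨e, ((g.data.refine ρ).refine σ).refine τ⟩ = Ger.mk g := fun ρ σ τ =>
    (Ger.mk_refine ⟨_, _⟩ τ).trans ((Ger.mk_refine ⟨_, _⟩ σ).trans (Ger.mk_refine _ ρ))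
  exact (key ρ _ τ).symm.trans (e'.trans (key ρ' _ τ))

/-- The class of a trivial relative gerbe vanishes. -/
theorem IsTrivial.classOf_eq_zero {g : RelativeGerbe Φ} (h : g.IsTrivial) : g.classOf = 0 := by
  obtain ⟨c, ρ, ⟨T⟩⟩ := g.exists_refinement
  obtain ⟨R, hR⟩ := h
  -- The line bundles of `R` have unitary sections on a further refinement.
  let R₁ : QuasiLineBundle (g.data.refine ρ).G := R.pullback ContMDiffMap.id ρ.V_le
  choose W hW hsec using BundleFamily.HasSection.exists_nhds R₁.E
  let S : c.Shrinking := ⟨W, fun _ _ => ⊤, hW, fun _ _ _ => _root_.trivial⟩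
  let τ := S.ref Φ.contMDiff.continuous
  let R₂ : QuasiLineBundle ((g.data.refine ρ).refine τ).G := R₁.pullback ContMDiffMap.id τ.V_le
  have hr : ∀ α, Nonempty (UnitarySection (R₂.E α)) := fun α =>
    (BundleFamily.HasSection.nonempty_of_le (hsec _ (α 0).2)
      (O' := inter (S.cover Φ.contMDiff.continuous).V α) fun x hx => (mem_inter.1 hx 0).2).2
  rw [g.classOf_eq ρ T, ← T.cls_refine τ]
  exact (T.refine τ).cls_eq_zero R₂ (RelGerbeOn.differenceHasSection_refine
    (RelGerbeOn.differenceHasSection_refine hR ρ) τ) fun α => (hr α).some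

theorem classOf_ofCocycle (w : (circleCoeff Φ).Cocycle c 0) :
    (RelativeGerbe.mk c (.ofCocycle w)).classOf = (circleCoeff Φ).cls c 0 w := by
  rw [classOf_eq_cls _ (RelGerbeOn.ofCocycleTrivialization w),
    RelGerbeOn.cocycle_ofCocycleTrivialization]

end RelativeGerbe

variable (Φ) in
/-- Relative gerbes are classified by `H²(Φ, U(1))`. -/
def gerEquiv : Ger Φ ≃ H2U1 Φ :=
  Equiv.ofBijective (Quot.lift RelativeGerbe.classOf fun _ _ h => h.classOf_eq) <| by
    constructor
    · rintro ⟨g⟩ ⟨k⟩ h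
      exact RelativeGerbe.mk_eq_of_classOf_eq h
    · intro x
      obtain ⟨c, w, rfl⟩ := Coeff.exists_cls x
      exact ⟨Ger.mk ⟨c, .ofCocycle w⟩, RelativeGerbe.classOf_ofCocycle w⟩

/-- `Ger_0(Φ)` consists of the single class of relative gerbes with class zero. -/
theorem mem_Ger0_iff {x : Ger Φ} : x ∈ Ger0 Φ ↔ gerEquiv Φ x = 0 := by
  constructor
  · rintro ⟨g, rfl, hg⟩
    exact hg.classOf_eq_zero
  · intro h
    obtain ⟨g, rfl⟩ := Quot.exists_rep x
    obtain ⟨c, ρ, T, hT⟩ := RelativeGerbe.exists_cochain_eq_zero h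
    exact ⟨_, Ger.mk_refine g ρ, T.isTrivial hT⟩

theorem mk_mem_Ger0_iff {g : RelativeGerbe Φ} : Ger.mk g ∈ Ger0 Φ ↔
    ∃ (c : Cover Φ) (ρ : Cover.Refinement g.cover c),
      (RelativeGerbe.mk c (g.data.refine ρ)).IsTrivial := by
  refine ⟨fun h => ?_, fun ⟨c, ρ, h⟩ => ⟨_, Ger.mk_refine g ρ, h⟩⟩
  obtain ⟨c, ρ, T, hT⟩ := RelativeGerbe.exists_cochain_eq_zero (mem_Ger0_iff.1 h)
  exact ⟨c, ρ, T.isTrivial hT⟩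

end Classification

end RelGerbe

end

theorem mainTheorem1
    {EM : Type*} [NormedAddCommGroup EM] [NormedSpace ℝ EM] [FiniteDimensional ℝ EM]
    {HM : Type*} [TopologicalSpace HM] {IM : ModelWithCorners ℝ EM HM}
    {M : Type u} [TopologicalSpace M] [ChartedSpace HM M] [IsManifold IM ∞ M]
    [T2Space M] [SigmaCompactSpace M]
    {EN : Type*} [NormedAddCommGroup EN] [NormedSpace ℝ EN] [FiniteDimensional ℝ EN]
    {HN : Type*} [TopologicalSpace HN] {IN : ModelWithCorners ℝ EN HN}
    {N : Type u} [TopologicalSpace N] [ChartedSpace HN N] [IsManifold IN ∞ N]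
    [T2Space N] [SigmaCompactSpace N]
    (Φ : C^∞⟮IM, M; IN, N⟯) :
    ∃ (_ : AddCommGroup (RelGerbe.Ger Φ)) (κ : RelGerbe.Ger Φ →+ RelGerbe.H2U1 Φ)
      (e : RelGerbe.H2U1 Φ ≃+ RelGerbe.H3Z Φ),
      -- the group structure of `Ger(Φ)` is given by products and duals of relative gerbes
      (∀ g k : RelGerbe.RelativeGerbe Φ,
        RelGerbe.Ger.mk (g.tensor k) = RelGerbe.Ger.mk g + RelGerbe.Ger.mk k) ∧
      (∀ g : RelGerbe.RelativeGerbe Φ, RelGerbe.Ger.mk g.dual = -RelGerbe.Ger.mk g) ∧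
      -- `κ` maps a relative gerbe to the class of `(s, t)`, for every choice of unitary sections
      (∀ (g : RelGerbe.RelativeGerbe Φ) (σ : RelGerbe.SectionFamily g.data.G.L)
        (lam : RelGerbe.SectionFamily g.data.Q.E),
        ∃ h : (g.cochainM σ lam, g.cochainN σ) ∈ (RelGerbe.circleCoeff Φ).Cocycle g.cover 0,
          κ (RelGerbe.Ger.mk g) = (RelGerbe.circleCoeff Φ).cls g.cover 0 ⟨_, h⟩) ∧
      -- after a refinement of the cover, such unitary sections exist
      (∀ g : RelGerbe.RelativeGerbe Φ, ∃ k : RelGerbe.RelativeGerbe Φ,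
        RelGerbe.Ger.mk k = RelGerbe.Ger.mk g ∧
          Nonempty (RelGerbe.SectionFamily k.data.G.L) ∧
          Nonempty (RelGerbe.SectionFamily k.data.Q.E)) ∧
      -- `e` is the connecting homomorphism of the exponential sequence
      (∀ (c : RelGerbe.Cover Φ) (f : (RelGerbe.realCoeff Φ).RelCochain c 1)
        (w : (RelGerbe.circleCoeff Φ).Cocycle c 0) (z : (RelGerbe.intCoeff Φ).Cocycle c 1),
        w.1 = RelGerbe.expCochain f →
        RelGerbe.realCochain z.1 = (RelGerbe.realCoeff Φ).relD c 1 f →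
        e ((RelGerbe.circleCoeff Φ).cls c 0 w) = (RelGerbe.intCoeff Φ).cls c 1 z) ∧
      -- `κ` is onto, with kernel `Ger_0(Φ)`
      Function.Surjective κ ∧ (κ.ker : Set (RelGerbe.Ger Φ)) = RelGerbe.Ger0 Φ ∧
      -- the exact sequence `0 → Ger_0(Φ) → Ger(Φ) → H³(Φ, ℤ) → 0`
      Function.Surjective (e.toAddMonoidHom.comp κ) ∧
      ((e.toAddMonoidHom.comp κ).ker : Set (RelGerbe.Ger Φ)) = RelGerbe.Ger0 Φ ∧
      -- membership in `Ger_0(Φ)`, in terms of any representative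
      (∀ g : RelGerbe.RelativeGerbe Φ, RelGerbe.Ger.mk g ∈ RelGerbe.Ger0 Φ ↔
        ∃ (c : RelGerbe.Cover Φ) (ρ : RelGerbe.Cover.Refinement g.cover c),
          (RelGerbe.RelativeGerbe.mk c (g.data.refine ρ)).IsTrivial) ∧
      -- classification of relative gerbes by `H³(Φ, ℤ)`
      (∀ g k : RelGerbe.RelativeGerbe Φ,
        e (κ (RelGerbe.Ger.mk g)) = e (κ (RelGerbe.Ger.mk k)) ↔
          RelGerbe.Ger.mk (g.tensor k.dual) ∈ RelGerbe.Ger0 Φ) := by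
  let γ := RelGerbe.gerEquiv Φ
  let _ : AddCommGroup (RelGerbe.Ger Φ) := γ.addCommGroup
  let κ : RelGerbe.Ger Φ ≃+ RelGerbe.H2U1 Φ := γ.addEquiv
  let e := RelGerbe.connectingEquiv Φ
  have hκ : ∀ g : RelGerbe.RelativeGerbe Φ, κ (RelGerbe.Ger.mk g) = g.classOf := fun _ => rfl
  have tensor_mk : ∀ g k : RelGerbe.RelativeGerbe Φ,
      RelGerbe.Ger.mk (g.tensor k) = RelGerbe.Ger.mk g + RelGerbe.Ger.mk k := fun g k =>
    κ.injective (by rw [map_add, hκ, hκ, hκ, g.classOf_tensor])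
  have dual_mk : ∀ g : RelGerbe.RelativeGerbe Φ,
      RelGerbe.Ger.mk g.dual = -RelGerbe.Ger.mk g := fun g =>
    κ.injective (by rw [map_neg, hκ, hκ, g.classOf_dual])
  have mem_Ger0 : ∀ x : RelGerbe.Ger Φ, x ∈ RelGerbe.Ger0 Φ ↔ κ x = 0 :=
    fun x => RelGerbe.mem_Ger0_iff
  refine ⟨inferInstance, κ.toAddMonoidHom, e, tensor_mk, dual_mk, fun g σ lam => ?_, fun g => ?_,
    fun c f w z hw hz => ?_, κ.surjective, ?_, e.surjective.comp κ.surjective, ?_,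
    fun g => RelGerbe.mk_mem_Ger0_iff, fun g k => ?_⟩
  · let T : g.data.Trivialization := ⟨σ, lam⟩
    exact ⟨T.cocycle.2, g.classOf_eq_cls T⟩
  · obtain ⟨c, ρ, ⟨T⟩⟩ := g.exists_refinement
    exact ⟨⟨c, g.data.refine ρ⟩, RelGerbe.Ger.mk_refine g ρ, ⟨T.σ⟩, ⟨T.lam⟩⟩
  · exact RelGerbe.connectingEquiv_cls ⟨f, hw ▸ RelGerbe.isExp_expCochain f,
      hz ▸ RelGerbe.isCast_realCochain z.1⟩
  · ext x
    exact (mem_Ger0 x).symm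
  · ext x
    refine Iff.trans ?_ (mem_Ger0 x).symm
    exact e.map_eq_zero_iff
  · rw [mem_Ger0, tensor_mk, dual_mk, ← sub_eq_add_neg, map_sub, sub_eq_zero]
    exact e.injective.eq_iff
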